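/- Let $n\ge 2$, let $z_0,\dots,z_{n-1}\in\mathbb C$ be pairwise distinct, $z_n=\infty$, $d=n-2$. Let $j_r\in-\frac12+\mathrm i\mathbb R$ for $r=1,\dots,n$, let $j_0\in\mathbb C$ with $-1<\mathrm{Re}\,j_0<0$ (in particular $j_0\in-\frac12+\mathrm i\mathbb R$ is allowed), and put $\boldsymbol j'=(j_0,j_1,\dots,j_n)$, $\boldsymbol j''=(-j_0-1,j_1,\dots,j_n)$. Let $i\in\{0,1\}$, $j_{n,0}=j_n$, $j_{n,1}=-j_n-1$. Translation invariant functions or tempered distributions $\Psi(x_0,\dots,x_{n-1})$ are represented by their restriction to $x_1=0$, in the variables $(x_0,x_2,\dots,x_{n-1})\in\mathbb C^{d+1}$; functions are identified with the regular distributions they define. The dual variables are $(k_0,k_2,\dots,k_{n-1})$, with $k_1:=-\sum_{r\ne1}k_r$, and the distributional Fourier transform $\widetilde\Psi$ is taken with respect to the kernel $\prod_{r\neq 1}e^{-2\mathrm i\,\mathrm{Im}(k_rx_r)}$. Let $\rho(\boldsymbol k)=\sum_{r=0}^{n-1} z_rk_r$ and, for $\boldsymbol y=(y_1,\dots,y_d)$,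 $$\kappa_r(\boldsymbol y)=\frac{\prod_{k=1}^{d}(z_r-y_k)}{\prod_{s\ne r}(z_r-z_s)}\quad(r=0,\dots,n-1),$$ where $s$ runs over $0,\dots,n-1$. Let $\mathcal H_{\rm Skl}$ be the space of symmetric functions in $L^2(\mathbb C^{d},d\mu_{\rm Skl})$, $$d\mu_{\rm Skl}(\boldsymbol y)=d^{2d}\boldsymbol y\prod_{0\le r<s\le n-1}|z_r-z_s|^2\prod_{k<l}|y_k-y_l|^2\prod_{r=0}^{n-1}|\kappa_r(\boldsymbol y)|^{-2}.$$ For a tempered distribution $\Psi$ whose Fourier transform $\widetilde\Psi$ is a function, write $\mathsf S^{(n+1)}_{\boldsymbol j',i}\Psi=\phi$ if $$|\rho(\boldsymbol k)|^{-2(j_{n,i}+1)}\prod_{r=0}^{n-1}|k_r|^{2j_r+2}\,\widetilde\Psi(\boldsymbol k)\Big|_{k_r=\rho\,\kappa_r(\boldsymbol y)}=\phi(\boldsymbol y)\qquad\text{for a.e. }(\boldsymbol y,\rho)\in\mathbb C^d\times\mathbb C ,$$ and similarly for $\boldsymbol j''$. Let $\mathsf R_{j_0}$ be the integral operator in the variable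 $x_0$ $$(\mathsf R_{j_0}\Psi)(x_0',x_1,\dots)=-\frac{2j_0+1}{\pi}\int_{\mathbb C}d^2x_0\,|x_0-x_0'|^{-4j_0-4}\,\Psi(x_0,x_1,\dots),$$ where the kernel $-\frac{2j_0+1}{\pi}|u|^{-4j_0-4}$ is the homogeneous distribution obtained by analytic continuation from $\mathrm{Re}\,j_0<-\frac12$, and the integral over large $|x_0-x_0'|$ is the weak limit $L\to\infty$ of the integrals with a factor $\eta(|x_0-x_0'|/L)$, for any smooth $\eta:\mathbb R\to\mathbb R$ with $\eta(t)=1$ for $t\le1$ and $\eta(t)=0$ for $t\ge2$. Then for every $\phi\in\mathcal H_{\rm Skl}$ there are unique tempered distributions $(\mathsf S^{(n+1)}_{\boldsymbol j',i})^{-1}\phi$ and $(\mathsf S^{(n+1)}_{\boldsymbol j'',i})^{-1}\phi$ whose images under $\mathsf S^{(n+1)}_{\boldsymbol j',i}$, respectively $\mathsf S^{(n+1)}_{\boldsymbol j'',i}$, are $\phi$; the limit defining $\mathsf R_{j_0}(\mathsf S^{(n+1)}_{\boldsymbol j',i})^{-1}\phi$ exists, and $$\mathsf R_{j_0}\big(\mathsf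 S^{(n+1)}_{\boldsymbol j',i}\big)^{-1}\phi=\frac{\Gamma(-2j_0)}{\Gamma(2j_0+2)}\big(\mathsf S^{(n+1)}_{\boldsymbol j'',i}\big)^{-1}\phi .$$ -/

import Mathlib

open scoped ContDiff SchwartzMap BigOperators
open MeasureTheory Filter Topology

noncomputable section

/-!
Setting.  `z : Fin (d + 2) → ℂ` are the finite punctures `z_0, …, z_{n-1}`, with `n = d + 2`; the
remaining puncture is `z_n = ∞`, so that there are `n + 1` punctures and `d = (n + 1) - 3`
separated variables `y`.

A translation invariant function of `x_0, …, x_{n-1}` is represented by its restriction to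
`x_1 = 0`, a function of the `d + 1` variables `(x_0, x_2, …, x_{n-1})`, which are indexed by
`Fin (d + 1)`; the index `r` stands for the puncture `(1 : Fin (d + 2)).succAbove r`, so that
`x 0` is the variable `x_0`.  The dual variables `(k_0, k_2, …, k_{n-1})` are indexed in the same
way, and `k_1` is determined by `∑ k_r = 0`.
-/

namespace SoV

/-- The pairing `∑_r k_r x_r` over the indices `r ≠ 1`. -/
def pair {d : ℕ} (k x : Fin (d + 1) → ℂ) : ℂ := ∑ r, k r * x r

/-- All `n` dual variables `k_0, …, k_{n-1}`, with `k_1 = -∑_{r ≠ 1} k_r`. -/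
def allK {d : ℕ} (k : Fin (d + 1) → ℂ) : Fin (d + 2) → ℂ :=
  Fin.insertNth (α := fun _ => ℂ) 1 (-∑ r, k r) k

/-- `ρ(k) = ∑_r z_r k_r`. -/
def rho {d : ℕ} (z : Fin (d + 2) → ℂ) (k : Fin (d + 1) → ℂ) : ℂ :=
  ∑ r, z r * allK k r

/-- `κ_r(y) = ∏_k (z_r - y_k) / ∏_{s ≠ r} (z_r - z_s)`. -/
def kappa {d : ℕ} (z : Fin (d + 2) → ℂ) (y : Fin d → ℂ) (r : Fin (d + 2)) : ℂ :=
  (∏ k, (z r - y k)) / ∏ s ∈ Finset.univ.erase r, (z r - z s)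

/-- Sklyanin's change of variables `k_r(y, ρ) = ρ κ_r(y)`, for the indices `r ≠ 1`. -/
def kOfY {d : ℕ} (z : Fin (d + 2) → ℂ) (y : Fin d → ℂ) (ρ : ℂ) : Fin (d + 1) → ℂ :=
  fun r => ρ * kappa z y ((1 : Fin (d + 2)).succAbove r)

/-- The Sklyanin measure on `ℂ^d`. -/
def muSkl {d : ℕ} (z : Fin (d + 2) → ℂ) : Measure (Fin d → ℂ) :=
  volume.withDensity fun y => ENNReal.ofReal
    ((∏ r, ∏ s ∈ Finset.Ioi r, ‖z r - z s‖ ^ 2) *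
      (∏ k, ∏ l ∈ Finset.Ioi k, ‖y k - y l‖ ^ 2) *
      ∏ r, 1 / ‖kappa z y r‖ ^ 2)

/-- `φ` represents a (symmetric) element of `H_Skl = L²(ℂ^d, dμ_Skl)`.  Since `k(y, ρ)` is symmetric
in `y_1, …, y_d`, so are all functions in the image of the SoV transformation. -/
def MemSkl {d : ℕ} (z : Fin (d + 2) → ℂ) (φ : (Fin d → ℂ) → ℂ) : Prop :=
  MemLp φ 2 (muSkl z) ∧
    ∀ σ : Equiv.Perm (Fin d), ∀ᵐ y ∂(volume : Measure (Fin d → ℂ)), φ (y ∘ σ) = φ y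

/-- `j_{n,i}`: equal to `j_n` for `i = 0` and to `-j_n - 1` for `i = 1`. -/
def jInf (jn : ℂ) (i : Fin 2) : ℂ := if i = 0 then jn else -jn - 1

/-- The factor `|ρ(k)|^{-2(j_{n,i}+1)} ∏_r |k_r|^{2 j_r + 2}` of the twisted Fourier
transformation `F_{j,i}`. -/
def twist {d : ℕ} (z : Fin (d + 2) → ℂ) (j : Fin (d + 2) → ℂ) (jn : ℂ) (i : Fin 2)
    (k : Fin (d + 1) → ℂ) : ℂ :=
  (‖rho z k‖ : ℂ) ^ (-2 * (jInf jn i + 1)) * ∏ r, (‖allK k r‖ : ℂ) ^ (2 * j r + 2)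

/-- The Fourier transform of the tempered distribution `T`, for the Fourier kernel
`exp(-2 i Im ∑ k_r x_r)`, is the regular distribution given by the function `Ψt`: for every
Schwartz function `g`, with Fourier transform `f`, one has `⟨T, f⟩ = ∫ Ψt g`. -/
def HasFourierTransform {d : ℕ} (T : 𝓢'(Fin (d + 1) → ℂ, ℂ)) (Ψt : (Fin (d + 1) → ℂ) → ℂ) : Prop :=
  ∀ g : 𝓢(Fin (d + 1) → ℂ, ℂ),
    Integrable (fun k => Ψt k * g k) ∧
    ∃ f : 𝓢(Fin (d + 1) → ℂ, ℂ),
      (∀ x, f x = ∫ k, g k * Complex.exp (-2 * Complex.I * ((pair k x).im : ℂ))) ∧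
      T f = ∫ k, Ψt k * g k

/-- `S_{j,i} T = φ`: the Fourier transform `Ψt` of `T` is a function, and the twisted Fourier
transform `F_{j,i} T = twist * Ψt`, expressed in the variables `(y, ρ)`, is the function `φ(y)`.
A translation invariant function `Ψ(x)` is identified with the regular distribution it defines. -/
def IsSoVTransform {d : ℕ} (z : Fin (d + 2) → ℂ) (j : Fin (d + 2) → ℂ) (jn : ℂ) (i : Fin 2)
    (T : 𝓢'(Fin (d + 1) → ℂ, ℂ)) (φ : (Fin d → ℂ) → ℂ) : Prop :=
  ∃ Ψt : (Fin (d + 1) → ℂ) → ℂ, HasFourierTransform T Ψt ∧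
    ∀ᵐ p : (Fin d → ℂ) × ℂ,
      twist z j jn i (kOfY z p.1 p.2) * Ψt (kOfY z p.1 p.2) = φ p.1

/-- The kernel `-(2j+1)/π |u|^{-4j-4}` as a homogeneous distribution on `ℂ`, for `-1 < Re j < 0`,
evaluated on `h`.  For `Re j < -1/2` the kernel is locally integrable and this is just
`-(2j+1)/π ∫ |u|^{-4j-4} h(u) d²u`; in general it is the analytic continuation in `j` of that
integral, obtained by subtracting `h(0)` on the unit disc and adding it back, using
`-(2j+1)/π ∫_{|u|<1} |u|^{-4j-4} d²u = 1`. -/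
def kernelDist (j : ℂ) (h : ℂ → ℂ) : ℂ :=
  h 0 - (2 * j + 1) / (Real.pi : ℂ) *
    ((1 / 2) * (∫ u in Metric.ball (0 : ℂ) 1,
        (‖u‖ : ℂ) ^ (-4 * j - 4) * (h u + h (-u) - 2 * h 0)) +
      ∫ u in (Metric.ball (0 : ℂ) 1)ᶜ, (‖u‖ : ℂ) ^ (-4 * j - 4) * h u)

/-- `R_j T = T'`, where `R_j` is the integral operator in the variable `x_0` with kernel
`-(2j+1)/π |x_0 - x_0'|^{-4j-4}`.  The kernel is cut off smoothly at `|x_0 - x_0'| ∼ L`; the cut-off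
operator is symmetric, maps Schwartz functions `f` to Schwartz functions `g L`, and so acts on
tempered distributions by transposition; `R_j T` is the limit for `L → ∞`, for every choice of the
cut-off function `η`. -/
def IsReflection {d : ℕ} (j : ℂ) (T T' : 𝓢'(Fin (d + 1) → ℂ, ℂ)) : Prop :=
  ∀ η : ℝ → ℝ, ContDiff ℝ ∞ η → (∀ t ≤ 1, η t = 1) → (∀ t ≥ 2, η t = 0) →
    ∀ f : 𝓢(Fin (d + 1) → ℂ, ℂ), ∃ g : ℝ → 𝓢(Fin (d + 1) → ℂ, ℂ),
      (∀ L > 0, ∀ x, g L x =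
        kernelDist j (fun u => (η (‖u‖ / L) : ℂ) * f (x + Pi.single 0 u))) ∧
      Tendsto (fun L => T (g L)) atTop (𝓝 (T' f))

end SoV

end

/-! On the Fourier side both transformations are explicit: multiply by `twist`, then read the result
in the variables `(y, ρ)`. Replacing `j_0` by `-j_0 - 1` changes the twist only through the power of
`|k_0|`, so the two inverse images of the same `φ` have Fourier transforms related by `Ψ'' =
|k_0|^(4 j_0 + 2) Ψ'`. The operator `R_{j_0}` is a convolution in `x_0`, and the Fourier transform
of its kernel is `Γ(-2 j_0) / Γ(2 j_0 + 2) · |ξ|^(4 j_0 + 2)`. Comparing the two multipliers gives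
the theorem. What remains is to justify existence, uniqueness and the limit.

Uniqueness (`IsSoVTransform.unique`): by partial fractions every `k` with `ρ(k) ≠ 0` comes from some
`(y, ρ)`, unique up to permuting `y`, and the change of variables sends null sets to null sets. So
`φ` fixes the Fourier transform almost everywhere.

Existence (`exists_isSoVTransform`): the candidate Fourier transform is `φ / twist`. The Jacobian of
the change of variables is, up to a constant, `|ρ|^(2d)` times the squared Vandermonde product,
which is what the Sklyanin measure needs. A Cauchy-Schwarz estimate then bounds the candidate
against a polynomial weight, by the norm of `φ` and an integral of powers of `|k_0|` and `|ρ|` that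
converges because `-1 < Re j_0 < 0`.

Kernel (`kernelDist_eq`): `|u|^(-2α)`, with `α = 2 j_0 + 2`, is a superposition of Gaussians. The
regularization turns the Gaussian Fourier transform into `subExp`, whose Mellin transform is
computed by integration by parts, uniformly across `α = 1`.

Limit (`isReflection_of_fourier`): a cut-off at scale `L` replaces `|k_0|^(4 j_0 + 2)` by its
mollification at scale `1 / L`. The mollifications are bounded by a constant times `1 + |k_0|^(4 Re
j_0 + 2)`, uniformly in `L ≥ 1`, and both `Ψ'` and `Ψ''` are integrable against Schwartz functions,
so dominated convergence applies. -/

noncomputable section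

namespace SoV

/-! ### Sklyanin's variables by Lagrange interpolation -/

open Polynomial

/-- The monic polynomial with roots `y`. -/
def nodePoly {d : ℕ} (y : Fin d → ℂ) : ℂ[X] := ∏ k, (X - C (y k))

lemma eval_nodePoly {d : ℕ} (y : Fin d → ℂ) (w : ℂ) : (nodePoly y).eval w = ∏ k, (w - y k) := by
  simp [nodePoly, eval_prod]

lemma monic_nodePoly {d : ℕ} (y : Fin d → ℂ) : (nodePoly y).Monic :=
  monic_prod_of_monic _ _ fun k _ => monic_X_sub_C (y k)

lemma natDegree_nodePoly {d : ℕ} (y : Fin d → ℂ) : (nodePoly y).natDegree = d := by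
  simp [nodePoly, natDegree_prod_of_monic _ _ fun k _ => monic_X_sub_C (y k)]

lemma degree_nodePoly {d : ℕ} (y : Fin d → ℂ) : (nodePoly y).degree = d := by
  rw [degree_eq_natDegree (monic_nodePoly y).ne_zero, natDegree_nodePoly]

/-- The sum is the coefficient of `X ^ (d + 1)` in the Lagrange interpolant of `nodePoly y` at the
`d + 2` nodes `z`, and this polynomial has degree only `d`. -/
lemma sum_kappa {d : ℕ} {z : Fin (d + 2) → ℂ} (hz : Function.Injective z) (y : Fin d → ℂ) :
    ∑ r, kappa z y r = 0 := by
  have h := Lagrange.coeff_eq_sum (s := Finset.univ) (v := z) hz.injOn (P := nodePoly y)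
    (by rw [degree_nodePoly, Finset.card_univ, Fintype.card_fin]; exact_mod_cast (by omega))
  simp only [eval_nodePoly] at h
  rw [coeff_eq_zero_of_natDegree_lt
    (by rw [natDegree_nodePoly, Finset.card_univ, Fintype.card_fin]; omega)] at h
  exact h.symm

/-- Same interpolation formula for `X * nodePoly y`, whose coefficient of `X ^ (d + 1)` is its
leading coefficient. -/
lemma sum_mul_kappa {d : ℕ} {z : Fin (d + 2) → ℂ} (hz : Function.Injective z) (y : Fin d → ℂ) :
    ∑ r, z r * kappa z y r = 1 := by
  have hn : (X * nodePoly y).natDegree = d + 1 := by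
    rw [natDegree_X_mul (monic_nodePoly y).ne_zero, natDegree_nodePoly]
  have h := Lagrange.coeff_eq_sum (s := Finset.univ) (v := z) hz.injOn (P := X * nodePoly y)
    (by rw [degree_eq_natDegree (mul_ne_zero X_ne_zero (monic_nodePoly y).ne_zero), hn,
          Finset.card_univ, Fintype.card_fin]; exact_mod_cast (by omega))
  simp only [eval_mul, eval_X, eval_nodePoly, Finset.card_univ, Fintype.card_fin] at h
  rw [show d + 2 - 1 = d + 1 from rfl, coeff_X_mul,
    show (nodePoly y).coeff d = 1 by
      have h := monic_nodePoly y
      rwa [Monic, leadingCoeff, natDegree_nodePoly] at h] at h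
  rw [h]
  exact Finset.sum_congr rfl fun r _ => (mul_div_assoc _ _ _).symm

lemma allK_succAbove {d : ℕ} (k : Fin (d + 1) → ℂ) (r : Fin (d + 1)) :
    allK k ((1 : Fin (d + 2)).succAbove r) = k r := by
  simp [allK]

lemma allK_zero {d : ℕ} (k : Fin (d + 1) → ℂ) : allK k 0 = k 0 := by
  conv_lhs => rw [show (0 : Fin (d + 2)) = (1 : Fin (d + 2)).succAbove 0 by simp]
  exact allK_succAbove k 0

lemma allK_one {d : ℕ} (k : Fin (d + 1) → ℂ) : allK k 1 = -∑ r, k r := by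
  simp [allK]

lemma sum_allK {d : ℕ} (k : Fin (d + 1) → ℂ) : ∑ r, allK k r = 0 := by
  rw [Fin.sum_univ_succAbove _ 1, allK_one]; simp [allK_succAbove]

lemma eq_of_allK_eq {d : ℕ} {k k' : Fin (d + 1) → ℂ} (h : allK k = allK k') : k = k' := by
  funext r; rw [← allK_succAbove k r, h, allK_succAbove]

/-- The index `1`, which `kOfY` omits, follows the same formula because the `kappa z y r` sum to
zero. -/
lemma allK_kOfY {d : ℕ} {z : Fin (d + 2) → ℂ} (hz : Function.Injective z) (y : Fin d → ℂ) (ρ : ℂ)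
    (r : Fin (d + 2)) : allK (kOfY z y ρ) r = ρ * kappa z y r := by
  rcases Fin.eq_self_or_eq_succAbove 1 r with rfl | ⟨s, rfl⟩
  · have h := sum_kappa hz y
    rw [Fin.sum_univ_succAbove _ 1] at h
    rw [allK_one, eq_neg_of_add_eq_zero_left h]
    simp [kOfY, Finset.mul_sum]
  · rw [allK_succAbove]; rfl

lemma rho_kOfY {d : ℕ} {z : Fin (d + 2) → ℂ} (hz : Function.Injective z) (y : Fin d → ℂ) (ρ : ℂ) :
    rho z (kOfY z y ρ) = ρ := by
  simp only [rho, allK_kOfY hz]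
  calc ∑ r, z r * (ρ * kappa z y r) = ρ * ∑ r, z r * kappa z y r := by
        rw [Finset.mul_sum]; exact Finset.sum_congr rfl fun r _ => by ring
    _ = ρ := by rw [sum_mul_kappa hz, mul_one]

lemma rho_eq_sum {d : ℕ} (z : Fin (d + 2) → ℂ) (k : Fin (d + 1) → ℂ) :
    rho z k = ∑ r, (z ((1 : Fin (d + 2)).succAbove r) - z 1) * k r := by
  rw [rho, Fin.sum_univ_succAbove _ 1, allK_one]
  simp only [allK_succAbove, sub_mul, Finset.sum_sub_distrib, ← Finset.mul_sum]
  ring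

lemma prod_erase_sub_ne_zero {ι : Type*} [Fintype ι] [DecidableEq ι] {z : ι → ℂ}
    (hz : Function.Injective z) (r : ι) : ∏ s ∈ Finset.univ.erase r, (z r - z s) ≠ 0 :=
  Finset.prod_ne_zero_iff.2 fun _ hs => sub_ne_zero.2 fun h => (Finset.ne_of_mem_erase hs) (hz h).symm

/-- Every `k` with `ρ(k) ≠ 0` is of the form `k(y, ρ)`. -/
lemma exists_kOfY_eq {d : ℕ} {z : Fin (d + 2) → ℂ} (hz : Function.Injective z)
    (k : Fin (d + 1) → ℂ) (hk : rho z k ≠ 0) : ∃ y, kOfY z y (rho z k) = k := by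
  set D : Fin (d + 2) → ℂ := fun r => ∏ s ∈ Finset.univ.erase r, (z r - z s) with hD
  have hD0 : ∀ r, D r ≠ 0 := prod_erase_sub_ne_zero hz
  -- If `k = k(y, ρ)`, then `ρ ∏ (X - y_k)` has the value `k_r D r` at `z r`. So the `y_k` must be
  -- the roots of this interpolant. Its coefficient of `X ^ (d + 1)` is `∑ k_r = 0`, and that of `X
  -- ^ d` is `ρ(k)`.
  set P : ℂ[X] := Lagrange.interpolate Finset.univ z (fun r => allK k r * D r) with hP
  have hPe : ∀ r, P.eval (z r) = allK k r * D r := fun r =>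
    Lagrange.eval_interpolate_at_node _ hz.injOn (Finset.mem_univ r)
  have hPd : P.degree < (Finset.univ : Finset (Fin (d + 2))).card :=
    Lagrange.degree_interpolate_lt _ hz.injOn
  have hc1 : P.coeff (d + 1) = 0 := by
    have h := Lagrange.coeff_eq_sum (s := Finset.univ) (v := z) hz.injOn hPd
    rw [Finset.card_univ, Fintype.card_fin] at h
    rw [show d + 1 = d + 2 - 1 from rfl, h, ← sum_allK k]
    exact Finset.sum_congr rfl fun r _ => by rw [hPe]; exact mul_div_cancel_right₀ _ (hD0 r)
  have hdeg : P.natDegree < d + 1 := by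
    have h2 : P.natDegree < d + 2 := by
      rw [Finset.card_univ, Fintype.card_fin] at hPd
      rcases eq_or_ne P 0 with h0 | h0
      · rw [h0, natDegree_zero]; omega
      · exact (natDegree_lt_iff_degree_lt h0).2 (by exact_mod_cast hPd)
    rcases Nat.lt_succ_iff_lt_or_eq.1 h2 with h | h
    · exact h
    · exfalso
      rw [← h, coeff_natDegree, leadingCoeff_eq_zero] at hc1
      rw [hc1] at h; simp at h
  have hc0 : P.coeff d = rho z k := by
    have h := Lagrange.coeff_eq_sum (s := Finset.univ) (v := z) hz.injOn (P := X * P)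
      (by
        rw [Finset.card_univ, Fintype.card_fin]
        refine lt_of_le_of_lt (degree_le_of_natDegree_le (n := d + 1) ?_) (by exact_mod_cast (by omega))
        exact natDegree_mul_le.trans (by rw [natDegree_X]; omega))
    rw [Finset.card_univ, Fintype.card_fin, show d + 2 - 1 = d + 1 from rfl, coeff_X_mul] at h
    rw [h, rho]
    refine Finset.sum_congr rfl fun r _ => ?_
    rw [eval_mul, eval_X, hPe, ← mul_assoc]
    exact mul_div_cancel_right₀ _ (hD0 r)
  -- Here `ρ(k) ≠ 0` enters: the degree is exactly `d`, so there are `d` roots.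
  have hnd : P.natDegree = d := le_antisymm (by omega) (le_natDegree_of_ne_zero (hc0 ▸ hk))
  have hlead : P.leadingCoeff = rho z k := by rw [leadingCoeff, hnd, hc0]
  have hsplit := IsAlgClosed.splits P
  have hcard : P.roots.card = d := by
    rw [← hnd]; exact (splits_iff_card_roots.1 hsplit)
  obtain ⟨l, hl⟩ : ∃ l : List ℂ, P.roots = (l : Multiset ℂ) := ⟨P.roots.toList, by simp⟩
  obtain rfl : l.length = d := by rw [← hcard, hl, Multiset.coe_card]
  refine ⟨l.get, eq_of_allK_eq (funext fun r => ?_)⟩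
  rw [allK_kOfY hz, kappa, mul_div_assoc', div_eq_iff (hD0 r), ← hPe,
    hsplit.eq_prod_roots, hlead, hl, eval_mul, eval_C, Multiset.map_coe, Multiset.prod_coe,
    eval_list_prod, List.map_map, ← List.prod_ofFn]
  congr 2
  exact List.ext_getElem (by simp) fun n h1 h2 => by simp

/-- Equal multisets of values mean fibres of equal size over each value; bijections between
corresponding fibres are glued into a permutation. -/
lemma exists_perm_of_map_eq {ι X : Type*} [Fintype ι] {y y' : ι → X}
    (h : (Finset.univ : Finset ι).val.map y = (Finset.univ : Finset ι).val.map y') :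
    ∃ σ : Equiv.Perm ι, y' = y ∘ σ := by
  classical
  have hcard : ∀ w, Fintype.card {i // y' i = w} = Fintype.card {i // y i = w} := fun w => by
    have := congrArg (Multiset.count w) h
    simp only [Multiset.count_map, eq_comm (a := w)] at this
    rw [Fintype.card_subtype, Fintype.card_subtype]
    exact this.symm
  let e : ∀ w, {i // y' i = w} ≃ {i // y i = w} := fun w => Fintype.equivOfCardEq (hcard w)
  refine ⟨(Equiv.sigmaFiberEquiv y').symm.trans
    ((Equiv.sigmaCongrRight e).trans (Equiv.sigmaFiberEquiv y)), funext fun i => ?_⟩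
  exact (e (y' i) ⟨i, rfl⟩).2.symm

/-- The separated variables are determined by `k` up to a permutation. -/
lemma exists_perm_of_kOfY_eq {d : ℕ} {z : Fin (d + 2) → ℂ} (hz : Function.Injective z)
    {y y' : Fin d → ℂ} {ρ : ℂ} (hρ : ρ ≠ 0) (h : kOfY z y ρ = kOfY z y' ρ) :
    ∃ σ : Equiv.Perm (Fin d), y' = y ∘ σ := by
  -- Both polynomials have degree `d` and agree at `d + 2` nodes.
  have hp : nodePoly y = nodePoly y' := by
    refine eq_of_degree_sub_lt_of_eval_index_eq (s := Finset.univ) (v := z) hz.injOn ?_ fun r _ => ?_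
    · refine lt_of_le_of_lt (degree_sub_le _ _) ?_
      rw [degree_nodePoly, degree_nodePoly, max_self, Finset.card_univ, Fintype.card_fin]
      exact_mod_cast (by omega)
    · have h1 := allK_kOfY hz y ρ r
      rw [h, allK_kOfY hz] at h1
      have h2 := mul_left_cancel₀ hρ h1
      rw [kappa, kappa, div_left_inj' (prod_erase_sub_ne_zero hz r)] at h2
      rw [eval_nodePoly, eval_nodePoly, h2]
  have hr := congrArg Polynomial.roots hp
  have key : ∀ y : Fin d → ℂ, (nodePoly y).roots = (Finset.univ : Finset (Fin d)).val.map y := by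
    intro y
    rw [nodePoly, ← Polynomial.roots_multiset_prod_X_sub_C (Finset.univ.val.map y), Multiset.map_map]
    rfl
  rw [key, key] at hr
  exact exists_perm_of_map_eq hr

/-! ### The Jacobian of Sklyanin's change of variables -/

/-- The absolute value of the Vandermonde product of `y`. -/
def vdm {d : ℕ} (y : Fin d → ℂ) : ℝ := ∏ k, ∏ l ∈ Finset.Ioi k, ‖y k - y l‖

lemma prod_prod_erase_eq_sq {d : ℕ} (f : Fin d → Fin d → ℝ) (hf : ∀ k l, f k l = f l k) :
    ∏ k, ∏ l ∈ Finset.univ.erase k, f k l = (∏ k, ∏ l ∈ Finset.Ioi k, f k l) ^ 2 := by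
  have h1 : ∀ k : Fin d, ∏ l ∈ Finset.univ.erase k, f k l =
      (∏ l ∈ Finset.Ioi k, f k l) * ∏ l ∈ Finset.Iio k, f k l := fun k => by
    rw [← Finset.prod_union]
    · refine Finset.prod_congr ?_ fun _ _ => rfl
      ext l
      simp only [Finset.mem_erase, Finset.mem_univ, and_true, Finset.mem_union, Finset.mem_Ioi,
        Finset.mem_Iio]
      rw [ne_iff_lt_or_gt, or_comm]
    · rw [Finset.disjoint_left]
      intro l h h'
      exact lt_asymm (Finset.mem_Ioi.1 h) (Finset.mem_Iio.1 h')
  rw [Finset.prod_congr rfl fun k _ => h1 k, Finset.prod_mul_distrib, sq]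
  congr 1
  rw [Finset.prod_comm' (t' := Finset.univ) (s' := fun l => Finset.Ioi l) (by simp)]
  exact Finset.prod_congr rfl fun _ _ => Finset.prod_congr rfl fun _ _ => hf _ _

/-- The derivatives of `ρ ∏ (X - y_k)` with respect to `ρ` and the `y_k`. -/
def dPoly {d : ℕ} (u : Fin (d + 1) → ℂ) : Fin (d + 1) → ℂ[X] :=
  Fin.cons (nodePoly (Fin.tail u))
    fun k => C (-u 0) * ∏ m ∈ Finset.univ.erase k, (X - C (Fin.tail u m))

lemma natDegree_dPoly_succ {d : ℕ} (u : Fin (d + 1) → ℂ) (k : Fin d) :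
    (dPoly u k.succ).natDegree < d := by
  rw [dPoly, Fin.cons_succ]
  refine lt_of_le_of_lt (natDegree_C_mul_le _ _) ?_
  rw [natDegree_prod_of_monic _ _ fun k _ => monic_X_sub_C _]
  simp [Finset.card_erase_of_mem]
  exact lt_of_le_of_lt (Nat.zero_le _) k.2

lemma natDegree_dPoly {d : ℕ} (u : Fin (d + 1) → ℂ) (i : Fin (d + 1)) :
    (dPoly u i).natDegree < d + 1 := by
  refine Fin.cases ?_ (fun k => ?_) i
  · rw [dPoly, Fin.cons_zero, natDegree_nodePoly]; omega
  · have := natDegree_dPoly_succ u k; omega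

/-- The coefficients of `dPoly`. -/
def dCoeff {d : ℕ} (u : Fin (d + 1) → ℂ) : Matrix (Fin (d + 1)) (Fin (d + 1)) ℂ :=
  Matrix.of fun j i => (dPoly u i).coeff j

/-- Row `0` of the projective Vandermonde matrix is the point at infinity and reads off the
coefficient of `X ^ d`; row `k + 1` evaluates at `y_k`. The product is diagonal because `nodePoly`
vanishes at every `y_k`, while the derivative in `y_k` has degree below `d` and vanishes at all the
other nodes. -/
lemma projVandermonde_mul_dCoeff {d : ℕ} (u : Fin (d + 1) → ℂ) :
    Matrix.projVandermonde (Fin.cons 1 (Fin.tail u)) (Fin.cons 0 1) * dCoeff u =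
      Matrix.diagonal (Fin.cons 1 fun k =>
        -u 0 * ∏ m ∈ Finset.univ.erase k, (Fin.tail u k - Fin.tail u m)) := by
  have hev : ∀ (k : Fin d) (i : Fin (d + 1)),
      (Matrix.projVandermonde (Fin.cons 1 (Fin.tail u)) (Fin.cons 0 1) * dCoeff u) k.succ i =
        (dPoly u i).eval (Fin.tail u k) := fun k i => by
    rw [Matrix.mul_apply, eval_eq_sum_range' (natDegree_dPoly u i), Finset.sum_range]
    refine Finset.sum_congr rfl fun j _ => ?_
    rw [Matrix.projVandermonde_apply, dCoeff, Matrix.of_apply]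
    simp [mul_comm]
  ext a i
  refine Fin.cases ?_ (fun k => ?_) a
  · have h1 : (Matrix.projVandermonde (Fin.cons 1 (Fin.tail u)) (Fin.cons 0 1) * dCoeff u) 0 i =
        (dPoly u i).coeff d := by
      rw [Matrix.mul_apply, Finset.sum_eq_single (Fin.last d)]
      · rw [Matrix.projVandermonde_apply, dCoeff, Matrix.of_apply]; simp
      · intro j _ hj
        rw [Matrix.projVandermonde_apply]
        have h1 : (j : ℕ) ≠ d := fun h => hj (Fin.ext h)
        have h2 : d - (j : ℕ) ≠ 0 := by omega
        simp [h2]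
      · simp
    rw [h1]
    refine Fin.cases ?_ (fun l => ?_) i
    · have h := monic_nodePoly (Fin.tail u)
      rw [Monic, leadingCoeff, natDegree_nodePoly] at h
      simpa [dPoly] using h
    · rw [coeff_eq_zero_of_natDegree_lt (natDegree_dPoly_succ u l),
        Matrix.diagonal_apply_ne _ (Fin.succ_ne_zero l).symm]
  · rw [hev]
    refine Fin.cases ?_ (fun l => ?_) i
    · rw [Matrix.diagonal_apply_ne _ (Fin.succ_ne_zero k), dPoly, Fin.cons_zero, eval_nodePoly]
      exact Finset.prod_eq_zero (Finset.mem_univ k) (sub_self _)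
    · rw [dPoly, Fin.cons_succ, eval_mul, eval_C, eval_prod]
      simp only [eval_sub, eval_X, eval_C]
      rcases eq_or_ne k l with rfl | h
      · simp
      · rw [Matrix.diagonal_apply_ne _ (by simpa using h), Finset.prod_eq_zero
          (Finset.mem_erase.2 ⟨h, Finset.mem_univ k⟩) (sub_self _), mul_zero]

/-- The factors that involve the row at infinity have modulus one, so only the differences of the
`y_k` remain. -/
lemma norm_det_projVandermonde {d : ℕ} (y : Fin d → ℂ) :
    ‖(Matrix.projVandermonde (Fin.cons 1 y : Fin (d + 1) → ℂ) (Fin.cons 0 1)).det‖ = vdm y := by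
  rw [Matrix.det_projVandermonde, norm_prod, Fin.prod_univ_succ]
  have h0 : ‖∏ j ∈ Finset.Ioi (0 : Fin (d + 1)), ((Fin.cons 1 y : Fin (d + 1) → ℂ) j *
      (Fin.cons 0 1 : Fin (d + 1) → ℂ) 0 - (Fin.cons 1 y : Fin (d + 1) → ℂ) 0 *
      (Fin.cons 0 1 : Fin (d + 1) → ℂ) j)‖ = 1 := by
    rw [Fin.prod_Ioi_zero, norm_prod]
    simp
  rw [h0, one_mul, vdm]
  refine Finset.prod_congr rfl fun k _ => ?_
  rw [Fin.prod_Ioi_succ, norm_prod]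
  refine Finset.prod_congr rfl fun l _ => ?_
  simp [norm_sub_rev]

/-- Determinants in `projVandermonde_mul_dCoeff` give `vdm` times the unknown on one side and `|u 0|
^ d` times `vdm ^ 2` on the other. Cancelling one `vdm` excludes coinciding nodes, which form a null
set. -/
lemma norm_det_dCoeff {d : ℕ} (u : Fin (d + 1) → ℂ) (hu : vdm (Fin.tail u) ≠ 0) :
    ‖(dCoeff u).det‖ = ‖u 0‖ ^ d * vdm (Fin.tail u) := by
  have h := congrArg (fun M => ‖Matrix.det M‖) (projVandermonde_mul_dCoeff u)
  simp only [Matrix.det_mul, norm_mul, norm_det_projVandermonde, Matrix.det_diagonal] at h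
  rw [Fin.prod_univ_succ] at h
  simp only [Fin.cons_zero, Fin.cons_succ, one_mul, Finset.prod_mul_distrib, norm_mul, norm_prod,
    norm_pow, norm_neg, Finset.prod_const, Finset.card_univ, Fintype.card_fin] at h
  rw [prod_prod_erase_eq_sq (fun k l => ‖Fin.tail u k - Fin.tail u l‖)
    fun k l => norm_sub_rev _ _, show (∏ k, ∏ l ∈ Finset.Ioi k, ‖Fin.tail u k - Fin.tail u l‖) =
      vdm (Fin.tail u) from rfl] at h
  refine mul_left_cancel₀ hu ?_
  rw [h]; ring

/-- Sklyanin's change of variables, with `ρ = u 0` and `y_k = u (k + 1)`. -/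
def sklMap {d : ℕ} (z : Fin (d + 2) → ℂ) (u : Fin (d + 1) → ℂ) : Fin (d + 1) → ℂ :=
  kOfY z (Fin.tail u) (u 0)

/-- The Jacobian matrix of `sklMap`. -/
def sklJac {d : ℕ} (z : Fin (d + 2) → ℂ) (u : Fin (d + 1) → ℂ) :
    Matrix (Fin (d + 1)) (Fin (d + 1)) ℂ :=
  Matrix.diagonal (fun r : Fin (d + 1) => (∏ s ∈ Finset.univ.erase ((1 : Fin (d + 2)).succAbove r),
      (z ((1 : Fin (d + 2)).succAbove r) - z s))⁻¹) *
    Matrix.vandermonde (fun r => z ((1 : Fin (d + 2)).succAbove r)) * dCoeff u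

/-- Multiplying coefficient vectors by the Vandermonde matrix of the `z` evaluates the polynomials
there. This identifies the factorized matrix, whose determinant is accessible, with the matrix of
partial derivatives. -/
lemma sklJac_apply {d : ℕ} (z : Fin (d + 2) → ℂ) (u : Fin (d + 1) → ℂ) (r i : Fin (d + 1)) :
    sklJac z u r i = (∏ s ∈ Finset.univ.erase ((1 : Fin (d + 2)).succAbove r),
      (z ((1 : Fin (d + 2)).succAbove r) - z s))⁻¹ *
        (dPoly u i).eval (z ((1 : Fin (d + 2)).succAbove r)) := by
  rw [sklJac, Matrix.mul_assoc, Matrix.diagonal_mul, Matrix.mul_apply,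
    eval_eq_sum_range' (natDegree_dPoly u i), Finset.sum_range]
  congr 1
  refine Finset.sum_congr rfl fun j _ => ?_
  rw [Matrix.vandermonde_apply, dCoeff, Matrix.of_apply, mul_comm]

lemma hasFDerivAt_sklMap {d : ℕ} (z : Fin (d + 2) → ℂ) (u : Fin (d + 1) → ℂ) :
    HasFDerivAt (𝕜 := ℂ) (sklMap z) (LinearMap.toContinuousLinearMap (Matrix.toLin' (sklJac z u))) u := by
  rw [hasFDerivAt_pi']
  intro r
  set ζ := z ((1 : Fin (d + 2)).succAbove r)
  have h0 : ∀ i, HasFDerivAt (𝕜 := ℂ) (fun u : Fin (d + 1) → ℂ => u i)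
    (ContinuousLinearMap.proj (R := ℂ) (φ := fun _ : Fin (d + 1) => ℂ) i) u := fun i => hasFDerivAt_apply i u
  have h1 := HasFDerivAt.finsetProd (u := Finset.univ) (x := u) (𝔸' := ℂ)
    (g := fun (k : Fin d) (u : Fin (d + 1) → ℂ) => ζ - u k.succ)
    fun k _ => (h0 k.succ).const_sub ζ
  have h2 := ((h0 0).mul h1).mul_const
    ((∏ s ∈ Finset.univ.erase ((1 : Fin (d + 2)).succAbove r), (ζ - z s))⁻¹)
  have hf : (fun x => sklMap z x r) = fun x => (x 0 * ∏ k : Fin d, (ζ - x k.succ)) *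
      (∏ s ∈ Finset.univ.erase ((1 : Fin (d + 2)).succAbove r), (ζ - z s))⁻¹ := by
    funext x
    simp only [sklMap, kOfY, kappa, Fin.tail, ζ]
    ring
  rw [hf]
  refine h2.congr_fderiv ?_
  ext v
  simp only [ContinuousLinearMap.comp_apply, ContinuousLinearMap.proj_apply,
    LinearMap.coe_toContinuousLinearMap', Matrix.toLin'_apply, Matrix.mulVec, dotProduct,
    sklJac_apply]
  rw [Fin.sum_univ_succ]
  simp only [dPoly, Fin.cons_zero, Fin.cons_succ, eval_nodePoly, eval_mul, eval_C, eval_prod, eval_sub, eval_X]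
  simp only [_root_.smul_apply, _root_.add_apply, _root_.sum_apply, _root_.neg_apply,
    ContinuousLinearMap.proj_apply, smul_eq_mul, Finset.mul_sum, Fin.tail, mul_add]
  rw [add_comm]
  congr 1
  · ring
  · refine Finset.sum_congr rfl fun k _ => ?_
    ring

/-- The factor in the Jacobian determinant of `sklMap` that depends only on `z`. -/
def sklConst {d : ℕ} (z : Fin (d + 2) → ℂ) : ℝ :=
  ‖(Matrix.diagonal (fun r : Fin (d + 1) =>
      (∏ s ∈ Finset.univ.erase ((1 : Fin (d + 2)).succAbove r),
        (z ((1 : Fin (d + 2)).succAbove r) - z s))⁻¹)).det‖ *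
    ‖(Matrix.vandermonde (fun r => z ((1 : Fin (d + 2)).succAbove r))).det‖

/-- The real derivative of `sklMap`. -/
def sklFDeriv {d : ℕ} (z : Fin (d + 2) → ℂ) (u : Fin (d + 1) → ℂ) :
    (Fin (d + 1) → ℂ) →L[ℝ] (Fin (d + 1) → ℂ) :=
  (LinearMap.toContinuousLinearMap (Matrix.toLin' (sklJac z u))).restrictScalars ℝ

lemma hasFDerivAt_sklMap_real {d : ℕ} (z : Fin (d + 2) → ℂ) (u : Fin (d + 1) → ℂ) :
    HasFDerivAt (𝕜 := ℝ) (sklMap z) (sklFDeriv z u) u :=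
  (hasFDerivAt_sklMap z u).restrictScalars ℝ

/-- The real determinant of a complex linear map is the squared modulus of its complex determinant.
-/
lemma abs_det_sklFDeriv {d : ℕ} (z : Fin (d + 2) → ℂ) (u : Fin (d + 1) → ℂ)
    (hu : vdm (Fin.tail u) ≠ 0) :
    |(sklFDeriv z u).det| = sklConst z ^ 2 * (‖u 0‖ ^ (2 * d) * vdm (Fin.tail u) ^ 2) := by
  have h1 : (sklFDeriv z u).det = ‖(sklJac z u).det‖ ^ 2 := by
    have : (sklFDeriv z u).det = LinearMap.det ((Matrix.toLin' (sklJac z u)).restrictScalars ℝ) := rfl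
    rw [this, LinearMap.det_restrictScalars, LinearMap.det_toLin', Algebra.norm_complex_apply,
      Complex.normSq_eq_norm_sq]
  rw [h1, abs_of_nonneg (by positivity), sklJac, Matrix.det_mul, Matrix.det_mul, norm_mul, norm_mul,
    norm_det_dCoeff u hu, sklConst]
  ring

/-! ### Null sets and the change of variables in integrals -/

/-- The measurable equivalence `(y, ρ) ↦ (ρ, y_1, …, y_d)`. -/
def consEquiv (d : ℕ) : (Fin d → ℂ) × ℂ ≃ᵐ (Fin (d + 1) → ℂ) :=
  MeasurableEquiv.prodComm.trans (MeasurableEquiv.piFinSuccAbove (fun _ => ℂ) 0).symm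

lemma consEquiv_apply {d : ℕ} (p : (Fin d → ℂ) × ℂ) : consEquiv d p = Fin.cons p.2 p.1 := by
  simp [consEquiv, MeasurableEquiv.piFinSuccAbove, Fin.insertNthEquiv, MeasurableEquiv.prodComm]

lemma measurePreserving_consEquiv (d : ℕ) :
    MeasurePreserving (consEquiv d) volume volume :=
  (volume_preserving_piFinSuccAbove (fun _ => ℂ) 0).symm.comp
    (Measure.measurePreserving_swap (μ := volume) (ν := volume))

lemma sklMap_consEquiv {d : ℕ} (z : Fin (d + 2) → ℂ) (p : (Fin d → ℂ) × ℂ) :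
    sklMap z (consEquiv d p) = kOfY z p.1 p.2 := by
  simp [consEquiv_apply, sklMap]

lemma ae_linear_ne_zero {n : ℕ} {f : (Fin n → ℂ) →ₗ[ℂ] ℂ} (hf : f ≠ 0) :
    ∀ᵐ x : Fin n → ℂ, f x ≠ 0 := by
  have h := Measure.addHaar_submodule (volume : Measure (Fin n → ℂ))
    ((LinearMap.ker f).restrictScalars ℝ) (by
      rw [Ne, Submodule.restrictScalars_eq_top_iff, LinearMap.ker_eq_top]; exact hf)
  rw [ae_iff]
  convert h using 2
  ext x
  simp

lemma ae_apply_ne {n : ℕ} (i : Fin n) (c : ℂ) : ∀ᵐ x : Fin n → ℂ, x i ≠ c := by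
  rw [ae_iff]
  simp only [not_not]
  exact Measure.pi_hyperplane (fun _ : Fin n => (volume : Measure ℂ)) i c

lemma ae_vdm_ne_zero {d : ℕ} : ∀ᵐ y : Fin d → ℂ, vdm y ≠ 0 := by
  have h : ∀ k l : Fin d, k ≠ l → ∀ᵐ y : Fin d → ℂ, y k - y l ≠ 0 := fun k l hkl => by
    refine ae_linear_ne_zero (f := LinearMap.proj (R := ℂ) (φ := fun _ : Fin d => ℂ) k - LinearMap.proj l) fun h => ?_
    have := LinearMap.congr_fun h (Pi.single k 1)
    simp [hkl.symm] at this
  have h' : ∀ᵐ y : Fin d → ℂ, ∀ k l : Fin d, k ≠ l → y k - y l ≠ 0 := by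
    simp only [ae_all_iff]
    exact h
  filter_upwards [h'] with y hy
  refine Finset.prod_ne_zero_iff.2 fun k _ => Finset.prod_ne_zero_iff.2 fun l hl => ?_
  exact norm_ne_zero_iff.2 (hy k l (Finset.mem_Ioi.1 hl).ne)

lemma continuous_vdm {d : ℕ} : Continuous (vdm (d := d)) := by
  unfold vdm; fun_prop

lemma ae_kappa_ne_zero {d : ℕ} {z : Fin (d + 2) → ℂ} (hz : Function.Injective z) :
    ∀ᵐ y : Fin d → ℂ, ∀ r, kappa z y r ≠ 0 := by
  have h : ∀ᵐ y : Fin d → ℂ, ∀ r k, y k ≠ z r := by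
    simp only [ae_all_iff]
    exact fun r k => ae_apply_ne k (z r)
  filter_upwards [h] with y hy r
  exact div_ne_zero (Finset.prod_ne_zero_iff.2 fun k _ => sub_ne_zero.2 (hy r k).symm)
    (prod_erase_sub_ne_zero hz r)

/-- `ρ` as a linear functional. -/
def rhoLin {d : ℕ} (z : Fin (d + 2) → ℂ) : (Fin (d + 1) → ℂ) →ₗ[ℂ] ℂ :=
  ∑ r, (z ((1 : Fin (d + 2)).succAbove r) - z 1) • LinearMap.proj r

lemma rhoLin_apply {d : ℕ} (z : Fin (d + 2) → ℂ) (k : Fin (d + 1) → ℂ) : rhoLin z k = rho z k := by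
  rw [rho_eq_sum]; simp [rhoLin]

lemma rhoLin_ne_zero {d : ℕ} {z : Fin (d + 2) → ℂ} (hz : Function.Injective z) : rhoLin z ≠ 0 := by
  intro h
  have h2 := LinearMap.congr_fun h (Pi.single 0 1)
  rw [rhoLin_apply, rho_eq_sum, Finset.sum_eq_single 0] at h2
  · simp only [Pi.single_eq_same, mul_one, LinearMap.zero_apply, sub_eq_zero] at h2
    exact (Fin.succAbove_ne _ _) (hz h2)
  · intro r _ hr; simp [hr]
  · simp

lemma ae_rho_ne_zero {d : ℕ} {z : Fin (d + 2) → ℂ} (hz : Function.Injective z) :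
    ∀ᵐ k : Fin (d + 1) → ℂ, rho z k ≠ 0 := by
  simpa only [rhoLin_apply] using ae_linear_ne_zero (rhoLin_ne_zero hz)

lemma measurable_rho {d : ℕ} (z : Fin (d + 2) → ℂ) : Measurable (rho z) := by
  have : rho z = fun k => ∑ r, (z ((1 : Fin (d + 2)).succAbove r) - z 1) * k r :=
    funext (rho_eq_sum z)
  rw [this]; fun_prop

lemma continuous_sklMap {d : ℕ} (z : Fin (d + 2) → ℂ) : Continuous (sklMap z) :=
  continuous_iff_continuousAt.2 fun u => (hasFDerivAt_sklMap z u).continuousAt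

lemma exists_sklMap_eq {d : ℕ} {z : Fin (d + 2) → ℂ} (hz : Function.Injective z)
    {k : Fin (d + 1) → ℂ} (hk : rho z k ≠ 0) : ∃ u, sklMap z u = k := by
  obtain ⟨y, hy⟩ := exists_kOfY_eq hz k hk
  exact ⟨Fin.cons (rho z k) y, by simpa [sklMap] using hy⟩

/-- A property that holds almost everywhere in the variables `(y, ρ)` holds almost everywhere in
`k`. -/
lemma ae_of_ae_kOfY {d : ℕ} {z : Fin (d + 2) → ℂ} (hz : Function.Injective z)
    {Q : (Fin (d + 1) → ℂ) → Prop} (h : ∀ᵐ p : (Fin d → ℂ) × ℂ, Q (kOfY z p.1 p.2)) :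
    ∀ᵐ k, Q k := by
  have h1 : ∀ᵐ u : Fin (d + 1) → ℂ, Q (sklMap z u) := by
    have h2 := (measurePreserving_consEquiv d).symm.quasiMeasurePreserving.ae h
    filter_upwards [h2] with u hu
    rw [← sklMap_consEquiv] at hu
    simpa using hu
  -- A differentiable map between spaces of equal dimension sends null sets to null sets. Together
  -- with surjectivity off `ρ = 0` this transfers the property; injectivity plays no role.
  have h3 : volume (sklMap z '' {u | ¬ Q (sklMap z u)}) = 0 :=
    addHaar_image_eq_zero_of_differentiableOn_of_addHaar_eq_zero _
      (fun u _ => (hasFDerivAt_sklMap_real z u).differentiableAt.differentiableWithinAt) (ae_iff.1 h1)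
  filter_upwards [ae_rho_ne_zero hz, compl_mem_ae_iff.2 h3] with k hk hk'
  obtain ⟨u, rfl⟩ := exists_sklMap_eq hz hk
  by_contra hQ
  exact hk' ⟨u, hQ, rfl⟩

/-- Change of variables from `k` to `(y, ρ)`, as an inequality. -/
lemma lintegral_le_lintegral_kOfY {d : ℕ} {z : Fin (d + 2) → ℂ} (hz : Function.Injective z)
    {F : (Fin (d + 1) → ℂ) → ENNReal} (hF : Measurable F) :
    ∫⁻ k, F k ≤ ENNReal.ofReal (sklConst z ^ 2) * ∫⁻ p : (Fin d → ℂ) × ℂ,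
      F (kOfY z p.1 p.2) * ENNReal.ofReal (‖p.2‖ ^ (2 * d) * vdm p.1 ^ 2) := by
  set J : (Fin (d + 1) → ℂ) → ENNReal := fun u =>
    ENNReal.ofReal (sklConst z ^ 2 * (‖u 0‖ ^ (2 * d) * vdm (Fin.tail u) ^ 2)) with hJ
  have hJm : Measurable J := by
    have : Continuous fun u : Fin (d + 1) → ℂ => vdm (Fin.tail u) :=
      continuous_vdm.comp (by unfold Fin.tail; fun_prop)
    exact ENNReal.measurable_ofReal.comp (by fun_prop : Continuous _).measurable
  -- The determinant formula is available only where the `y_k` are distinct; the complement is null,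
  -- and so is its image.
  set s : Set (Fin (d + 1) → ℂ) := {u | vdm (Fin.tail u) ≠ 0} with hs
  have hsm : MeasurableSet s := by
    have : Continuous fun u : Fin (d + 1) → ℂ => vdm (Fin.tail u) :=
      continuous_vdm.comp (by unfold Fin.tail; fun_prop)
    exact this.measurable (measurableSet_singleton 0).compl
  have hs0 : volume sᶜ = 0 := by
    have h1 : ∀ᵐ p : (Fin d → ℂ) × ℂ, vdm p.1 ≠ 0 :=
      Measure.quasiMeasurePreserving_fst.ae ae_vdm_ne_zero
    have h2 := (measurePreserving_consEquiv d).symm.quasiMeasurePreserving.ae h1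
    have h3 : ∀ᵐ u : Fin (d + 1) → ℂ, u ∈ s := by
      filter_upwards [h2] with u hu
      have : u = consEquiv d ((consEquiv d).symm u) := by simp
      rw [hs, Set.mem_ofPred_eq, this, consEquiv_apply, Fin.tail_cons]
      exact hu
    exact h3
  -- Permuting `y` does not change `k`, so `sklMap` is not injective and no equality of measures is
  -- claimed. Surjectivity alone bounds Lebesgue measure by the image of the Jacobian-weighted
  -- measure.
  have hle : (volume : Measure (Fin (d + 1) → ℂ)) ≤ (volume.withDensity J).map (sklMap z) := by
    refine Measure.le_iff.2 fun A hA => ?_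
    have hA' : MeasurableSet (sklMap z ⁻¹' A) := (continuous_sklMap z).measurable hA
    rw [Measure.map_apply (continuous_sklMap z).measurable hA, withDensity_apply _ hA']
    have hsub : A ⊆ (sklMap z '' (sklMap z ⁻¹' A ∩ s) ∪ sklMap z '' sᶜ) ∪ {k | rho z k ≠ 0}ᶜ := by
      intro k hk
      by_cases hr : rho z k ≠ 0
      · obtain ⟨u, rfl⟩ := exists_sklMap_eq hz hr
        left
        by_cases hu : u ∈ s
        · exact Or.inl ⟨u, ⟨hk, hu⟩, rfl⟩
        · exact Or.inr ⟨u, hu, rfl⟩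
      · exact Or.inr hr
    have h3 : volume (sklMap z '' sᶜ) = 0 :=
      addHaar_image_eq_zero_of_differentiableOn_of_addHaar_eq_zero _
        (fun u _ => (hasFDerivAt_sklMap_real z u).differentiableAt.differentiableWithinAt) hs0
    have h4 : volume ({k : Fin (d + 1) → ℂ | rho z k ≠ 0}ᶜ) = 0 := ae_rho_ne_zero hz
    calc volume A ≤ volume (sklMap z '' (sklMap z ⁻¹' A ∩ s)) + 0 + 0 := by
          refine (measure_mono hsub).trans ((measure_union_le _ _).trans ?_)
          rw [h4]
          gcongr
          exact (measure_union_le _ _).trans (by rw [h3])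
      _ = volume (sklMap z '' (sklMap z ⁻¹' A ∩ s)) := by simp
      _ ≤ ∫⁻ u in sklMap z ⁻¹' A ∩ s, ENNReal.ofReal |(sklFDeriv z u).det| :=
          addHaar_image_le_lintegral_abs_det_fderiv _ (hA'.inter hsm)
            fun u _ => (hasFDerivAt_sklMap_real z u).hasFDerivWithinAt
      _ = ∫⁻ u in sklMap z ⁻¹' A ∩ s, J u := by
          refine setLIntegral_congr_fun (hA'.inter hsm) fun u hu => ?_
          simp only [hJ]
          rw [abs_det_sklFDeriv z u hu.2]
      _ ≤ ∫⁻ u in sklMap z ⁻¹' A, J u := lintegral_mono_set Set.inter_subset_left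
  calc ∫⁻ k, F k ≤ ∫⁻ k, F k ∂(volume.withDensity J).map (sklMap z) := lintegral_mono' hle le_rfl
    _ = ∫⁻ u, F (sklMap z u) ∂(volume.withDensity J) :=
        lintegral_map hF (continuous_sklMap z).measurable
    _ = ∫⁻ u, J u * F (sklMap z u) :=
        lintegral_withDensity_eq_lintegral_mul _ hJm (hF.comp (continuous_sklMap z).measurable)
    _ = ∫⁻ p : (Fin d → ℂ) × ℂ, J (consEquiv d p) * F (sklMap z (consEquiv d p)) :=
        ((measurePreserving_consEquiv d).lintegral_comp
          (hJm.mul (hF.comp (continuous_sklMap z).measurable))).symm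
    _ = _ := by
        rw [← lintegral_const_mul']
        · refine lintegral_congr fun p => ?_
          rw [sklMap_consEquiv, consEquiv_apply]
          simp only [hJ, Fin.cons_zero, Fin.tail_cons]
          rw [ENNReal.ofReal_mul (by positivity)]
          ring
        · exact ENNReal.ofReal_ne_top

/-! ### Fourier transforms for nondegenerate pairings -/

section Fourier

open scoped FourierTransform

variable {E : Type*} [NormedAddCommGroup E] [NormedSpace ℝ E] [FiniteDimensional ℝ E]

/-- A nondegenerate pairing becomes a multiple of the Euclidean inner product in suitable linear
coordinates. -/
lemma exists_inner_eq (β : E →ₗ[ℝ] E →ₗ[ℝ] ℝ) (hβ : ∀ x, (∀ k, β k x = 0) → x = 0) :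
    ∃ A : E ≃L[ℝ] EuclideanSpace ℝ (Fin (Module.finrank ℝ E)),
      ∀ k x, inner ℝ (toEuclidean k) (A x) = β k x / Real.pi := by
  let V := EuclideanSpace ℝ (Fin (Module.finrank ℝ E))
  let ψ : E →ₗ[ℝ] V →L[ℝ] ℝ :=
    { toFun := fun x => LinearMap.toContinuousLinearMap
        ((β.flip x).comp ((toEuclidean (E := E)).symm : V →ₗ[ℝ] E))
      map_add' := fun x y => by ext v; simp
      map_smul' := fun c y => by ext v; simp }
  have hψ : ∀ x v, ψ x v = β ((toEuclidean (E := E)).symm v) x := fun x v => rfl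
  -- The Riesz representative of `β · x`. The factor `1 / π` turns the standard kernel `exp (-2 π i
  -- ⟨v, w⟩)` into `exp (-2 i β)`.
  let A0 : E →ₗ[ℝ] V :=
    { toFun := fun x => (Real.pi)⁻¹ • (InnerProductSpace.toDual ℝ V).symm (ψ x)
      map_add' := fun x y => by simp
      map_smul' := fun c y => by simp [smul_comm c] }
  have hA0 : ∀ k x, inner ℝ (toEuclidean k) (A0 x) = β k x / Real.pi := fun k x => by
    have : A0 x = (Real.pi)⁻¹ • (InnerProductSpace.toDual ℝ V).symm (ψ x) := rfl
    rw [this, real_inner_smul_right, real_inner_comm, InnerProductSpace.toDual_symm_apply, hψ,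
      ContinuousLinearEquiv.symm_apply_apply]
    ring
  have hinj : Function.Injective A0 := by
    rw [← LinearMap.ker_eq_bot, LinearMap.ker_eq_bot']
    intro x hx
    refine hβ x fun k => ?_
    have := hA0 k x
    rw [hx, inner_zero_right] at this
    simpa [Real.pi_ne_zero] using this.symm
  refine ⟨(LinearMap.linearEquivOfInjective A0 hinj (by simp [V])).toContinuousLinearEquiv,
    fun k x => hA0 k x⟩

/-- Composition with a linear equivalence, as an equivalence of Schwartz spaces. -/
def schwartzCompCLE {D D' : Type*} [NormedAddCommGroup D] [NormedSpace ℝ D]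
    [NormedAddCommGroup D'] [NormedSpace ℝ D'] (L : D ≃L[ℝ] D') : 𝓢(D', ℂ) ≃L[ℂ] 𝓢(D, ℂ) :=
  ContinuousLinearEquiv.equivOfInverse (SchwartzMap.compCLMOfContinuousLinearEquiv ℂ L)
    (SchwartzMap.compCLMOfContinuousLinearEquiv ℂ L.symm)
    (fun f => by ext x; simp) (fun f => by ext x; simp)

/-- Linear substitutions on both sides reduce the kernel to the Euclidean Fourier transform. The
measure contributes only a nonzero constant, so the result is still an equivalence of Schwartz
space. -/
lemma exists_fourierCLE [MeasurableSpace E] [BorelSpace E] (μ : Measure E) [μ.IsAddHaarMeasure] (β : E →ₗ[ℝ] E →ₗ[ℝ] ℝ)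
    (hβ : ∀ x, (∀ k, β k x = 0) → x = 0) :
    ∃ Φ : 𝓢(E, ℂ) ≃L[ℂ] 𝓢(E, ℂ), ∀ (g : 𝓢(E, ℂ)) (x : E),
      Φ g x = ∫ k, g k * Complex.exp (-2 * Complex.I * (β k x : ℂ)) ∂μ := by
  obtain ⟨A, hA⟩ := exists_inner_eq β hβ
  let V := EuclideanSpace ℝ (Fin (Module.finrank ℝ E))
  let e : E ≃L[ℝ] V := toEuclidean
  have hμ : ∃ c : ℝ, c ≠ 0 ∧ ∀ f : V → ℂ, ∫ k, f (e k) ∂μ = c • ∫ v, f v := by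
    have : (μ.map e).IsAddHaarMeasure := e.isAddHaarMeasure_map μ
    obtain ⟨c, hc0, hct, hc⟩ : ∃ c : ENNReal, c ≠ 0 ∧ c ≠ ⊤ ∧ μ.map e = c • volume := by
      refine ⟨(Measure.addHaarScalarFactor (μ.map e) volume : ENNReal), ?_, ENNReal.coe_ne_top, ?_⟩
      · exact_mod_cast (Measure.addHaarScalarFactor_pos_of_isAddHaarMeasure (μ.map e) volume).ne'
      · exact Measure.isAddLeftInvariant_eq_smul _ _
    refine ⟨c.toReal, ENNReal.toReal_ne_zero.2 ⟨hc0, hct⟩, fun f => ?_⟩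
    rw [← integral_smul_measure, ← hc]
    exact (e.toHomeomorph.measurableEmbedding.integral_map f).symm
  obtain ⟨c, hc0, hc⟩ := hμ
  have hc0' : (c : ℂ) ≠ 0 := by exact_mod_cast hc0
  let F : 𝓢(E, ℂ) ≃L[ℂ] 𝓢(E, ℂ) :=
    ((schwartzCompCLE e.symm).trans (FourierTransform.fourierCLE ℂ 𝓢(V, ℂ))).trans
      (schwartzCompCLE A)
  refine ⟨F.trans (ContinuousLinearEquiv.smulLeft (Units.mk0 (c : ℂ) hc0')), fun g x => ?_⟩
  have h1 : (F.trans (ContinuousLinearEquiv.smulLeft (Units.mk0 (c : ℂ) hc0'))) g x =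
      (c : ℂ) * (FourierTransform.fourier (fun v : V => g (e.symm v)) (A x)) := rfl
  have h2 := hc fun v => g (e.symm v) * Complex.exp (-2 * Complex.I * (β (e.symm v) x : ℂ))
  simp only [ContinuousLinearEquiv.symm_apply_apply] at h2
  rw [h1, h2, Real.fourier_eq', Complex.real_smul]
  congr 1
  refine integral_congr_ae (ae_of_all _ fun v => ?_)
  have h3 := hA (e.symm v) x
  have h4 : toEuclidean (e.symm v) = v := e.apply_symm_apply v
  rw [h4] at h3
  simp only [h3, smul_eq_mul]
  rw [mul_comm]
  congr 2
  push_cast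
  have := Real.pi_ne_zero
  field_simp

end Fourier

/-! ### Tempered distributions whose Fourier transform is a function -/

/-- The imaginary part of `pair`, as a real bilinear form. -/
def imPair (d : ℕ) : (Fin (d + 1) → ℂ) →ₗ[ℝ] (Fin (d + 1) → ℂ) →ₗ[ℝ] ℝ :=
  LinearMap.mk₂ ℝ (fun k x => (pair k x).im)
    (fun k k' x => by simp [pair, add_mul, Finset.sum_add_distrib])
    (fun c k x => by simp [pair, mul_assoc, ← Finset.mul_sum])
    (fun k x x' => by simp [pair, mul_add, Finset.sum_add_distrib])
    (fun c k x => by simp [pair, mul_left_comm, ← mul_add, Finset.mul_sum])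

lemma pair_single {d : ℕ} (r : Fin (d + 1)) (a : ℂ) (x : Fin (d + 1) → ℂ) :
    pair (Pi.single r a) x = a * x r := by
  rw [pair, Finset.sum_eq_single r]
  · simp
  · intro s _ hs; simp [hs]
  · simp

lemma eq_zero_of_im_mul_eq_zero {x : ℂ} (h : ∀ a : ℂ, (a * x).im = 0) : x = 0 := by
  have h1 := h 1
  have h2 := h Complex.I
  simp at h1 h2
  exact Complex.ext h2 h1

lemma exists_pairFourier (d : ℕ) : ∃ Φ : 𝓢(Fin (d + 1) → ℂ, ℂ) ≃L[ℂ] 𝓢(Fin (d + 1) → ℂ, ℂ),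
    ∀ (g : 𝓢(Fin (d + 1) → ℂ, ℂ)) (x : Fin (d + 1) → ℂ),
      Φ g x = ∫ k, g k * Complex.exp (-2 * Complex.I * ((pair k x).im : ℂ)) := by
  refine exists_fourierCLE volume (imPair d) fun x hx => funext fun r => ?_
  refine eq_zero_of_im_mul_eq_zero fun a => ?_
  rw [← pair_single r a x]
  exact hx _

/-- The Fourier transform on the Schwartz space with kernel `exp (-2 i Im ∑ k_r x_r)`. -/
def pairFourier (d : ℕ) : 𝓢(Fin (d + 1) → ℂ, ℂ) ≃L[ℂ] 𝓢(Fin (d + 1) → ℂ, ℂ) :=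
  (exists_pairFourier d).choose

lemma pairFourier_apply {d : ℕ} (g : 𝓢(Fin (d + 1) → ℂ, ℂ)) (x : Fin (d + 1) → ℂ) :
    pairFourier d g x = ∫ k, g k * Complex.exp (-2 * Complex.I * ((pair k x).im : ℂ)) :=
  (exists_pairFourier d).choose_spec g x

/-- The Fourier transform on the Schwartz space of `ℂ` with kernel `exp (-2 i Im (ξ u))`. -/
lemma exists_complexFourier : ∃ Φ : 𝓢(ℂ, ℂ) ≃L[ℂ] 𝓢(ℂ, ℂ), ∀ (g : 𝓢(ℂ, ℂ)) (u : ℂ),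
    Φ g u = ∫ ξ, g ξ * Complex.exp (-2 * Complex.I * ((ξ * u).im : ℂ)) := by
  refine exists_fourierCLE volume (LinearMap.mk₂ ℝ (fun k x : ℂ => (k * x).im)
    (fun k k' x => by simp [add_mul]) (fun c k x => by simp [mul_assoc])
    (fun k x x' => by simp [mul_add]) (fun c k x => by simp [mul_left_comm, ← mul_add])) fun x hx => ?_
  exact eq_zero_of_im_mul_eq_zero fun a => hx a

/-- The Schwartz function in the definition is determined by its values, so it can be replaced by
`pairFourier d g`. -/
lemma hasFourierTransform_iff {d : ℕ} {T : 𝓢'(Fin (d + 1) → ℂ, ℂ)}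
    {Ψt : (Fin (d + 1) → ℂ) → ℂ} : HasFourierTransform T Ψt ↔
      ∀ g : 𝓢(Fin (d + 1) → ℂ, ℂ), Integrable (fun k => Ψt k * g k) ∧
        T (pairFourier d g) = ∫ k, Ψt k * g k := by
  refine forall_congr' fun g => and_congr_right fun _ => ⟨?_, fun h => ⟨_, pairFourier_apply g, h⟩⟩
  rintro ⟨f, hf, h⟩
  rw [← h]
  congr 1
  ext x
  rw [hf, pairFourier_apply]

/-- Every test function is a `pairFourier`, so the values of a distribution are determined by its
Fourier transform. -/
lemma HasFourierTransform.eq_of_ae_eq {d : ℕ} {T T' : 𝓢'(Fin (d + 1) → ℂ, ℂ)}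
    {Ψ Ψ' : (Fin (d + 1) → ℂ) → ℂ} (h : HasFourierTransform T Ψ) (h' : HasFourierTransform T' Ψ')
    (hΨ : ∀ᵐ k, Ψ k = Ψ' k) : T = T' := by
  rw [hasFourierTransform_iff] at h h'
  ext f
  rw [← (pairFourier d).apply_symm_apply f, (h _).2, (h' _).2]
  refine integral_congr_ae ?_
  filter_upwards [hΨ] with k hk
  rw [hk]

/-- The weight lets a Schwartz seminorm control `∫ Ψ g`; composing this functional with the inverse
of `pairFourier d` gives the distribution. -/
lemma exists_hasFourierTransform {d : ℕ} {Ψ : (Fin (d + 1) → ℂ) → ℂ} (N : ℕ)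
    (hm : AEStronglyMeasurable Ψ) (hΨ : Integrable fun k => ‖Ψ k‖ * ((1 + ‖k‖) ^ N)⁻¹) :
    ∃ T : 𝓢'(Fin (d + 1) → ℂ, ℂ), HasFourierTransform T Ψ := by
  set M : 𝓢(Fin (d + 1) → ℂ, ℂ) → ℝ := fun g =>
    2 ^ N * (Finset.Iic ((N, 0) : ℕ × ℕ)).sup (schwartzSeminormFamily ℂ (Fin (d + 1) → ℂ) ℂ) g
  have hb : ∀ (g : 𝓢(Fin (d + 1) → ℂ, ℂ)) k, ‖Ψ k * g k‖ ≤ ‖Ψ k‖ * ((1 + ‖k‖) ^ N)⁻¹ * M g := by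
    intro g k
    have h := SchwartzMap.one_add_le_sup_seminorm_apply (𝕜 := ℂ) (m := (N, 0)) (k := N) (n := 0)
      le_rfl le_rfl g k
    rw [norm_iteratedFDeriv_zero] at h
    rw [norm_mul, mul_assoc]
    refine mul_le_mul_of_nonneg_left ?_ (norm_nonneg _)
    rw [inv_mul_eq_div, le_div_iff₀ (by positivity), mul_comm]
    exact h
  have hint : ∀ g : 𝓢(Fin (d + 1) → ℂ, ℂ), Integrable fun k => Ψ k * g k := fun g =>
    (hΨ.mul_const (M g)).mono' (hm.mul g.continuous.aestronglyMeasurable) (ae_of_all _ (hb g))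
  let T0 : 𝓢(Fin (d + 1) → ℂ, ℂ) →L[ℂ] ℂ := SchwartzMap.mkCLMtoNormedSpace
    (fun g => ∫ k, Ψ k * g k)
    (fun f g => by
      rw [← integral_add (hint f) (hint g)]
      exact integral_congr_ae (ae_of_all _ fun k => by simp [mul_add]))
    (fun a f => by
      rw [RingHom.id_apply, smul_eq_mul, ← integral_const_mul]
      exact integral_congr_ae (ae_of_all _ fun k => by simp [mul_left_comm]))
    ⟨Finset.Iic ((N, 0) : ℕ × ℕ), (∫ k, ‖Ψ k‖ * ((1 + ‖k‖) ^ N)⁻¹) * 2 ^ N,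
      mul_nonneg (integral_nonneg fun k => by positivity) (by positivity), fun g => by
        refine (norm_integral_le_of_norm_le (hΨ.mul_const (M g)) (ae_of_all _ (hb g))).trans ?_
        rw [integral_mul_const, mul_assoc]⟩
  refine ⟨ContinuousLinearMap.toPointwiseConvergenceCLM _ _ _ _
    (T0.comp ((pairFourier d).symm : 𝓢(Fin (d + 1) → ℂ, ℂ) →L[ℂ] 𝓢(Fin (d + 1) → ℂ, ℂ))),
    hasFourierTransform_iff.2 fun g => ⟨hint g, ?_⟩⟩
  have : T0 ((pairFourier d).symm (pairFourier d g)) = ∫ k, Ψ k * g k := by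
    rw [ContinuousLinearEquiv.symm_apply_apply]; rfl
  exact this

lemma twist_ne_zero {d : ℕ} {z j : Fin (d + 2) → ℂ} {jn : ℂ} {i : Fin 2} {k : Fin (d + 1) → ℂ}
    (hρ : rho z k ≠ 0) (hk : ∀ r, allK k r ≠ 0) : twist z j jn i k ≠ 0 := by
  have h : ∀ (w c : ℂ), w ≠ 0 → (‖w‖ : ℂ) ^ c ≠ 0 := fun w c hw => by
    rw [Complex.cpow_def_of_ne_zero (by simpa using hw)]
    exact Complex.exp_ne_zero _
  exact mul_ne_zero (h _ _ hρ) (Finset.prod_ne_zero_iff.2 fun r _ => h _ _ (hk r))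

lemma ae_prod_ne_zero {d : ℕ} {z : Fin (d + 2) → ℂ} (hz : Function.Injective z) :
    ∀ᵐ p : (Fin d → ℂ) × ℂ, p.2 ≠ 0 ∧ ∀ r, kappa z p.1 r ≠ 0 := by
  have h1 : ∀ᵐ p : (Fin d → ℂ) × ℂ, ∀ r, kappa z p.1 r ≠ 0 :=
    Measure.quasiMeasurePreserving_fst.ae (ae_kappa_ne_zero hz)
  have h0 : ∀ᵐ ρ : ℂ, ρ ≠ 0 := by rw [ae_iff]; simp
  have h2 : ∀ᵐ p : (Fin d → ℂ) × ℂ, p.2 ≠ 0 :=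
    Measure.quasiMeasurePreserving_snd.ae h0
  filter_upwards [h1, h2] with p hp1 hp2 using ⟨hp2, hp1⟩

lemma ae_rho_allK_ne_zero {d : ℕ} {z : Fin (d + 2) → ℂ} (hz : Function.Injective z) :
    ∀ᵐ k : Fin (d + 1) → ℂ, rho z k ≠ 0 ∧ ∀ r, allK k r ≠ 0 := by
  refine ae_of_ae_kOfY hz ?_
  filter_upwards [ae_prod_ne_zero hz] with p hp
  rw [rho_kOfY hz]
  exact ⟨hp.1, fun r => by rw [allK_kOfY hz]; exact mul_ne_zero hp.1 (hp.2 r)⟩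

/-- Two functions representing the same `φ` differ by the quotient of the twists. -/
lemma ae_twist_mul_eq {d : ℕ} {z : Fin (d + 2) → ℂ} (hz : Function.Injective z)
    {j j' : Fin (d + 2) → ℂ} {jn jn' : ℂ} {i i' : Fin 2} {φ : (Fin d → ℂ) → ℂ}
    {Ψ Ψ' : (Fin (d + 1) → ℂ) → ℂ}
    (h : ∀ᵐ p : (Fin d → ℂ) × ℂ,
      twist z j jn i (kOfY z p.1 p.2) * Ψ (kOfY z p.1 p.2) = φ p.1)
    (h' : ∀ᵐ p : (Fin d → ℂ) × ℂ,
      twist z j' jn' i' (kOfY z p.1 p.2) * Ψ' (kOfY z p.1 p.2) = φ p.1) :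
    ∀ᵐ k, twist z j jn i k * Ψ k = twist z j' jn' i' k * Ψ' k := by
  refine ae_of_ae_kOfY hz ?_
  filter_upwards [h, h'] with p hp hp'
  rw [hp, hp']

/-- Almost everywhere in `k` the twist does not vanish, so it can be cancelled from
`ae_twist_mul_eq`. -/
lemma IsSoVTransform.unique {d : ℕ} {z : Fin (d + 2) → ℂ} (hz : Function.Injective z)
    {j : Fin (d + 2) → ℂ} {jn : ℂ} {i : Fin 2} {φ : (Fin d → ℂ) → ℂ}
    {T T' : 𝓢'(Fin (d + 1) → ℂ, ℂ)} (h : IsSoVTransform z j jn i T φ)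
    (h' : IsSoVTransform z j jn i T' φ) : T = T' := by
  obtain ⟨Ψ, hΨ, hφ⟩ := h
  obtain ⟨Ψ', hΨ', hφ'⟩ := h'
  refine hΨ.eq_of_ae_eq hΨ' ?_
  filter_upwards [ae_twist_mul_eq hz hφ hφ', ae_rho_allK_ne_zero hz] with k hk hk'
  exact mul_left_cancel₀ (twist_ne_zero hk'.1 hk'.2) hk

/-! ### Integrable weights in `k` -/

lemma integrable_norm_rpow_neg_mul {q : ℝ} {M : ℕ} (hq : q < 2) (hM : 2 < M + q) :
    Integrable fun w : ℂ => ‖w‖ ^ (-q) * ((1 + ‖w‖) ^ M)⁻¹ := by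
  refine (integrable_fun_norm_addHaar volume (E := ℂ)
    (f := fun t : ℝ => t ^ (-q) * ((1 + t) ^ M)⁻¹)).2 ?_
  rw [Complex.finrank_real_complex]
  have hm : Measurable fun t : ℝ => t ^ (2 - 1) • (t ^ (-q) * ((1 + t) ^ M)⁻¹) := by fun_prop
  -- Polar coordinates in real dimension two: the radial exponent is `1 - q > -1` near zero and `1 -
  -- q - M < -1` at infinity.
  rw [← Set.Ioc_union_Ioi_eq_Ioi (zero_le_one (α := ℝ))]
  refine IntegrableOn.union ?_ ?_
  · have h1 : IntegrableOn (fun t : ℝ => t ^ (1 - q)) (Set.Ioc 0 1) :=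
      (intervalIntegrable_iff_integrableOn_Ioc_of_le zero_le_one).1
        (intervalIntegral.intervalIntegrable_rpow' (by linarith))
    refine h1.mono' hm.aestronglyMeasurable ?_
    refine (ae_restrict_iff' measurableSet_Ioc).2 (ae_of_all _ fun t ht => ?_)
    have ht0 : 0 < t := ht.1
    rw [Real.norm_of_nonneg (by rw [smul_eq_mul]; positivity), smul_eq_mul, ← mul_assoc]
    have : t ^ (2 - 1) * t ^ (-q) = t ^ (1 - q) := by
      rw [sub_eq_add_neg 1 q, Real.rpow_add ht0]; simp
    rw [this]
    exact mul_le_of_le_one_right (by positivity)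
      (inv_le_one_of_one_le₀ (one_le_pow₀ (by linarith)))
  · have h1 : IntegrableOn (fun t : ℝ => t ^ (1 - q - M)) (Set.Ioi 1) :=
      integrableOn_Ioi_rpow_of_lt (by linarith) one_pos
    refine h1.mono' hm.aestronglyMeasurable ?_
    refine (ae_restrict_iff' measurableSet_Ioi).2 (ae_of_all _ fun t ht => ?_)
    have ht0 : 0 < t := zero_lt_one.trans ht
    rw [Real.norm_of_nonneg (by rw [smul_eq_mul]; positivity), smul_eq_mul, ← mul_assoc]
    have : t ^ (2 - 1) * t ^ (-q) = t ^ (1 - q) := by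
      rw [sub_eq_add_neg 1 q, Real.rpow_add ht0]; simp
    rw [this, Real.rpow_sub ht0 (1 - q), Real.rpow_natCast, div_eq_mul_inv]
    gcongr
    linarith

/-- The sup norm dominates each coordinate, so the weight is below a product of factors `(1 + ‖k r‖)
^ (-3)`, each integrable on the plane, also with the one singular factor. -/
lemma integrable_norm_apply_rpow_neg_mul {n : ℕ} (i : Fin n) {q : ℝ} (hq0 : 0 ≤ q) (hq : q < 2) :
    Integrable fun k : Fin n → ℂ => ‖k i‖ ^ (-q) * ((1 + ‖k‖) ^ (3 * n))⁻¹ := by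
  set e : Fin n → ℝ := fun r => if r = i then q else 0 with he
  have h1 : Integrable fun k : Fin n → ℂ => ∏ r, (‖k r‖ ^ (-e r) * ((1 + ‖k r‖) ^ 3)⁻¹) := by
    refine Integrable.fintype_prod (f := fun r (w : ℂ) => ‖w‖ ^ (-e r) * ((1 + ‖w‖) ^ 3)⁻¹)
      fun r => integrable_norm_rpow_neg_mul ?_ ?_
    · simp only [he]; split_ifs <;> linarith
    · simp only [he]; split_ifs <;> push_cast <;> linarith
  refine h1.mono' (Measurable.aestronglyMeasurable (by fun_prop)) (ae_of_all _ fun k => ?_)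
  rw [Real.norm_of_nonneg (by positivity), Finset.prod_mul_distrib]
  have h2 : ∏ r, ‖k r‖ ^ (-e r) = ‖k i‖ ^ (-q) := by
    rw [Finset.prod_eq_single i]
    · simp [he]
    · intro r _ hr; simp [he, hr]
    · simp
  rw [h2, Finset.prod_inv_distrib]
  refine mul_le_mul_of_nonneg_left (inv_anti₀ (by positivity) ?_) (by positivity)
  calc ∏ r, (1 + ‖k r‖) ^ 3 ≤ ∏ _r : Fin n, (1 + ‖k‖) ^ 3 :=
        Finset.prod_le_prod (fun r _ => by positivity) fun r _ => by
          gcongr; exact norm_le_pi_norm k r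
    _ = (1 + ‖k‖) ^ (3 * n) := by simp [pow_mul]

/-- Replacing the coordinate `k_0` by `ρ(k)`. -/
lemma exists_rhoCoord {d : ℕ} {z : Fin (d + 2) → ℂ} (hz : Function.Injective z) :
    ∃ A : (Fin (d + 1) → ℂ) ≃L[ℝ] (Fin (d + 1) → ℂ), ∀ k, A k 0 = rho z k := by
  let A0 : (Fin (d + 1) → ℂ) →ₗ[ℂ] (Fin (d + 1) → ℂ) :=
    LinearMap.pi (Fin.cons (rhoLin z) fun r : Fin d => LinearMap.proj r.succ)
  have h0 : ∀ k, A0 k 0 = rho z k := fun k => rhoLin_apply z k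
  have hs : ∀ k (r : Fin d), A0 k r.succ = k r.succ := fun k r => rfl
  have hinj : Function.Injective A0 := by
    rw [← LinearMap.ker_eq_bot, LinearMap.ker_eq_bot']
    intro k hk
    have h1 : ∀ r : Fin d, k r.succ = 0 := fun r => by rw [← hs k r, hk]; rfl
    have h2 := h0 k
    rw [hk, rho_eq_sum, Fin.sum_univ_succ] at h2
    simp only [h1, mul_zero, Finset.sum_const_zero, add_zero, Pi.zero_apply] at h2
    have h3 : z ((1 : Fin (d + 2)).succAbove 0) - z 1 ≠ 0 :=
      sub_ne_zero.2 fun h => Fin.succAbove_ne _ _ (hz h)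
    funext r
    refine Fin.cases ?_ h1 r
    exact (mul_eq_zero.1 h2.symm).resolve_left h3
  exact ⟨((LinearEquiv.ofInjectiveEndo A0 hinj).restrictScalars ℝ).toContinuousLinearEquiv, h0⟩

lemma integrable_comp_continuousLinearEquiv {E : Type*} [NormedAddCommGroup E] [NormedSpace ℝ E]
    [FiniteDimensional ℝ E] [MeasurableSpace E] [BorelSpace E] (μ : Measure E)
    [μ.IsAddHaarMeasure] (A : E ≃L[ℝ] E) {f : E → ℝ} (hf : Integrable f μ) :
    Integrable (fun x => f (A x)) μ := by
  have h1 := Measure.map_linearMap_addHaar_eq_smul_addHaar μ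
    (f := (A.toLinearEquiv : E →ₗ[ℝ] E)) A.toLinearEquiv.isUnit_det'.ne_zero
  refine (MeasurableEmbedding.integrable_map_iff A.toHomeomorph.measurableEmbedding).1 ?_
  change Integrable f (μ.map (A.toLinearEquiv : E →ₗ[ℝ] E))
  rw [h1]
  exact hf.smul_measure ENNReal.ofReal_ne_top

lemma integrable_norm_rho_rpow_neg_mul {d : ℕ} {z : Fin (d + 2) → ℂ} (hz : Function.Injective z)
    {q : ℝ} (hq0 : 0 ≤ q) (hq : q < 2) :
    Integrable fun k : Fin (d + 1) → ℂ => ‖rho z k‖ ^ (-q) * ((1 + ‖k‖) ^ (3 * (d + 1)))⁻¹ := by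
  obtain ⟨A, hA⟩ := exists_rhoCoord hz
  have h1 := integrable_comp_continuousLinearEquiv volume A
    (integrable_norm_apply_rpow_neg_mul (0 : Fin (d + 1)) hq0 hq)
  simp only [hA] at h1
  set C : ℝ := 1 + ‖(A : (Fin (d + 1) → ℂ) →L[ℝ] (Fin (d + 1) → ℂ))‖
  have hC : ∀ k, 1 + ‖A k‖ ≤ C * (1 + ‖k‖) := fun k => by
    have := (A : (Fin (d + 1) → ℂ) →L[ℝ] (Fin (d + 1) → ℂ)).le_opNorm k
    simp only [ContinuousLinearEquiv.coe_coe] at this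
    have h3 : 0 ≤ ‖(A : (Fin (d + 1) → ℂ) →L[ℝ] (Fin (d + 1) → ℂ))‖ := norm_nonneg _
    simp only [C]
    nlinarith [norm_nonneg k]
  refine (h1.const_mul (C ^ (3 * (d + 1)))).mono' ?_ (ae_of_all _ fun k => ?_)
  · have := measurable_rho z
    exact Measurable.aestronglyMeasurable (by fun_prop)
  rw [Real.norm_of_nonneg (by positivity), mul_left_comm]
  refine mul_le_mul_of_nonneg_left ?_ (by positivity)
  have hC0 : 0 < C := by positivity
  rw [← div_eq_mul_inv, le_div_iff₀ (by positivity), inv_mul_le_iff₀ (by positivity), ← mul_pow,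
    mul_comm]
  exact pow_le_pow_left₀ (by positivity) ((hC k).trans_eq (mul_comm _ _)) _

lemma exists_norm_rho_le {d : ℕ} (z : Fin (d + 2) → ℂ) :
    ∃ C : ℝ, 1 ≤ C ∧ ∀ k, 1 + ‖rho z k‖ ≤ C * (1 + ‖k‖) := by
  refine ⟨1 + ∑ r : Fin (d + 1), ‖z ((1 : Fin (d + 2)).succAbove r) - z 1‖,
    by simpa using Finset.sum_nonneg fun _ _ => norm_nonneg _, fun k => ?_⟩
  have h1 : ‖rho z k‖ ≤ (∑ r : Fin (d + 1), ‖z ((1 : Fin (d + 2)).succAbove r) - z 1‖) * ‖k‖ := by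
    rw [rho_eq_sum, Finset.sum_mul]
    refine norm_sum_le_of_le _ fun r _ => ?_
    rw [norm_mul]
    exact mul_le_mul_of_nonneg_left (norm_le_pi_norm k r) (norm_nonneg _)
  have h2 : 0 ≤ ∑ r : Fin (d + 1), ‖z ((1 : Fin (d + 2)).succAbove r) - z 1‖ :=
    Finset.sum_nonneg fun _ _ => norm_nonneg _
  nlinarith [norm_nonneg k]

/-- The weight that remains in the Cauchy-Schwarz estimate for the twisted Fourier transform. -/
lemma exists_integrable_weight {d : ℕ} {z : Fin (d + 2) → ℂ} (hz : Function.Injective z)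
    {p : ℝ} (hp : p < 2) (hp' : -2 < p) :
    ∃ (ε : ℝ) (N : ℕ), 0 < ε ∧ ε < 2 ∧ Integrable fun k : Fin (d + 1) → ℂ =>
      ‖k 0‖ ^ (-p) * ‖rho z k‖ ^ (-ε) * (1 + ‖rho z k‖) ^ 4 * (((1 + ‖k‖) ^ N) ^ 2)⁻¹ := by
  obtain ⟨C, hC1, hC⟩ := exists_norm_rho_le z
  -- Only positive `p` makes `‖k 0‖ ^ (-p)` singular; for `p < 0` the factor grows less than
  -- quadratically. The choice of `ε` below keeps `m + ε < 2`.
  set m := max p 0 with hm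
  have hm0 : 0 ≤ m := le_max_right _ _
  have hm2 : m < 2 := max_lt hp two_pos
  set ε := (2 - m) / 2 with hε
  have hε0 : 0 < ε := by rw [hε]; linarith
  -- Six powers absorb the growth (two from `k 0`, four from `ρ`) and `3 * (d + 1)` give
  -- integrability; `2 * N` covers both.
  set N := 3 * (d + 1) + 6 with hN
  refine ⟨ε, N, hε0, by rw [hε]; linarith, ?_⟩
  have hI := ((integrable_norm_apply_rpow_neg_mul (0 : Fin (d + 1)) (q := m + ε)
    (by linarith) (by rw [hε]; linarith)).add (integrable_norm_rho_rpow_neg_mul hz (q := m + ε)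
    (by linarith) (by rw [hε]; linarith))).const_mul (C ^ 4)
  have hmr := measurable_rho z
  refine hI.mono' (Measurable.aestronglyMeasurable (by fun_prop)) ?_
  filter_upwards [ae_rho_allK_ne_zero hz] with k hk
  have hk0 : 0 < ‖k 0‖ := norm_pos_iff.2 (by rw [← allK_zero k]; exact hk.2 0)
  have hr0 : 0 < ‖rho z k‖ := norm_pos_iff.2 hk.1
  have hkk : ‖k 0‖ ≤ ‖k‖ := norm_le_pi_norm k 0
  rw [Real.norm_of_nonneg (by positivity)]
  have h1 : ‖k 0‖ ^ (-p) ≤ (1 + ‖k‖) ^ 2 * ‖k 0‖ ^ (-m) := by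
    rcases le_total 0 p with h | h
    · rw [hm, max_eq_left h]
      exact le_mul_of_one_le_left (by positivity) (one_le_pow₀ (by linarith))
    · rw [hm, max_eq_right h, neg_zero, Real.rpow_zero, mul_one]
      calc ‖k 0‖ ^ (-p) ≤ (1 + ‖k‖) ^ (-p) :=
            Real.rpow_le_rpow hk0.le (by linarith) (by linarith)
        _ ≤ (1 + ‖k‖) ^ (2 : ℝ) :=
            Real.rpow_le_rpow_of_exponent_le (by linarith) (by linarith)
        _ = (1 + ‖k‖) ^ 2 := by norm_cast
  -- Moving both singularities onto the smaller of the two moduli avoids treating `k 0` and `ρ` as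
  -- independent coordinates, which they are not when `d = 0`.
  have h2 : ‖k 0‖ ^ (-m) * ‖rho z k‖ ^ (-ε) ≤ ‖k 0‖ ^ (-(m + ε)) + ‖rho z k‖ ^ (-(m + ε)) := by
    rw [neg_add, Real.rpow_add hk0, Real.rpow_add hr0]
    rcases le_total ‖k 0‖ ‖rho z k‖ with h | h
    · have : ‖rho z k‖ ^ (-ε) ≤ ‖k 0‖ ^ (-ε) :=
        Real.rpow_le_rpow_of_nonpos hk0 h (by linarith)
      refine le_add_of_le_of_nonneg ?_ (by positivity)
      gcongr
    · have : ‖k 0‖ ^ (-m) ≤ ‖rho z k‖ ^ (-m) :=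
        Real.rpow_le_rpow_of_nonpos hr0 h (by linarith)
      refine le_add_of_nonneg_of_le (by positivity) ?_
      gcongr
  have h3 : (1 + ‖rho z k‖) ^ 4 ≤ C ^ 4 * (1 + ‖k‖) ^ 4 := by
    rw [← mul_pow]; exact pow_le_pow_left₀ (by positivity) (hC k) 4
  have h4 : (((1 + ‖k‖) ^ N) ^ 2)⁻¹ ≤ ((1 + ‖k‖) ^ 6)⁻¹ * ((1 + ‖k‖) ^ (3 * (d + 1)))⁻¹ := by
    rw [← mul_inv, ← pow_add, ← pow_mul]
    exact inv_anti₀ (by positivity) (pow_le_pow_right₀ (by linarith [norm_nonneg k]) (by omega))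
  have hk1 : 0 < 1 + ‖k‖ := by positivity
  calc ‖k 0‖ ^ (-p) * ‖rho z k‖ ^ (-ε) * (1 + ‖rho z k‖) ^ 4 * (((1 + ‖k‖) ^ N) ^ 2)⁻¹
      ≤ ((1 + ‖k‖) ^ 2 * ‖k 0‖ ^ (-m)) * ‖rho z k‖ ^ (-ε) * (C ^ 4 * (1 + ‖k‖) ^ 4) *
          (((1 + ‖k‖) ^ 6)⁻¹ * ((1 + ‖k‖) ^ (3 * (d + 1)))⁻¹) := by gcongr
    _ = C ^ 4 * ((‖k 0‖ ^ (-m) * ‖rho z k‖ ^ (-ε)) * ((1 + ‖k‖) ^ (3 * (d + 1)))⁻¹) := by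
        field_simp
    _ ≤ C ^ 4 * ((‖k 0‖ ^ (-(m + ε)) + ‖rho z k‖ ^ (-(m + ε))) *
          ((1 + ‖k‖) ^ (3 * (d + 1)))⁻¹) := by gcongr
    _ = _ := by simp only [Pi.add_apply, add_mul]

/-! ### Existence of the inverse SoV transform -/

lemma ae_comp_perm {d : ℕ} {Q : (Fin d → ℂ) → Prop} (h : ∀ᵐ y : Fin d → ℂ, Q y)
    (σ : Equiv.Perm (Fin d)) : ∀ᵐ y : Fin d → ℂ, Q (y ∘ σ) := by
  have h1 := (volume_measurePreserving_piCongrLeft (fun _ : Fin d => ℂ)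
    σ.symm).quasiMeasurePreserving.ae h
  filter_upwards [h1] with y hy
  convert hy using 1
  funext k
  have := MeasurableEquiv.piCongrLeft_apply_apply (β := fun _ : Fin d => ℂ) σ.symm y (σ k)
  simpa using this.symm

/-- An element of the Sklyanin space has a measurable, everywhere symmetric representative. -/
lemma MemSkl.exists_symm {d : ℕ} {z : Fin (d + 2) → ℂ} (hz : Function.Injective z)
    {φ : (Fin d → ℂ) → ℂ} (hφ : MemSkl z φ) :
    ∃ φs : (Fin d → ℂ) → ℂ, Measurable φs ∧ (∀ y (σ : Equiv.Perm (Fin d)), φs (y ∘ σ) = φs y) ∧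
      φs =ᵐ[volume] φ := by
  obtain ⟨φ1, hφ1, h1⟩ := hφ.1.1
  -- The Sklyanin density is positive almost everywhere, so almost everywhere statements pass to
  -- Lebesgue measure.
  have hac : (volume : Measure (Fin d → ℂ)) ≪ muSkl z := by
    refine withDensity_absolutelyContinuous' ?_ ?_
    · refine Measurable.aemeasurable (ENNReal.measurable_ofReal.comp ?_)
      unfold kappa
      fun_prop
    · filter_upwards [ae_vdm_ne_zero, ae_kappa_ne_zero hz] with y hy hy'
      refine (ENNReal.ofReal_pos.2 (mul_pos (mul_pos ?_ ?_) ?_)).ne'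
      · exact Finset.prod_pos fun r _ => Finset.prod_pos fun s hs =>
          pow_pos (norm_pos_iff.2 (sub_ne_zero.2 fun h => (Finset.mem_Ioi.1 hs).ne (hz h))) 2
      · refine Finset.prod_pos fun r _ => Finset.prod_pos fun s hs => pow_pos ?_ 2
        have := Finset.prod_ne_zero_iff.1 (Finset.prod_ne_zero_iff.1 hy r (Finset.mem_univ r)) s hs
        positivity
      · exact Finset.prod_pos fun r _ => by
          have := norm_pos_iff.2 (hy' r)
          positivity
  have h2 : φ =ᵐ[volume] φ1 := hac.ae_le h1
  -- Averaging over all permutations makes the symmetry exact and changes `φ1` only on a null set.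
  refine ⟨fun y => (Fintype.card (Equiv.Perm (Fin d)) : ℂ)⁻¹ * ∑ σ : Equiv.Perm (Fin d), φ1 (y ∘ σ),
    ?_, fun y τ => ?_, ?_⟩
  · have := hφ1.measurable
    refine measurable_const.mul (Finset.measurable_sum _ fun σ _ => this.comp ?_)
    unfold Function.comp
    fun_prop
  · refine congrArg _ ?_
    exact (Equiv.sum_comp (Equiv.mulLeft τ) fun σ : Equiv.Perm (Fin d) => φ1 (y ∘ σ))
  · have h3 : ∀ᵐ y : Fin d → ℂ, ∀ σ : Equiv.Perm (Fin d), φ1 (y ∘ σ) = φ y := by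
      rw [ae_all_iff]
      intro σ
      filter_upwards [hφ.2 σ, ae_comp_perm h2 σ] with y hy hy'
      rw [← hy', hy]
    filter_upwards [h3] with y hy
    have : (Fintype.card (Equiv.Perm (Fin d)) : ℂ) ≠ 0 := by
      exact_mod_cast Fintype.card_ne_zero
    simp only [hy, Finset.sum_const, Finset.card_univ, nsmul_eq_mul]
    rw [inv_mul_cancel_left₀ this]

/-- A symmetric function of the separated variables is a measurable function of `k`. -/
lemma exists_measurable_comp_kOfY {d : ℕ} {z : Fin (d + 2) → ℂ} (hz : Function.Injective z)
    {φ : (Fin d → ℂ) → ℂ} (hm : Measurable φ)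
    (hs : ∀ y (σ : Equiv.Perm (Fin d)), φ (y ∘ σ) = φ y) :
    ∃ H : (Fin (d + 1) → ℂ) → ℂ, Measurable H ∧ ∀ y ρ, ρ ≠ 0 → H (kOfY z y ρ) = φ y := by
  classical
  have hZm : MeasurableSet {k | rho z k ≠ 0} := measurable_rho z (measurableSet_singleton 0).compl
  have hXm : MeasurableSet {u : Fin (d + 1) → ℂ | u 0 ≠ 0} :=
    measurable_pi_apply 0 (measurableSet_singleton 0).compl
  have : StandardBorelSpace {u : Fin (d + 1) → ℂ | u 0 ≠ 0} := hXm.standardBorel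
  let f : {u : Fin (d + 1) → ℂ | u 0 ≠ 0} → {k | rho z k ≠ 0} :=
    fun u => ⟨sklMap z u, by
      have := u.2
      simpa only [Set.mem_ofPred_eq, sklMap, rho_kOfY hz] using this⟩
  have hf : Measurable f :=
    ((continuous_sklMap z).measurable.comp measurable_subtype_coe).subtype_mk
  choose Y hY using fun k : {k | rho z k ≠ 0} => exists_kOfY_eq hz k.1 k.2
  have hYs : ∀ (k : {k | rho z k ≠ 0}) y, kOfY z y (rho z k) = k → φ (Y k) = φ y := by
    intro k y hy
    obtain ⟨σ, hσ⟩ := exists_perm_of_kOfY_eq hz k.2 (hy.trans (hY k).symm)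
    rw [hσ, hs]
  have hsurj : Function.Surjective f := fun k => by
    refine ⟨⟨Fin.cons (rho z k) (Y k), by
      have := k.2
      simpa only [Set.mem_ofPred_eq, Fin.cons_zero] using this⟩, Subtype.ext ?_⟩
    simpa [f, sklMap] using hY k
  -- The choice `Y` need not be measurable. But `φ ∘ Y` pulled back along the measurable surjection
  -- `f` is `φ` of the tail, hence measurable, and a surjection from a standard Borel space reflects
  -- this.
  have hg : Measurable fun k => φ (Y k) := by
    refine (hf.measurable_comp_iff_of_surjective hsurj).1 ?_
    have : (fun k => φ (Y k)) ∘ f = fun u => φ (Fin.tail u.1) := funext fun u =>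
      hYs _ _ (by simp only [f, sklMap, rho_kOfY hz])
    rw [this]
    exact hm.comp (measurable_pi_lambda _ fun i =>
      (measurable_pi_apply i.succ).comp measurable_subtype_coe)
  refine ⟨fun k => if h : rho z k ≠ 0 then φ (Y ⟨k, h⟩) else 0,
    Measurable.dite hg measurable_const hZm, fun y ρ hρ => ?_⟩
  have h1 : rho z (kOfY z y ρ) ≠ 0 := by rwa [rho_kOfY hz]
  simp only [dif_pos h1]
  exact hYs _ _ (by rw [rho_kOfY hz])

lemma measurable_allK {d : ℕ} (r : Fin (d + 2)) : Measurable fun k : Fin (d + 1) → ℂ => allK k r := by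
  rcases Fin.eq_self_or_eq_succAbove 1 r with rfl | ⟨s, rfl⟩
  · simp only [allK_one]; fun_prop
  · simp only [allK_succAbove]; fun_prop

lemma measurable_twist {d : ℕ} (z j : Fin (d + 2) → ℂ) (jn : ℂ) (i : Fin 2) :
    Measurable (twist z j jn i) := by
  have h1 := measurable_rho z
  have h2 := fun r => measurable_allK (d := d) r
  unfold twist
  fun_prop

/-- For either `i` the real part of `j_{n,i}` is `-1/2`, so only `k_0` keeps an exponent different
from one; its excess is split off as a separate factor. -/
lemma norm_twist {d : ℕ} {z j : Fin (d + 2) → ℂ} {jn : ℂ} {i : Fin 2}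
    (hj : ∀ r, r ≠ 0 → (j r).re = -1 / 2) (hjn : jn.re = -1 / 2) {k : Fin (d + 1) → ℂ}
    (hρ : rho z k ≠ 0) (hk : ∀ r, allK k r ≠ 0) :
    ‖twist z j jn i k‖ =
      ‖rho z k‖⁻¹ * (‖k 0‖ ^ (2 * (j 0).re + 1) * ∏ r, ‖allK k r‖) := by
  have h : ∀ (w c : ℂ), w ≠ 0 → ‖(‖w‖ : ℂ) ^ c‖ = ‖w‖ ^ c.re := fun w c hw =>
    Complex.norm_cpow_eq_rpow_re_of_pos (norm_pos_iff.2 hw) c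
  have hre : (-2 * (jInf jn i + 1)).re = -1 := by
    unfold jInf
    split_ifs <;> simp [hjn] <;> norm_num
  rw [twist, norm_mul, h _ _ hρ, hre, Real.rpow_neg_one, norm_prod,
    Finset.prod_congr rfl fun r _ => h _ _ (hk r), Fin.prod_univ_succ,
    Fin.prod_univ_succ fun r => ‖allK k r‖]
  congr 1
  rw [← mul_assoc, allK_zero k]
  have hk0 : 0 < ‖k 0‖ := norm_pos_iff.2 (by rw [← allK_zero k]; exact hk 0)
  congr 1
  · rw [← Real.rpow_add_one hk0.ne']
    congr 1
    simp; ring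
  · refine Finset.prod_congr rfl fun r _ => ?_
    have : (2 * j r.succ + 2).re = 1 := by
      simp [hj r.succ (Fin.succ_ne_zero r)]; norm_num
    rw [this, Real.rpow_one]

/-- The density of the Sklyanin norm, up to a constant depending only on `z`. -/
def sklDensity {d : ℕ} (z : Fin (d + 2) → ℂ) (φ : (Fin d → ℂ) → ℂ) (y : Fin d → ℂ) : ℝ :=
  ‖φ y‖ ^ 2 * (∏ r, ‖kappa z y r‖⁻¹) ^ 2 * vdm y ^ 2

lemma lintegral_sklDensity_lt_top {d : ℕ} {z : Fin (d + 2) → ℂ} (hz : Function.Injective z)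
    {φ φs : (Fin d → ℂ) → ℂ} (hφ : MemSkl z φ) (hm : Measurable φs) (h : φs =ᵐ[volume] φ) :
    ∫⁻ y, ENNReal.ofReal (sklDensity z φs y) < ⊤ := by
  have h0 : φs =ᵐ[muSkl z] φ := (withDensity_absolutelyContinuous _ _).ae_le h
  have h1 : MemLp φs 2 (muSkl z) := hφ.1.ae_eq h0.symm
  have h2 := lintegral_rpow_enorm_lt_top_of_eLpNorm_lt_top two_ne_zero ENNReal.ofNat_ne_top h1.2
  have hkm : Measurable fun y : Fin d → ℂ => ENNReal.ofReal
    ((∏ r, ∏ s ∈ Finset.Ioi r, ‖z r - z s‖ ^ 2) *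
      (∏ k, ∏ l ∈ Finset.Ioi k, ‖y k - y l‖ ^ 2) *
      ∏ r, 1 / ‖kappa z y r‖ ^ 2) := by
    refine ENNReal.measurable_ofReal.comp ?_
    unfold kappa
    fun_prop
  rw [muSkl, lintegral_withDensity_eq_lintegral_mul _ hkm (by fun_prop)] at h2
  set c : ℝ := ∏ r, ∏ s ∈ Finset.Ioi r, ‖z r - z s‖ ^ 2 with hc
  have hc0 : 0 < c := Finset.prod_pos fun r _ => Finset.prod_pos fun s hs =>
    pow_pos (norm_pos_iff.2 (sub_ne_zero.2 fun h => (Finset.mem_Ioi.1 hs).ne (hz h))) 2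
  have h3 : ∀ y, ENNReal.ofReal (sklDensity z φs y) = ENNReal.ofReal c⁻¹ *
      (ENNReal.ofReal (c * (∏ k, ∏ l ∈ Finset.Ioi k, ‖y k - y l‖ ^ 2) *
        ∏ r, 1 / ‖kappa z y r‖ ^ 2) * ‖φs y‖ₑ ^ (2 : ENNReal).toReal) := fun y => by
    have h4 : ‖φs y‖ₑ ^ (2 : ENNReal).toReal = ENNReal.ofReal (‖φs y‖ ^ 2) := by
      rw [ENNReal.toReal_ofNat, ENNReal.rpow_ofNat, ENNReal.ofReal_pow (norm_nonneg _),
        ofReal_norm]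
    rw [h4, ← ENNReal.ofReal_mul (by positivity), ← ENNReal.ofReal_mul (by positivity)]
    congr 1
    simp only [sklDensity, vdm, Finset.prod_pow, one_div, Finset.prod_inv_distrib]
    field_simp
  simp only [h3]
  rw [lintegral_const_mul' _ _ ENNReal.ofReal_ne_top]
  exact ENNReal.mul_lt_top ENNReal.ofReal_lt_top h2

/-- The `L²` half of the Cauchy-Schwarz estimate for the inverse SoV transformation. -/
lemma integrable_sq_of_lintegral_sklDensity {d : ℕ} {z : Fin (d + 2) → ℂ}
    (hz : Function.Injective z) {φ : (Fin d → ℂ) → ℂ} (hm : Measurable φ)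
    (hφ : ∫⁻ y, ENNReal.ofReal (sklDensity z φ y) < ⊤)
    {H : (Fin (d + 1) → ℂ) → ℂ} (hH : Measurable H)
    (hHφ : ∀ y ρ, ρ ≠ 0 → H (kOfY z y ρ) = φ y) {ε : ℝ} (hε : 0 < ε) (hε2 : ε < 2) :
    Integrable fun k : Fin (d + 1) → ℂ => ‖H k‖ ^ 2 * (∏ r, ‖allK k r‖⁻¹) ^ 2 *
      (‖rho z k‖ ^ 4 * (‖rho z k‖ ^ (-(2 - ε)) * ((1 + ‖rho z k‖) ^ 4)⁻¹)) := by
  have h1 := measurable_rho z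
  have h2 := fun r => measurable_allK (d := d) r
  have hF : Measurable fun k : Fin (d + 1) → ℂ => ‖H k‖ ^ 2 * (∏ r, ‖allK k r‖⁻¹) ^ 2 *
      (‖rho z k‖ ^ 4 * (‖rho z k‖ ^ (-(2 - ε)) * ((1 + ‖rho z k‖) ^ 4)⁻¹)) := by fun_prop
  have hG := integrable_norm_rpow_neg_mul (q := 2 - ε) (M := 4) (by linarith)
    (by push_cast; linarith)
  refine ⟨hF.aestronglyMeasurable, ?_⟩
  rw [hasFiniteIntegral_iff_ofReal (ae_of_all _ fun k => by positivity)]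
  refine lt_of_le_of_lt (lintegral_le_lintegral_kOfY hz hF.ennreal_ofReal) ?_
  refine ENNReal.mul_lt_top ENNReal.ofReal_lt_top ?_
  -- The powers of `|ρ|` balance: `-2 (d + 2)` from the `k_r`, `4` from the explicit factor and `2
  -- d` from the Jacobian. The integrand becomes the Sklyanin density in `y` times an integrable
  -- function of `ρ`.
  have h3 : ∀ᵐ p : (Fin d → ℂ) × ℂ, ENNReal.ofReal (‖H (kOfY z p.1 p.2)‖ ^ 2 *
      (∏ r, ‖allK (kOfY z p.1 p.2) r‖⁻¹) ^ 2 * (‖rho z (kOfY z p.1 p.2)‖ ^ 4 *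
      (‖rho z (kOfY z p.1 p.2)‖ ^ (-(2 - ε)) * ((1 + ‖rho z (kOfY z p.1 p.2)‖) ^ 4)⁻¹))) *
      ENNReal.ofReal (‖p.2‖ ^ (2 * d) * vdm p.1 ^ 2) =
      ENNReal.ofReal (sklDensity z φ p.1) *
        ENNReal.ofReal (‖p.2‖ ^ (-(2 - ε)) * ((1 + ‖p.2‖) ^ 4)⁻¹) := by
    filter_upwards [ae_prod_ne_zero hz] with p hp
    have hp0 : ‖p.2‖ ≠ 0 := norm_ne_zero_iff.2 hp.1
    rw [← ENNReal.ofReal_mul (by positivity),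
      ← ENNReal.ofReal_mul (by unfold sklDensity; positivity), rho_kOfY hz, hHφ _ _ hp.1]
    congr 1
    simp only [allK_kOfY hz, norm_mul, mul_inv, Finset.prod_mul_distrib, Finset.prod_const,
      Finset.card_univ, Fintype.card_fin, sklDensity]
    generalize (∏ r, ‖kappa z p.1 r‖⁻¹) = K
    generalize ‖p.2‖ ^ (-(2 - ε)) * ((1 + ‖p.2‖) ^ 4)⁻¹ = G
    have : (‖p.2‖⁻¹ ^ (d + 2)) ^ 2 * (‖p.2‖ ^ 4 * ‖p.2‖ ^ (2 * d)) = 1 := by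
      rw [← pow_add, ← pow_mul, show (d + 2) * 2 = 4 + 2 * d by ring, ← mul_pow,
        inv_mul_cancel₀ hp0, one_pow]
    linear_combination ‖φ p.1‖ ^ 2 * K ^ 2 * G * vdm p.1 ^ 2 * this
  rw [lintegral_congr_ae h3]
  have hD : Measurable fun y => ENNReal.ofReal (sklDensity z φ y) := by
    refine ENNReal.measurable_ofReal.comp ?_
    have h4 := (continuous_vdm (d := d)).measurable
    unfold sklDensity kappa
    fun_prop
  have h5 := lintegral_prod_mul (μ := (volume : Measure (Fin d → ℂ))) (ν := (volume : Measure ℂ))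
    hD.aemeasurable hG.1.aemeasurable.ennreal_ofReal
  refine lt_of_eq_of_lt h5 (ENNReal.mul_lt_top hφ ?_)
  rw [← hasFiniteIntegral_iff_ofReal (ae_of_all _ fun k => by positivity)]
  exact hG.2

/-- Existence of the inverse of the SoV transformation. -/
lemma exists_isSoVTransform {d : ℕ} {z : Fin (d + 2) → ℂ} (hz : Function.Injective z)
    {j : Fin (d + 2) → ℂ} {jn : ℂ} (i : Fin 2) (hj0 : -1 < (j 0).re ∧ (j 0).re < 0)
    (hj : ∀ r, r ≠ 0 → (j r).re = -1 / 2) (hjn : jn.re = -1 / 2)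
    {φ : (Fin d → ℂ) → ℂ} (hφ : MemSkl z φ) :
    ∃ T : 𝓢'(Fin (d + 1) → ℂ, ℂ), IsSoVTransform z j jn i T φ := by
  obtain ⟨φs, hm, hs, hae⟩ := hφ.exists_symm hz
  obtain ⟨H, hH, hHφ⟩ := exists_measurable_comp_kOfY hz hm hs
  -- The exponent `2 + 4 Re j_0` is twice the excess exponent `2 Re j_0 + 1` of `norm_twist`; the
  -- strip `-1 < Re j_0 < 0` is the condition `-2 < p < 2`.
  obtain ⟨ε, N, hε, hε2, hQ⟩ := exists_integrable_weight hz (p := 2 + 4 * (j 0).re)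
    (by linarith [hj0.2]) (by linarith [hj0.1])
  have hP := integrable_sq_of_lintegral_sklDensity hz hm (lintegral_sklDensity_lt_top hz hφ hm hae)
    hH hHφ hε hε2
  have hΨm : Measurable fun k => (twist z j jn i k)⁻¹ * H k := (measurable_twist z j jn i).inv.mul hH
  obtain ⟨T, hT⟩ := exists_hasFourierTransform N hΨm.aestronglyMeasurable (by
    refine (hP.add hQ).mono' (by fun_prop) ?_
    filter_upwards [ae_rho_allK_ne_zero hz] with k hk
    have hk0 : 0 < ‖k 0‖ := norm_pos_iff.2 (by rw [← allK_zero k]; exact hk.2 0)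
    have hr0 : 0 < ‖rho z k‖ := norm_pos_iff.2 hk.1
    rw [Real.norm_of_nonneg (by positivity), norm_mul, norm_inv, norm_twist hj hjn hk.1 hk.2]
    simp only [Pi.add_apply]
    set a := (j 0).re
    set R := ‖rho z k‖
    set x := ‖k 0‖
    set K := (∏ r, ‖allK k r‖⁻¹) with hK
    have hK' : (∏ r, ‖allK k r‖)⁻¹ = K := by rw [hK, Finset.prod_inv_distrib]
    set g := R ^ (-1 + ε / 2) with hg
    have hg0 : 0 < g := Real.rpow_pos_of_pos hr0 _
    set S := (1 + R) ^ 2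
    set W := ((1 + ‖k‖) ^ N)⁻¹ with hW
    have e1 : R ^ (-(2 - ε)) = g ^ 2 := by
      rw [hg, ← Real.rpow_natCast, ← Real.rpow_mul hr0.le]; congr 1; push_cast; ring
    have e2 : x ^ (-(2 + 4 * a)) = ((x ^ (2 * a + 1))⁻¹) ^ 2 := by
      rw [← Real.rpow_neg hk0.le, ← Real.rpow_natCast, ← Real.rpow_mul hk0.le]
      congr 1; push_cast; ring
    have e3 : R ^ (-ε) = (R⁻¹ * g⁻¹) ^ 2 := by
      rw [hg, ← Real.rpow_neg hr0.le, ← Real.rpow_neg_one R, ← Real.rpow_add hr0,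
        ← Real.rpow_natCast, ← Real.rpow_mul hr0.le]
      congr 1; push_cast; ring
    have e4 : (1 + R) ^ 4 = S ^ 2 := by rw [← pow_mul]
    rw [e1, e2, e3, e4, ← inv_pow ((1 + ‖k‖) ^ N), ← hW, mul_inv, inv_inv, mul_inv, hK']
    have hS0 : S ≠ 0 := by positivity
    -- Cauchy-Schwarz in pointwise form: the squares of the two factors are the integrands of `hP`
    -- and `hQ`, and a product is at most the sum of squares. The auxiliary `g` and `S` make both
    -- `ρ`-integrals converge at zero and infinity.
    have key : R * ((x ^ (2 * a + 1))⁻¹ * K) * ‖H k‖ * W =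
        (‖H k‖ * K * R ^ 2 * g * S⁻¹) * ((x ^ (2 * a + 1))⁻¹ * (R⁻¹ * g⁻¹) * S * W) := by
      field_simp
    rw [key]
    have h2 := two_mul_le_add_sq (‖H k‖ * K * R ^ 2 * g * S⁻¹)
      ((x ^ (2 * a + 1))⁻¹ * (R⁻¹ * g⁻¹) * S * W)
    have h3 : 0 ≤ (‖H k‖ * K * R ^ 2 * g * S⁻¹) *
      ((x ^ (2 * a + 1))⁻¹ * (R⁻¹ * g⁻¹) * S * W) := by positivity
    calc _ ≤ _ := by linarith
      _ ≤ _ := h2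
      _ = _ := by ring_nf)
  refine ⟨T, _, hT, ?_⟩
  have hae' : ∀ᵐ p : (Fin d → ℂ) × ℂ, φs p.1 = φ p.1 := Measure.quasiMeasurePreserving_fst.ae hae
  filter_upwards [ae_prod_ne_zero hz, hae'] with p hp hp'
  rw [mul_inv_cancel_left₀, hHφ _ _ hp.1, hp']
  refine twist_ne_zero (by rw [rho_kOfY hz]; exact hp.1) fun r => ?_
  rw [allK_kOfY hz]
  exact mul_ne_zero hp.1 (hp.2 r)

/-! ### A regularized Mellin transform -/

/-- The subtracted exponential `e^{-s/t} - 1 + e^{-t}`. -/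
def subExp (s t : ℝ) : ℝ := Real.exp (-(s / t)) - 1 + Real.exp (-t)

/-- Uses `e^{-x} ≤ x^{-β}` at `x = s / t` and `0 ≤ 1 - e^{-t} ≤ t`. The free `β` trades smallness in
`t` against a singularity in `s`. -/
lemma abs_subExp_le_of_le_one {s t β : ℝ} (hs : 0 < s) (ht : 0 < t) (hβ0 : 0 ≤ β) (hβ1 : β ≤ 1) :
    |subExp s t| ≤ s ^ (-β) * t ^ β + t := by
  have hx : 0 < s / t := div_pos hs ht
  have h1 : (s / t) ^ β ≤ Real.exp (s / t) := by
    rcases le_total (s / t) 1 with h | h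
    · exact (Real.rpow_le_one hx.le h hβ0).trans (Real.one_le_exp hx.le)
    · calc (s / t) ^ β ≤ (s / t) ^ (1 : ℝ) := Real.rpow_le_rpow_of_exponent_le h hβ1
        _ = s / t := Real.rpow_one _
        _ ≤ Real.exp (s / t) := by linarith [Real.add_one_le_exp (s / t)]
  have h2 : Real.exp (-(s / t)) ≤ s ^ (-β) * t ^ β := by
    have h3 : s ^ (-β) * t ^ β = ((s / t) ^ β)⁻¹ := by
      rw [Real.div_rpow hs.le ht.le, inv_div, Real.rpow_neg hs.le, div_eq_inv_mul]
    rw [Real.exp_neg, h3]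
    exact inv_anti₀ (by positivity) h1
  have h3 : 1 - t ≤ Real.exp (-t) := by linarith [Real.add_one_le_exp (-t)]
  have h4 : Real.exp (-t) ≤ 1 := Real.exp_le_one_iff.2 (by linarith)
  have h5 := Real.exp_pos (-(s / t))
  rw [subExp, abs_le]
  constructor <;> linarith

/-- The bound for large `t`, where the subtraction of `1` is what gives decay. -/
lemma abs_subExp_le {s t : ℝ} (hs : 0 < s) (ht : 0 < t) : |subExp s t| ≤ (s + 1) * t⁻¹ := by
  have hx : 0 < s / t := div_pos hs ht
  have h1 : 1 - s / t ≤ Real.exp (-(s / t)) := by linarith [Real.add_one_le_exp (-(s / t))]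
  have h2 : Real.exp (-(s / t)) ≤ 1 := Real.exp_le_one_iff.2 (by linarith)
  have h3 : Real.exp (-t) ≤ t⁻¹ := by
    rw [Real.exp_neg]
    exact inv_anti₀ ht (by linarith [Real.add_one_le_exp t])
  have h4 := Real.exp_pos (-t)
  have h5 : (s + 1) * t⁻¹ = s / t + t⁻¹ := by rw [add_mul, one_mul, div_eq_mul_inv]
  rw [subExp, abs_le, h5]
  constructor <;> linarith

/-- A dominating function for the Gaussian superposition. -/
def gaussDom (a t : ℝ) : ℝ := if t ≤ 1 then t ^ (a / 2 - 1) + t ^ (a - 1) else t ^ (a - 3)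

lemma integrableOn_gaussDom {a : ℝ} (ha0 : 0 < a) (ha2 : a < 2) :
    IntegrableOn (gaussDom a) (Set.Ioi 0) := by
  rw [← Set.Ioc_union_Ioi_eq_Ioi (zero_le_one (α := ℝ))]
  refine IntegrableOn.union ?_ ?_
  · have h : ∀ c : ℝ, -1 < c → IntegrableOn (fun t : ℝ => t ^ c) (Set.Ioc 0 1) := fun c hc =>
      (intervalIntegrable_iff_integrableOn_Ioc_of_le zero_le_one).1
        (intervalIntegral.intervalIntegrable_rpow' hc)
    refine ((h (a / 2 - 1) (by linarith)).add (h (a - 1) (by linarith))).congr_fun ?_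
      measurableSet_Ioc
    intro t ht
    simp only [gaussDom, if_pos ht.2, Pi.add_apply]
  · have h : IntegrableOn (fun t : ℝ => t ^ (a - 3)) (Set.Ioi 1) :=
      integrableOn_Ioi_rpow_of_lt (by linarith) one_pos
    refine h.congr_fun (fun t ht => ?_) measurableSet_Ioi
    simp only [gaussDom, if_neg (not_le.2 (show (1 : ℝ) < t from ht))]

lemma norm_cpow_mul_subExp_le {α : ℂ} (h0 : 0 < α.re) (h2 : α.re < 2) {s t : ℝ} (hs : 0 < s)
    (ht : 0 < t) : ‖(t : ℂ) ^ (α - 2) * (subExp s t : ℂ)‖ ≤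
      (1 + s + s ^ (α.re / 2 - 1)) * gaussDom α.re t := by
  have hn : ‖(t : ℂ) ^ (α - 2)‖ = t ^ (α.re - 2) := by
    rw [Complex.norm_cpow_eq_rpow_re_of_pos ht]; simp
  rw [norm_mul, hn, Complex.norm_real, Real.norm_eq_abs]
  have hp : 0 < s ^ (α.re / 2 - 1) := by positivity
  unfold gaussDom
  split_ifs with h
  · have h1 := abs_subExp_le_of_le_one (β := 1 - α.re / 2) hs ht (by linarith) (by linarith)
    rw [neg_sub] at h1
    have e1 : t ^ (α.re - 2) * t ^ (1 - α.re / 2) = t ^ (α.re / 2 - 1) := by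
      rw [← Real.rpow_add ht]; congr 1; ring
    have e2 : t ^ (α.re - 2) * t = t ^ (α.re - 1) := by
      rw [← Real.rpow_add_one ht.ne']; congr 1; ring
    calc t ^ (α.re - 2) * |subExp s t|
        ≤ t ^ (α.re - 2) * (s ^ (α.re / 2 - 1) * t ^ (1 - α.re / 2) + t) := by gcongr
      _ = s ^ (α.re / 2 - 1) * t ^ (α.re / 2 - 1) + 1 * t ^ (α.re - 1) := by
          rw [mul_add, e2, mul_left_comm, e1, one_mul]
      _ ≤ (1 + s + s ^ (α.re / 2 - 1)) * t ^ (α.re / 2 - 1) +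
          (1 + s + s ^ (α.re / 2 - 1)) * t ^ (α.re - 1) := by gcongr <;> linarith
      _ = _ := by ring
  · have e1 : t ^ (α.re - 2) * t⁻¹ = t ^ (α.re - 3) := by
      rw [← Real.rpow_neg_one t, ← Real.rpow_add ht]; congr 1; ring
    calc t ^ (α.re - 2) * |subExp s t| ≤ t ^ (α.re - 2) * ((s + 1) * t⁻¹) := by
          gcongr; exact abs_subExp_le hs ht
      _ = (s + 1) * t ^ (α.re - 3) := by rw [mul_left_comm, e1]
      _ ≤ _ := mul_le_mul_of_nonneg_right (by linarith) (by positivity)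

lemma continuousOn_cpow_mul_subExp (α : ℂ) (s : ℝ) :
    ContinuousOn (fun t : ℝ => (t : ℂ) ^ (α - 2) * (subExp s t : ℂ)) (Set.Ioi 0) := by
  intro t ht
  have ht0 : t ≠ 0 := (ne_of_gt ht)
  have h1 : ContinuousAt (fun t : ℝ => (t : ℂ) ^ (α - 2)) t :=
    Complex.continuousAt_ofReal_cpow_const t _ (Or.inr ht0)
  have h2 : ContinuousAt (fun t : ℝ => subExp s t) t := by
    unfold subExp
    fun_prop (disch := exact ht0)
  exact (h1.mul (Complex.continuous_ofReal.continuousAt.comp h2)).continuousWithinAt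

lemma integrableOn_cpow_mul_subExp {α : ℂ} (h0 : 0 < α.re) (h2 : α.re < 2) {s : ℝ} (hs : 0 < s) :
    IntegrableOn (fun t : ℝ => (t : ℂ) ^ (α - 2) * (subExp s t : ℂ)) (Set.Ioi 0) := by
  refine ((integrableOn_gaussDom h0 h2).const_mul (1 + s + s ^ (α.re / 2 - 1))).mono'
    ((continuousOn_cpow_mul_subExp α s).aestronglyMeasurable measurableSet_Ioi) ?_
  exact (ae_restrict_iff' measurableSet_Ioi).2 (ae_of_all _ fun t ht =>
    norm_cpow_mul_subExp_le h0 h2 hs ht)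

/-- The substitution `t ↦ 1 / t` turns this into Euler's integral for `Γ(2 - α)`. -/
lemma inv_cpow_integral {α : ℂ} (h2 : α.re < 2) {s : ℝ} (hs : 0 < s) :
    IntegrableOn (fun t : ℝ => (t : ℂ) ^ (α - 3) * (Real.exp (-(s / t)) : ℂ)) (Set.Ioi 0) ∧
    s * ∫ t in Set.Ioi (0 : ℝ), (t : ℂ) ^ (α - 3) * (Real.exp (-(s / t)) : ℂ) =
      (s : ℂ) ^ (α - 1) * Complex.Gamma (2 - α) := by
  have hre : 0 < (2 - α).re := by simpa using h2
  set G : ℝ → ℂ := fun r => (r : ℂ) ^ ((2 - α) - 1) * Complex.exp (-(s * r)) with hG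
  have hcongr : Set.EqOn (fun t : ℝ => (|(-1 : ℝ)| * t ^ ((-1 : ℝ) - 1)) • G (t ^ (-1 : ℝ)))
      (fun t : ℝ => (t : ℂ) ^ (α - 3) * (Real.exp (-(s / t)) : ℂ)) (Set.Ioi 0) := by
    intro t ht
    have ht0 : 0 < t := ht
    have htc : (t : ℂ) ≠ 0 := by exact_mod_cast ht0.ne'
    simp only [hG, abs_neg, abs_one, one_mul, Complex.real_smul, Real.rpow_neg_one]
    rw [← mul_assoc, Complex.ofReal_exp]
    congr 1
    · rw [Complex.ofReal_inv, Complex.inv_cpow _ _ (by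
        rw [Complex.arg_ofReal_of_nonneg ht0.le]; exact Real.pi_pos.ne), ← Complex.cpow_neg,
        Complex.ofReal_cpow ht0.le, ← Complex.cpow_add _ _ htc]
      congr 1; push_cast; ring
    · congr 1; push_cast; field_simp
  have hGi : IntegrableOn G (Set.Ioi 0) := by
    have h1 := integrableOn_rpow_mul_exp_neg_mul_rpow (p := 1) (s := (2 - α).re - 1) (b := s)
      (by linarith) one_pos hs
    refine Integrable.mono' h1 ?_ ?_
    · refine ContinuousOn.aestronglyMeasurable (fun r hr => ?_) measurableSet_Ioi
      have h1 : ContinuousAt (fun t : ℝ => (t : ℂ) ^ ((2 - α) - 1)) r :=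
        Complex.continuousAt_ofReal_cpow_const r _ (Or.inr (ne_of_gt hr))
      exact (h1.mul (by fun_prop)).continuousWithinAt
    · refine (ae_restrict_iff' measurableSet_Ioi).2 (ae_of_all _ fun t ht => ?_)
      have ht0 : 0 < t := ht
      simp only [hG]
      rw [norm_mul, Complex.norm_cpow_eq_rpow_re_of_pos ht0, Complex.norm_exp]
      simp
  constructor
  · refine IntegrableOn.congr_fun ?_ hcongr measurableSet_Ioi
    exact (integrableOn_Ioi_comp_rpow_iff G (by norm_num)).2 hGi
  · rw [← setIntegral_congr_fun measurableSet_Ioi hcongr, integral_comp_rpow_Ioi G (by norm_num),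
      Complex.integral_cpow_mul_exp_neg_mul_Ioi hre hs, ← mul_assoc]
    congr 1
    have hsc : (s : ℂ) ≠ 0 := by exact_mod_cast hs.ne'
    rw [one_div, Complex.inv_cpow _ _ (by
        rw [Complex.arg_ofReal_of_nonneg hs.le]; exact Real.pi_pos.ne), ← Complex.cpow_neg]
    nth_rewrite 1 [← Complex.cpow_one (s : ℂ)]
    rw [← Complex.cpow_add _ _ hsc]
    congr 1; ring

/-- The regularized Mellin transform of `e^{-s/t}`. -/
lemma one_sub_mul_integral_cpow_mul_subExp {α : ℂ} (h0 : 0 < α.re) (h2 : α.re < 2) {s : ℝ}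
    (hs : 0 < s) :
    (1 - α) * ∫ t in Set.Ioi (0 : ℝ), (t : ℂ) ^ (α - 2) * (subExp s t : ℂ) =
      (s : ℂ) ^ (α - 1) * Complex.Gamma (2 - α) - Complex.Gamma α := by
  obtain ⟨hi1, he1⟩ := inv_cpow_integral h2 hs
  have hi2 := Complex.GammaIntegral_convergent h0
  have he2 : Complex.Gamma α =
      ∫ t in Set.Ioi (0 : ℝ), ((-t).exp : ℂ) * (t : ℂ) ^ (α - 1) := by
    rw [Complex.Gamma_eq_integral h0]; rfl
  have hi3 := integrableOn_cpow_mul_subExp h0 h2 hs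
  -- Integration by parts: `F` vanishes at both ends and `F'` contains the three integrals to be
  -- related. The value at `0` is forced because for `α = 1` the conventions `0 ^ 0 = 1` and `s / 0
  -- = 0` would give `1` instead of the limit.
  set F : ℝ → ℂ := Function.update (fun t : ℝ => (t : ℂ) ^ (α - 1) * (subExp s t : ℂ)) 0 0 with hF
  set F' : ℝ → ℂ := fun t => (α - 1) * ((t : ℂ) ^ (α - 2) * (subExp s t : ℂ)) +
    (s * ((t : ℂ) ^ (α - 3) * (Real.exp (-(s / t)) : ℂ)) -
      ((-t).exp : ℂ) * (t : ℂ) ^ (α - 1)) with hF'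
  have hFn : ∀ t : ℝ, 0 < t → ‖F t‖ = t ^ (α.re - 1) * |subExp s t| := fun t ht => by
    rw [hF, Function.update_of_ne ht.ne', norm_mul, Complex.norm_cpow_eq_rpow_re_of_pos ht,
      Complex.norm_real, Real.norm_eq_abs]
    simp
  have hderiv : ∀ t ∈ Set.Ioi (0 : ℝ), HasDerivAt F (F' t) t := by
    intro t ht
    have ht0 : 0 < t := ht
    have htc : (t : ℂ) ≠ 0 := by exact_mod_cast ht0.ne'
    have d1 : HasDerivAt (fun t : ℝ => (t : ℂ) ^ (α - 1)) ((α - 1) * (t : ℂ) ^ (α - 2)) t := by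
      have := ((hasDerivAt_id (t : ℂ)).cpow_const (c := α - 1)
        (Complex.ofReal_mem_slitPlane.2 ht0)).comp_ofReal
      refine this.congr_deriv ?_
      simp only [id, mul_one]
      congr 2; ring
    have d2 : HasDerivAt (fun t : ℝ => subExp s t)
        (Real.exp (-(s / t)) * (s / t ^ 2) - Real.exp (-t)) t := by
      have e1 : HasDerivAt (fun t : ℝ => -(s / t)) (s / t ^ 2) t := by
        refine ((hasDerivAt_inv ht0.ne').const_mul s).neg.congr_deriv ?_
        ring
      refine ((e1.exp.sub_const 1).add (hasDerivAt_neg t).exp).congr_deriv ?_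
      ring
    have d3 := d1.mul d2.ofReal_comp
    refine (d3.congr_of_eventuallyEq ?_).congr_deriv ?_
    · filter_upwards [lt_mem_nhds ht0] with r hr
      rw [hF, Function.update_of_ne hr.ne']; rfl
    · have c1 : (t : ℂ) ^ (α - 1) = (t : ℂ) ^ (α - 3) * (t : ℂ) ^ 2 := by
        rw [← Complex.cpow_natCast, ← Complex.cpow_add _ _ htc]; congr 1; push_cast; ring
      simp only [hF']
      push_cast
      rw [c1]
      field_simp
  have hcont : ContinuousWithinAt F (Set.Ici 0) 0 := by
    rw [hF, continuousWithinAt_update_same]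
    have hz : ∀ c : ℝ, 0 < c → Tendsto (fun t : ℝ => t ^ c) (𝓝[Set.Ici 0 \ {0}] 0) (𝓝 0) :=
      fun c hc => by
        have := (Real.continuousAt_rpow_const 0 c (Or.inr hc.le)).tendsto
        rw [Real.zero_rpow hc.ne'] at this
        exact this.mono_left nhdsWithin_le_nhds
    have hz' := ((hz (α.re / 2) (by linarith)).const_mul (s ^ (α.re / 2 - 1))).add (hz α.re h0)
    rw [mul_zero, add_zero] at hz'
    refine squeeze_zero_norm' ?_ hz'
    filter_upwards [self_mem_nhdsWithin] with t ht
    have ht0 : 0 < t := lt_of_le_of_ne ht.1 fun h => ht.2 h.symm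
    have h3 := hFn t ht0
    rw [hF, Function.update_of_ne ht0.ne'] at h3
    rw [h3]
    have h1 := abs_subExp_le_of_le_one (β := 1 - α.re / 2) hs ht0 (by linarith) (by linarith)
    rw [neg_sub] at h1
    have e1 : t ^ (α.re - 1) * t ^ (1 - α.re / 2) = t ^ (α.re / 2) := by
      rw [← Real.rpow_add ht0]; congr 1; ring
    have e2 : t ^ (α.re - 1) * t = t ^ α.re := by
      rw [← Real.rpow_add_one ht0.ne']; congr 1; ring
    calc t ^ (α.re - 1) * |subExp s t|
        ≤ t ^ (α.re - 1) * (s ^ (α.re / 2 - 1) * t ^ (1 - α.re / 2) + t) := by gcongr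
      _ = _ := by rw [mul_add, e2, mul_left_comm, e1]
  have htop : Tendsto F atTop (𝓝 0) := by
    have hz := (tendsto_rpow_neg_atTop (y := 2 - α.re) (by linarith)).const_mul (s + 1)
    rw [mul_zero] at hz
    refine squeeze_zero_norm' ?_ hz
    filter_upwards [eventually_gt_atTop 0] with t ht
    have e1 : t ^ (α.re - 1) * t⁻¹ = t ^ (-(2 - α.re)) := by
      rw [← Real.rpow_neg_one t, ← Real.rpow_add ht]; congr 1; ring
    rw [hFn t ht, ← e1, mul_left_comm]
    gcongr
    exact abs_subExp_le hs ht
  have hint : IntegrableOn F' (Set.Ioi 0) :=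
    (hi3.const_mul _).add ((hi1.const_mul _).sub hi2)
  have key := integral_Ioi_of_hasDerivAt_of_tendsto hcont hderiv hint htop
  have hF0 : F 0 = 0 := by simp [hF]
  have hi4 : IntegrableOn (fun t : ℝ => s * ((t : ℂ) ^ (α - 3) * (Real.exp (-(s / t)) : ℂ)) -
      ((-t).exp : ℂ) * (t : ℂ) ^ (α - 1)) (Set.Ioi 0) := (hi1.const_mul _).sub hi2
  have hsum : ∫ t in Set.Ioi (0 : ℝ), F' t = _ := integral_add (hi3.const_mul (α - 1)) hi4
  rw [hF0, sub_zero, hsum, integral_sub (hi1.const_mul _) hi2, integral_const_mul,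
    integral_const_mul, he1, ← he2] at key
  linear_combination -key

/-! ### The Fourier transform of the homogeneous kernel -/

/-- The Fourier kernel on `ℂ`. -/
def expK (ξ u : ℂ) : ℂ := Complex.exp (-2 * Complex.I * ((ξ * u).im : ℂ))

lemma expK_eq (ξ u : ℂ) : expK ξ u = Complex.exp (Complex.I * ((-2 * (ξ * u).im : ℝ) : ℂ)) := by
  rw [expK]; congr 1; push_cast; ring

lemma norm_expK (ξ u : ℂ) : ‖expK ξ u‖ = 1 := by
  rw [expK_eq, mul_comm, Complex.norm_exp_ofReal_mul_I]

lemma continuous_expK : Continuous fun p : ℂ × ℂ => expK p.1 p.2 := by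
  unfold expK; fun_prop

@[fun_prop]
lemma measurable_expK {X : Type*} [MeasurableSpace X] {f g : X → ℂ} (hf : Measurable f)
    (hg : Measurable g) : Measurable fun x => expK (f x) (g x) :=
  continuous_expK.measurable.comp (hf.prodMk hg)

lemma expK_zero (ξ : ℂ) : expK ξ 0 = 1 := by simp [expK]

/-- From `e^{ix} + e^{-ix} - 2 = -(e^{ix} - 1)(e^{-ix} - 1)`, each factor being of size at most
`|x|`. -/
lemma norm_expK_add_expK_neg_sub_two_le (ξ u : ℂ) :
    ‖expK ξ u + expK ξ (-u) - 2‖ ≤ 4 * (‖ξ‖ ^ 2 * ‖u‖ ^ 2) := by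
  set x : ℝ := -2 * (ξ * u).im with hx
  have h1 : expK ξ u = Complex.exp (Complex.I * (x : ℂ)) := expK_eq ξ u
  have h2 : expK ξ (-u) = Complex.exp (Complex.I * ((-x : ℝ) : ℂ)) := by
    rw [expK_eq]; congr 3; rw [hx, mul_neg, Complex.neg_im, mul_neg]
  have h3 : Complex.exp (Complex.I * (x : ℂ)) * Complex.exp (Complex.I * ((-x : ℝ) : ℂ)) = 1 := by
    rw [← Complex.exp_add]; simp
  have h4 : expK ξ u + expK ξ (-u) - 2 = -((Complex.exp (Complex.I * (x : ℂ)) - 1) *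
      (Complex.exp (Complex.I * ((-x : ℝ) : ℂ)) - 1)) := by
    rw [h1, h2]; linear_combination h3
  have h5 : |x| ≤ 2 * (‖ξ‖ * ‖u‖) := by
    rw [hx, abs_mul, ← norm_mul]
    simpa using Complex.abs_im_le_norm (ξ * u)
  rw [h4, norm_neg, norm_mul]
  calc _ ≤ ‖x‖ * ‖-x‖ := mul_le_mul Real.norm_exp_I_mul_ofReal_sub_one_le
        Real.norm_exp_I_mul_ofReal_sub_one_le (norm_nonneg _) (norm_nonneg _)
    _ = |x| ^ 2 := by rw [norm_neg, Real.norm_eq_abs, sq]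
    _ ≤ (2 * (‖ξ‖ * ‖u‖)) ^ 2 := pow_le_pow_left₀ (abs_nonneg _) h5 2
    _ = _ := by ring

lemma integrable_gauss {t : ℝ} (ht : 0 < t) : Integrable fun u : ℂ => Real.exp (-t * ‖u‖ ^ 2) := by
  have h := (GaussianFourier.integrable_cexp_neg_mul_sq_norm_add (V := ℂ) (b := t)
    (by simpa using ht) 0 0).norm
  refine h.congr (ae_of_all _ fun u => ?_)
  simp only [zero_mul, add_zero, Complex.norm_exp]
  congr 1
  rw [← Complex.ofReal_neg, ← Complex.ofReal_pow, ← Complex.ofReal_mul, Complex.ofReal_re]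

lemma integral_gauss_mul_expK {t : ℝ} (ht : 0 < t) (ξ : ℂ) :
    ∫ u : ℂ, (Real.exp (-t * ‖u‖ ^ 2) : ℂ) * expK ξ u =
      (Real.pi / t : ℂ) * (Real.exp (-(‖ξ‖ ^ 2 / t)) : ℂ) := by
  have h := GaussianFourier.integral_cexp_neg_mul_sq_norm_add (V := ℂ) (b := t)
    -- The real inner product of `I * conj ξ` with `u` is `Im (ξ u)`.
    (by simpa using ht) (-2 * Complex.I) (Complex.I * (starRingEnd ℂ) ξ)
  rw [Complex.finrank_real_complex] at h
  have htc : (t : ℂ) ≠ 0 := by exact_mod_cast ht.ne'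
  have e1 : (Real.pi / t : ℂ) ^ (((2 : ℕ) : ℂ) / 2) = Real.pi / t := by
    rw [Nat.cast_ofNat, div_self two_ne_zero, Complex.cpow_one]
  rw [e1] at h
  convert h using 1
  · refine integral_congr_ae (ae_of_all _ fun u => ?_)
    simp only
    rw [expK, Complex.ofReal_exp, ← Complex.exp_add]
    congr 1
    push_cast
    congr 2
    rw [Complex.inner]
    simp
    ring
  · congr 1
    rw [Complex.ofReal_exp]
    congr 1
    push_cast
    have : ‖Complex.I * (starRingEnd ℂ) ξ‖ = ‖ξ‖ := by simp
    rw [this, mul_pow, Complex.I_sq]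
    field_simp
    norm_num

lemma integral_ball_gauss {t : ℝ} (ht : 0 < t) :
    ∫ u in Metric.ball (0 : ℂ) 1, (Real.exp (-t * ‖u‖ ^ 2) : ℂ) =
      (Real.pi / t : ℂ) * (1 - (Real.exp (-t) : ℂ)) := by
  set f : ℝ → ℝ := (Set.Iio 1).indicator fun r => Real.exp (-t * r ^ 2) with hf
  have h1 : ∫ u in Metric.ball (0 : ℂ) 1, Real.exp (-t * ‖u‖ ^ 2) = ∫ u : ℂ, f ‖u‖ := by
    rw [← integral_indicator Metric.isOpen_ball.measurableSet]
    refine integral_congr_ae (ae_of_all _ fun u => ?_)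
    simp only [hf, Set.indicator, Metric.mem_ball, dist_zero_right, Set.mem_Iio]
  have h2 : ∫ y in Set.Ioi (0 : ℝ), y ^ (2 - 1) • f y = (1 - Real.exp (-t)) / (2 * t) := by
    have e1 : ∫ y in Set.Ioi (0 : ℝ), y ^ (2 - 1) • f y =
        ∫ y in (0 : ℝ)..1, y * Real.exp (-t * y ^ 2) := by
      rw [intervalIntegral.integral_of_le zero_le_one, integral_Ioc_eq_integral_Ioo,
        ← integral_indicator measurableSet_Ioi, ← integral_indicator measurableSet_Ioo]
      refine integral_congr_ae (ae_of_all _ fun y => ?_)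
      simp only [hf, Set.indicator, Set.mem_Ioi, Set.mem_Ioo, Set.mem_Iio, smul_eq_mul]
      by_cases h0 : 0 < y <;> by_cases h1 : y < 1 <;> simp [h0, h1]
    have e2 : ∀ y ∈ Set.uIcc (0 : ℝ) 1, HasDerivAt (fun y : ℝ => -Real.exp (-t * y ^ 2) / (2 * t))
        (y * Real.exp (-t * y ^ 2)) y := fun y _ => by
      have := ((((hasDerivAt_pow 2 y).const_mul (-t)).exp).neg).div_const (2 * t)
      refine this.congr_deriv ?_
      field_simp
      simp [mul_comm]
    rw [e1, intervalIntegral.integral_eq_sub_of_hasDerivAt e2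
      (Continuous.intervalIntegrable (by fun_prop) _ _)]
    simp
    ring
  have h3 : ∫ u in Metric.ball (0 : ℂ) 1, Real.exp (-t * ‖u‖ ^ 2) =
      Real.pi / t * (1 - Real.exp (-t)) := by
    rw [h1, integral_fun_norm_addHaar volume f, Complex.finrank_real_complex, h2, Measure.real,
      Complex.volume_ball]
    simp
    field_simp
  rw [integral_complex_ofReal, h3]
  push_cast
  ring

lemma sq_cpow {x : ℝ} (hx : 0 < x) (c : ℂ) : ((x ^ 2 : ℝ) : ℂ) ^ c = (x : ℂ) ^ (2 * c) := by
  have hxc : (x : ℂ) ≠ 0 := by exact_mod_cast hx.ne'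
  have hxc2 : ((x ^ 2 : ℝ) : ℂ) ≠ 0 := by exact_mod_cast (pow_pos hx 2).ne'
  rw [Complex.cpow_def_of_ne_zero hxc, Complex.cpow_def_of_ne_zero hxc2,
    ← Complex.ofReal_log (by positivity), ← Complex.ofReal_log hx.le, Real.log_pow]
  congr 1; push_cast; ring

/-- The even part of `h`, with `h 0` subtracted on the unit disc. -/
def evenSub (h : ℂ → ℂ) (u : ℂ) : ℂ :=
  (1 / 2) * (h u + h (-u)) - (Metric.ball (0 : ℂ) 1).indicator (fun _ => h 0) u

section Kernel

variable {α : ℂ} {g h : ℂ → ℂ}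

/-- Evenness of the Gaussian merges the two halves of `evenSub`. The disc contributes `(π / t) (1 -
e^{-t}) h 0`, and `h 0 = ∫ g` puts it under the same integral; this is the origin of `subExp`. -/
lemma integral_gauss_mul_evenSub (hg : Integrable g) (hh : ∀ u, h u = ∫ ξ, g ξ * expK ξ u)
    {t : ℝ} (ht : 0 < t) (hhm : Measurable h) :
    ∫ u, (Real.exp (-t * ‖u‖ ^ 2) : ℂ) * evenSub h u =
      (Real.pi / t : ℂ) * ∫ ξ, g ξ * (subExp (‖ξ‖ ^ 2) t : ℂ) := by
  have hG := integrable_gauss ht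
  have hbd : ∀ u, ‖h u‖ ≤ ∫ ξ, ‖g ξ‖ := fun u => by
    rw [hh]
    refine (norm_integral_le_integral_norm _).trans_eq ?_
    simp only [norm_mul, norm_expK, mul_one]
  have hGh : Integrable fun u => (Real.exp (-t * ‖u‖ ^ 2) : ℂ) * h u :=
    hG.ofReal.mul_bdd hhm.aestronglyMeasurable (ae_of_all _ hbd)
  have hGh' : Integrable fun u => (Real.exp (-t * ‖u‖ ^ 2) : ℂ) * h (-u) := by
    simpa using hGh.comp_neg
  have e1 : ∫ u, (Real.exp (-t * ‖u‖ ^ 2) : ℂ) * h (-u) =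
      ∫ u, (Real.exp (-t * ‖u‖ ^ 2) : ℂ) * h u := by
    rw [← integral_neg_eq_self]
    simp
  have e2 : ∫ u, (Real.exp (-t * ‖u‖ ^ 2) : ℂ) * h u =
      (Real.pi / t : ℂ) * ∫ ξ, g ξ * (Real.exp (-(‖ξ‖ ^ 2 / t)) : ℂ) := by
    have hI : Integrable (fun p : ℂ × ℂ =>
        (Real.exp (-t * ‖p.1‖ ^ 2) : ℂ) * (g p.2 * expK p.2 p.1)) (volume.prod volume) := by
      have h1 := (hG.ofReal (𝕜 := ℂ)).mul_prod hg
      have h2 : Integrable (fun p : ℂ × ℂ => ((Real.exp (-t * ‖p.1‖ ^ 2) : ℂ) * g p.2) * expK p.2 p.1)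
          (volume.prod volume) :=
        h1.mul_bdd (c := 1) (Measurable.aestronglyMeasurable (by fun_prop))
          (ae_of_all _ fun p => (norm_expK _ _).le)
      simpa only [mul_assoc] using h2
    calc ∫ u, (Real.exp (-t * ‖u‖ ^ 2) : ℂ) * h u
        = ∫ u, ∫ ξ, (Real.exp (-t * ‖u‖ ^ 2) : ℂ) * (g ξ * expK ξ u) := by
          simp only [hh, integral_const_mul]
      _ = ∫ ξ, ∫ u, (Real.exp (-t * ‖u‖ ^ 2) : ℂ) * (g ξ * expK ξ u) :=
          integral_integral_swap hI
      _ = ∫ ξ, g ξ * ((Real.pi / t : ℂ) * (Real.exp (-(‖ξ‖ ^ 2 / t)) : ℂ)) := by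
          refine integral_congr_ae (ae_of_all _ fun ξ => ?_)
          simp only
          rw [← integral_gauss_mul_expK ht, ← integral_const_mul]
          exact integral_congr_ae (ae_of_all _ fun u => by simp only; ring)
      _ = _ := by
          rw [← integral_const_mul]
          exact integral_congr_ae (ae_of_all _ fun u => by simp only; ring)
  have e3 : ∫ u, (Real.exp (-t * ‖u‖ ^ 2) : ℂ) *
      (Metric.ball (0 : ℂ) 1).indicator (fun _ => h 0) u =
      (Real.pi / t : ℂ) * (1 - (Real.exp (-t) : ℂ)) * h 0 := by
    rw [← integral_ball_gauss ht, ← integral_mul_const,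
      ← integral_indicator Metric.isOpen_ball.measurableSet]
    refine integral_congr_ae (ae_of_all _ fun u => ?_)
    simp only [Set.indicator]
    split_ifs <;> simp
  have hi3 : Integrable fun u => (Real.exp (-t * ‖u‖ ^ 2) : ℂ) *
      (Metric.ball (0 : ℂ) 1).indicator (fun _ => h 0) u := by
    refine hG.ofReal.mul_bdd (c := ‖h 0‖) ?_ (ae_of_all _ fun u => ?_)
    · exact (measurable_const.indicator Metric.isOpen_ball.measurableSet).aestronglyMeasurable
    · exact norm_indicator_le_norm_self (fun _ => h 0) u
  have h0 : h 0 = ∫ ξ, g ξ := by rw [hh]; simp [expK_zero]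
  have hi4 : Integrable fun ξ => g ξ * (Real.exp (-(‖ξ‖ ^ 2 / t)) : ℂ) := by
    refine hg.mul_bdd (c := 1) (Measurable.aestronglyMeasurable (by fun_prop)) (ae_of_all _ fun ξ => ?_)
    rw [Complex.norm_real, Real.norm_of_nonneg (Real.exp_pos _).le, Real.exp_le_one_iff,
      neg_nonpos]
    positivity
  have e4 : ∫ ξ, g ξ * (subExp (‖ξ‖ ^ 2) t : ℂ) =
      (∫ ξ, g ξ * (Real.exp (-(‖ξ‖ ^ 2 / t)) : ℂ)) - (1 - (Real.exp (-t) : ℂ)) * h 0 := by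
    rw [h0, ← integral_const_mul, ← integral_sub hi4 (hg.const_mul _)]
    refine integral_congr_ae (ae_of_all _ fun ξ => ?_)
    simp only [subExp]
    push_cast
    ring
  have e5 : ∫ u, (Real.exp (-t * ‖u‖ ^ 2) : ℂ) * evenSub h u =
      (1 / 2) * ((∫ u, (Real.exp (-t * ‖u‖ ^ 2) : ℂ) * h u) +
        ∫ u, (Real.exp (-t * ‖u‖ ^ 2) : ℂ) * h (-u)) -
      ∫ u, (Real.exp (-t * ‖u‖ ^ 2) : ℂ) *
        (Metric.ball (0 : ℂ) 1).indicator (fun _ => h 0) u := by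
    have hs : Integrable fun u => (1 / 2 : ℂ) * ((Real.exp (-t * ‖u‖ ^ 2) : ℂ) * h u +
        (Real.exp (-t * ‖u‖ ^ 2) : ℂ) * h (-u)) := (hGh.add hGh').const_mul _
    rw [← integral_add hGh hGh', ← integral_const_mul, ← integral_sub hs hi3]
    refine integral_congr_ae (ae_of_all _ fun u => ?_)
    simp only [evenSub]
    ring
  rw [e5, e1, e2, e3, e4]
  ring

lemma norm_norm_cpow {u : ℂ} (hu : u ≠ 0) (c : ℂ) : ‖(‖u‖ : ℂ) ^ c‖ = ‖u‖ ^ c.re :=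
  Complex.norm_cpow_eq_rpow_re_of_pos (norm_pos_iff.2 hu) c

lemma ae_ne_zero : ∀ᵐ u : ℂ, u ≠ 0 := by rw [ae_iff]; simp

lemma measurable_evenSub (hm : Measurable h) : Measurable (evenSub h) := by
  have : Measurable fun u => (Metric.ball (0 : ℂ) 1).indicator (fun _ => h 0) u :=
    measurable_const.indicator Metric.isOpen_ball.measurableSet
  unfold evenSub
  fun_prop

/-- Subtracting `h 0` and symmetrizing leaves a second order remainder, controlled by the second
moment of `g`. This order makes `‖u‖ ^ (-2 α.re)` integrable up to `α.re < 2`. -/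
lemma norm_evenSub_le (hg : Integrable g) (hg2 : Integrable fun ξ => ‖ξ‖ ^ 2 * ‖g ξ‖)
    (hh : ∀ u, h u = ∫ ξ, g ξ * expK ξ u) {u : ℂ} (hu : u ∈ Metric.ball (0 : ℂ) 1) :
    ‖evenSub h u‖ ≤ 2 * (∫ ξ, ‖ξ‖ ^ 2 * ‖g ξ‖) * ‖u‖ ^ 2 := by
  have hi : ∀ u, Integrable fun ξ => g ξ * expK ξ u := fun u =>
    hg.mul_bdd (c := 1) (Measurable.aestronglyMeasurable (by fun_prop))
      (ae_of_all _ fun ξ => (norm_expK _ _).le)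
  have h0 : h 0 = ∫ ξ, g ξ := by rw [hh]; simp [expK_zero]
  have e : evenSub h u = (1 / 2) * ∫ ξ, g ξ * (expK ξ u + expK ξ (-u) - 2) := by
    rw [evenSub, Set.indicator_of_mem hu, h0, hh u, hh (-u)]
    have e1 : ∫ ξ, g ξ * (expK ξ u + expK ξ (-u) - 2) =
        ((∫ ξ, g ξ * expK ξ u) + ∫ ξ, g ξ * expK ξ (-u)) - ∫ ξ, 2 * g ξ := by
      have hs : Integrable fun ξ => g ξ * expK ξ u + g ξ * expK ξ (-u) := (hi u).add (hi (-u))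
      rw [← integral_add (hi u) (hi (-u)), ← integral_sub hs (hg.const_mul 2)]
      exact integral_congr_ae (ae_of_all _ fun ξ => by simp only; ring)
    rw [e1, integral_const_mul]
    ring
  rw [e, norm_mul]
  have h1 : ‖∫ ξ, g ξ * (expK ξ u + expK ξ (-u) - 2)‖ ≤
      ∫ ξ, 4 * ‖u‖ ^ 2 * (‖ξ‖ ^ 2 * ‖g ξ‖) := by
    refine norm_integral_le_of_norm_le (hg2.const_mul _) (ae_of_all _ fun ξ => ?_)
    rw [norm_mul]
    calc ‖g ξ‖ * ‖expK ξ u + expK ξ (-u) - 2‖ ≤ ‖g ξ‖ * (4 * (‖ξ‖ ^ 2 * ‖u‖ ^ 2)) := by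
          gcongr; exact norm_expK_add_expK_neg_sub_two_le ξ u
      _ = _ := by ring
  rw [integral_const_mul] at h1
  have h2 : ‖(1 / 2 : ℂ)‖ = 1 / 2 := by simp
  rw [h2]
  linarith

lemma integrable_cpow_mul_evenSub (h0 : 0 < α.re) (h2 : α.re < 2) (hg : Integrable g)
    (hg2 : Integrable fun ξ => ‖ξ‖ ^ 2 * ‖g ξ‖)
    (hh : ∀ u, h u = ∫ ξ, g ξ * expK ξ u) (hm : Measurable h) (hi : Integrable h) :
    Integrable fun u => (‖u‖ : ℂ) ^ (-2 * α) * evenSub h u := by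
  have hre : (-2 * α).re = -(2 * α.re) := by simp
  have hmm : Measurable fun u : ℂ => (‖u‖ : ℂ) ^ (-2 * α) * evenSub h u := by
    have := measurable_evenSub hm
    fun_prop
  rw [← integrableOn_univ, ← Set.union_compl_self (Metric.ball (0 : ℂ) 1)]
  refine IntegrableOn.union ?_ ?_
  · have h1 := (integrable_norm_rpow_neg_mul (q := 2 * α.re - 2) (M := 4) (by linarith)
      (by push_cast; linarith)).const_mul (2 * (∫ ξ, ‖ξ‖ ^ 2 * ‖g ξ‖) * 2 ^ 4)
    refine (h1.integrableOn (s := Metric.ball 0 1)).mono' hmm.aestronglyMeasurable ?_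
    refine (ae_restrict_iff' Metric.isOpen_ball.measurableSet).2 ?_
    filter_upwards [ae_ne_zero] with u hu0 hu
    have hu1 : ‖u‖ < 1 := by simpa using hu
    have hup : 0 < ‖u‖ := norm_pos_iff.2 hu0
    have hM : 0 ≤ ∫ ξ, ‖ξ‖ ^ 2 * ‖g ξ‖ := integral_nonneg fun ξ => by positivity
    rw [norm_mul, norm_norm_cpow hu0, hre]
    have e1 : ‖u‖ ^ (-(2 * α.re - 2)) = ‖u‖ ^ (-(2 * α.re)) * ‖u‖ ^ 2 := by
      rw [← Real.rpow_natCast, ← Real.rpow_add hup]; congr 1; push_cast; ring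
    have e2 : 1 ≤ 2 ^ 4 * ((1 + ‖u‖) ^ 4)⁻¹ := by
      rw [← div_eq_mul_inv, one_le_div (by positivity)]
      exact pow_le_pow_left₀ (by positivity) (by linarith) 4
    calc ‖u‖ ^ (-(2 * α.re)) * ‖evenSub h u‖
        ≤ ‖u‖ ^ (-(2 * α.re)) * (2 * (∫ ξ, ‖ξ‖ ^ 2 * ‖g ξ‖) * ‖u‖ ^ 2) := by
          gcongr; exact norm_evenSub_le hg hg2 hh hu
      _ = (2 * (∫ ξ, ‖ξ‖ ^ 2 * ‖g ξ‖) * ‖u‖ ^ (-(2 * α.re - 2))) * 1 := by rw [e1]; ring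
      _ ≤ (2 * (∫ ξ, ‖ξ‖ ^ 2 * ‖g ξ‖) * ‖u‖ ^ (-(2 * α.re - 2))) *
          (2 ^ 4 * ((1 + ‖u‖) ^ 4)⁻¹) := by gcongr
      _ = _ := by ring
  · have h1 : Integrable fun u => ‖h u‖ + ‖h (-u)‖ := hi.norm.add hi.comp_neg.norm
    refine (h1.integrableOn (s := (Metric.ball 0 1)ᶜ)).mono' hmm.aestronglyMeasurable ?_
    refine (ae_restrict_iff' Metric.isOpen_ball.measurableSet.compl).2 ?_
    filter_upwards [ae_ne_zero] with u hu0 hu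
    have hu1 : 1 ≤ ‖u‖ := by simpa using hu
    rw [norm_mul, norm_norm_cpow hu0, hre, evenSub, Set.indicator_of_notMem hu, sub_zero, norm_mul]
    have e1 : ‖u‖ ^ (-(2 * α.re)) ≤ 1 := Real.rpow_le_one_of_one_le_of_nonpos hu1 (by linarith)
    have e2 : ‖(1 / 2 : ℂ)‖ = 1 / 2 := by simp
    have e3 := norm_add_le (h u) (h (-u))
    rw [e2]
    calc _ ≤ 1 * (1 / 2 * ‖h u + h (-u)‖) := by gcongr
      _ ≤ _ := by linarith [norm_nonneg (h u), norm_nonneg (h (-u))]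

/-- The weight that makes the regularized Mellin transform absolutely convergent. -/
def gaussWeight (α : ℂ) (ξ : ℂ) : ℝ := 1 + ‖ξ‖ ^ 2 + (‖ξ‖ ^ 2) ^ (α.re / 2 - 1)

/-- Writes `Γ(α) |u|^{-2α}` as `∫ t^{α-1} e^{-t|u|²} dt`, exchanges the integrals, applies
`integral_gauss_mul_evenSub` for each `t`, and exchanges back with `ξ` in place of `u`. -/
lemma gamma_mul_integral_evenSub (h0 : 0 < α.re) (h2 : α.re < 2) (hg : Integrable g)
    (hg2 : Integrable fun ξ => ‖ξ‖ ^ 2 * ‖g ξ‖)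
    (hw : Integrable fun ξ => gaussWeight α ξ * ‖g ξ‖)
    (hh : ∀ u, h u = ∫ ξ, g ξ * expK ξ u) (hm : Measurable h) (hi : Integrable h) :
    Complex.Gamma α * ∫ u, (‖u‖ : ℂ) ^ (-2 * α) * evenSub h u =
      Real.pi * ∫ ξ, g ξ * ∫ t in Set.Ioi (0 : ℝ),
        (t : ℂ) ^ (α - 2) * (subExp (‖ξ‖ ^ 2) t : ℂ) := by
  have hB := integrable_cpow_mul_evenSub h0 h2 hg hg2 hh hm hi
  have hem := measurable_evenSub hm
  have htpos : ∀ᵐ p : ℂ × ℝ ∂(volume.prod (volume.restrict (Set.Ioi 0))), 0 < p.2 :=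
    Measure.quasiMeasurePreserving_snd.ae (ae_restrict_mem measurableSet_Ioi)
  have hξ0 : ∀ᵐ p : ℂ × ℝ ∂(volume.prod (volume.restrict (Set.Ioi 0))), p.1 ≠ 0 :=
    Measure.quasiMeasurePreserving_fst.ae ae_ne_zero
  have hswap1 : Integrable (fun p : ℂ × ℝ => (p.2 : ℂ) ^ (α - 1) *
      (Real.exp (-p.2 * ‖p.1‖ ^ 2) : ℂ) * evenSub h p.1)
      (volume.prod (volume.restrict (Set.Ioi 0))) := by
    refine (integrable_prod_iff (Measurable.aestronglyMeasurable (by fun_prop))).2 ⟨?_, ?_⟩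
    · filter_upwards [ae_ne_zero] with u hu
      have hup : 0 < ‖u‖ ^ 2 := pow_pos (norm_pos_iff.2 hu) 2
      have h1 := integrableOn_rpow_mul_exp_neg_mul_rpow (p := 1) (s := α.re - 1) (b := ‖u‖ ^ 2)
        (by linarith) one_pos hup
      refine Integrable.mul_const ?_ _
      refine Integrable.mono' h1 (Measurable.aestronglyMeasurable (by fun_prop)) ?_
      refine (ae_restrict_iff' measurableSet_Ioi).2 (ae_of_all _ fun t ht => ?_)
      rw [norm_mul, Complex.norm_cpow_eq_rpow_re_of_pos ht, Complex.norm_real,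
        Real.norm_of_nonneg (Real.exp_pos _).le, Real.rpow_one]
      refine le_of_eq ?_
      congr 2
      ring
    · refine (hB.norm.const_mul (Real.Gamma α.re)).congr ?_
      filter_upwards [ae_ne_zero] with u hu
      have hup : 0 < ‖u‖ ^ 2 := pow_pos (norm_pos_iff.2 hu) 2
      have e1 : ∫ t in Set.Ioi (0 : ℝ), ‖(t : ℂ) ^ (α - 1) *
          (Real.exp (-t * ‖u‖ ^ 2) : ℂ) * evenSub h u‖ =
          (∫ t in Set.Ioi (0 : ℝ), t ^ (α.re - 1) * Real.exp (-(‖u‖ ^ 2 * t))) *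
            ‖evenSub h u‖ := by
        rw [← integral_mul_const]
        refine setIntegral_congr_fun measurableSet_Ioi fun t ht => ?_
        rw [norm_mul, norm_mul, Complex.norm_cpow_eq_rpow_re_of_pos ht, Complex.norm_real,
          Real.norm_of_nonneg (Real.exp_pos _).le]
        congr 3
        ring
      have e2 : (1 / ‖u‖ ^ 2) ^ α.re = ‖u‖ ^ (-(2 * α.re)) := by
        rw [one_div, Real.inv_rpow hup.le, ← Real.rpow_natCast, ← Real.rpow_mul (norm_nonneg u),
          ← Real.rpow_neg (norm_nonneg u)]
        norm_num
      rw [e1, Real.integral_rpow_mul_exp_neg_mul_Ioi h0 hup, norm_mul, norm_norm_cpow hu, e2]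
      have : (-2 * α).re = -(2 * α.re) := by simp
      rw [this]
      ring
  have hswap2 : Integrable (fun p : ℂ × ℝ => g p.1 *
      ((p.2 : ℂ) ^ (α - 2) * (subExp (‖p.1‖ ^ 2) p.2 : ℂ)))
      (volume.prod (volume.restrict (Set.Ioi 0))) := by
    refine (hw.mul_prod (integrableOn_gaussDom h0 h2)).mono' ?_ ?_
    · refine hg.1.comp_fst.mul (Measurable.aestronglyMeasurable ?_)
      unfold subExp
      fun_prop
    · filter_upwards [htpos, hξ0] with p hp hp0
      have h1 := norm_cpow_mul_subExp_le h0 h2 (s := ‖p.1‖ ^ 2)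
        (pow_pos (norm_pos_iff.2 hp0) 2) hp
      rw [norm_mul]
      calc _ ≤ ‖g p.1‖ * (gaussWeight α p.1 * gaussDom α.re p.2) := by gcongr; exact h1
        _ = _ := by ring
  have e1 : Complex.Gamma α * ∫ u, (‖u‖ : ℂ) ^ (-2 * α) * evenSub h u =
      ∫ u, ∫ t in Set.Ioi (0 : ℝ), (t : ℂ) ^ (α - 1) *
        (Real.exp (-t * ‖u‖ ^ 2) : ℂ) * evenSub h u := by
    rw [← integral_const_mul]
    refine integral_congr_ae ?_
    filter_upwards [ae_ne_zero] with u hu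
    have hun : 0 < ‖u‖ := norm_pos_iff.2 hu
    have hup : 0 < ‖u‖ ^ 2 := pow_pos hun 2
    have h3 := Complex.integral_cpow_mul_exp_neg_mul_Ioi h0 hup
    have h4 : (1 / (‖u‖ ^ 2 : ℝ) : ℂ) ^ α = (‖u‖ : ℂ) ^ (-2 * α) := by
      rw [one_div, Complex.inv_cpow _ _ (by
        rw [Complex.arg_ofReal_of_nonneg hup.le]; exact Real.pi_pos.ne), sq_cpow hun,
        ← Complex.cpow_neg]
      congr 1; ring
    rw [integral_mul_const, ← h4, ← mul_assoc, mul_comm (Complex.Gamma α), ← h3]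
    congr 1
    refine setIntegral_congr_fun measurableSet_Ioi fun t ht => ?_
    rw [Complex.ofReal_exp]
    congr 2
    push_cast
    ring
  have e2 : ∫ t in Set.Ioi (0 : ℝ), ∫ u, (t : ℂ) ^ (α - 1) *
      (Real.exp (-t * ‖u‖ ^ 2) : ℂ) * evenSub h u =
      ∫ t in Set.Ioi (0 : ℝ), ∫ ξ, Real.pi * (g ξ *
        ((t : ℂ) ^ (α - 2) * (subExp (‖ξ‖ ^ 2) t : ℂ))) := by
    refine setIntegral_congr_fun measurableSet_Ioi fun t ht => ?_
    have ht0 : 0 < t := ht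
    have htc : (t : ℂ) ≠ 0 := by exact_mod_cast ht0.ne'
    simp only [mul_assoc]
    rw [integral_const_mul, integral_gauss_mul_evenSub hg hh ht hm, integral_const_mul,
      ← mul_assoc, ← integral_const_mul, ← integral_const_mul]
    refine integral_congr_ae (ae_of_all _ fun ξ => ?_)
    have c1 : (t : ℂ) ^ (α - 1) = (t : ℂ) ^ (α - 2) * t := by
      rw [show α - 1 = (α - 2) + 1 by ring, Complex.cpow_add _ _ htc, Complex.cpow_one]
    simp only [c1]
    field_simp
  rw [e1, integral_integral_swap hswap1, e2,
    ← integral_integral_swap (f := fun (ξ : ℂ) (t : ℝ) => (Real.pi : ℂ) * (g ξ *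
        ((t : ℂ) ^ (α - 2) * (subExp (‖ξ‖ ^ 2) t : ℂ)))) (hswap2.const_mul (Real.pi : ℂ)),
    ← integral_const_mul]
  refine integral_congr_ae (ae_of_all _ fun ξ => ?_)
  simp only [integral_const_mul]

/-- The exponent lies between `α.re - 2`, which governs small `ξ`, and `2`, which governs large `ξ`.
-/
lemma norm_rpow_le_gaussWeight (h0 : 0 < α.re) (h2 : α.re < 2) {ξ : ℂ} (hξ : ξ ≠ 0) :
    ‖ξ‖ ^ (2 * α.re - 2) ≤ gaussWeight α ξ := by
  have hp : 0 < ‖ξ‖ := norm_pos_iff.2 hξ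
  have e1 : (‖ξ‖ ^ 2) ^ (α.re / 2 - 1) = ‖ξ‖ ^ (α.re - 2) := by
    rw [← Real.rpow_natCast, ← Real.rpow_mul hp.le]; congr 1; push_cast; ring
  rw [gaussWeight, e1]
  have h3 : 0 < ‖ξ‖ ^ (α.re - 2) := by positivity
  rcases le_total ‖ξ‖ 1 with h | h
  · have := Real.rpow_le_rpow_of_exponent_ge hp h (show α.re - 2 ≤ 2 * α.re - 2 by linarith)
    nlinarith [sq_nonneg ‖ξ‖]
  · have := Real.rpow_le_rpow_of_exponent_le h (show 2 * α.re - 2 ≤ 2 by linarith)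
    rw [Real.rpow_two] at this
    linarith

lemma integrable_cpow_mul_of_gaussWeight (h0 : 0 < α.re) (h2 : α.re < 2) (hg : Integrable g)
    (hw : Integrable fun ξ => gaussWeight α ξ * ‖g ξ‖) :
    Integrable fun ξ => (‖ξ‖ : ℂ) ^ (2 * α - 2) * g ξ := by
  refine hw.mono' ((Measurable.aestronglyMeasurable (by fun_prop)).mul hg.1) ?_
  filter_upwards [ae_ne_zero] with ξ hξ
  rw [norm_mul, norm_norm_cpow hξ]
  have : (2 * α - 2).re = 2 * α.re - 2 := by simp
  rw [this]
  exact mul_le_mul_of_nonneg_right (norm_rpow_le_gaussWeight h0 h2 hξ) (norm_nonneg _)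

lemma one_sub_mul_gamma_mul_integral_evenSub (h0 : 0 < α.re) (h2 : α.re < 2) (hg : Integrable g)
    (hg2 : Integrable fun ξ => ‖ξ‖ ^ 2 * ‖g ξ‖)
    (hw : Integrable fun ξ => gaussWeight α ξ * ‖g ξ‖)
    (hh : ∀ u, h u = ∫ ξ, g ξ * expK ξ u) (hm : Measurable h) (hi : Integrable h) :
    (1 - α) * (Complex.Gamma α * ∫ u, (‖u‖ : ℂ) ^ (-2 * α) * evenSub h u) =
      Real.pi * (Complex.Gamma (2 - α) * (∫ ξ, (‖ξ‖ : ℂ) ^ (2 * α - 2) * g ξ) -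
        Complex.Gamma α * h 0) := by
  have e0 : h 0 = ∫ ξ, g ξ := by rw [hh]; simp [expK_zero]
  have e1 : Complex.Gamma (2 - α) * (∫ ξ, (‖ξ‖ : ℂ) ^ (2 * α - 2) * g ξ) -
      Complex.Gamma α * ∫ ξ, g ξ = ∫ ξ, (Complex.Gamma (2 - α) * ((‖ξ‖ : ℂ) ^ (2 * α - 2) * g ξ) -
        Complex.Gamma α * g ξ) := by
    rw [integral_sub ((integrable_cpow_mul_of_gaussWeight h0 h2 hg hw).const_mul _)
      (hg.const_mul _), integral_const_mul, integral_const_mul]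
  rw [gamma_mul_integral_evenSub h0 h2 hg hg2 hw hh hm hi, e0, mul_left_comm, e1,
    ← integral_const_mul]
  congr 1
  refine integral_congr_ae ?_
  filter_upwards [ae_ne_zero] with ξ hξ
  have hp : 0 < ‖ξ‖ := norm_pos_iff.2 hξ
  rw [mul_left_comm, one_sub_mul_integral_cpow_mul_subExp h0 h2 (pow_pos hp 2), sq_cpow hp,
    show 2 * (α - 1) = 2 * α - 2 by ring]
  ring

end Kernel

/-- The Fourier transform of the homogeneous distribution `kernelDist j`. -/
theorem kernelDist_eq {j : ℂ} (hj : -1 < j.re ∧ j.re < 0) {g h : ℂ → ℂ} (hg : Integrable g)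
    (hg2 : Integrable fun ξ => ‖ξ‖ ^ 2 * ‖g ξ‖)
    (hw : Integrable fun ξ => gaussWeight (2 * j + 2) ξ * ‖g ξ‖)
    (hh : ∀ u, h u = ∫ ξ, g ξ * expK ξ u) (hm : Measurable h) (hi : Integrable h) :
    kernelDist j h = Complex.Gamma (-2 * j) / Complex.Gamma (2 * j + 2) *
      ∫ ξ, (‖ξ‖ : ℂ) ^ (4 * j + 2) * g ξ := by
  have hre : (2 * j + 2).re = 2 * j.re + 2 := by simp
  have h0 : 0 < (2 * j + 2).re := by rw [hre]; linarith [hj.1]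
  have h2 : (2 * j + 2).re < 2 := by rw [hre]; linarith [hj.2]
  have hB := integrable_cpow_mul_evenSub h0 h2 hg hg2 hh hm hi
  -- Here `α = 2 j + 2`, so `1 - α` is the prefactor `-(2 j + 1)` of the kernel, and the term `-Γ(α)
  -- h 0` cancels the added `h 0`. Nothing is divided by `2 j + 1`, so `j = -1/2` is covered.
  have key := one_sub_mul_gamma_mul_integral_evenSub h0 h2 hg hg2 hw hh hm hi
  rw [show 2 - (2 * j + 2) = -2 * j by ring, show 2 * (2 * j + 2) - 2 = 4 * j + 2 by ring,
    show -2 * (2 * j + 2) = -4 * j - 4 by ring, show 1 - (2 * j + 2) = -(2 * j + 1) by ring] at key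
  rw [show -2 * (2 * j + 2) = -4 * j - 4 by ring] at hB
  have hbm : MeasurableSet (Metric.ball (0 : ℂ) 1) := Metric.isOpen_ball.measurableSet
  have e1 : (1 / 2) * (∫ u in Metric.ball (0 : ℂ) 1,
      (‖u‖ : ℂ) ^ (-4 * j - 4) * (h u + h (-u) - 2 * h 0)) =
      ∫ u in Metric.ball (0 : ℂ) 1, (‖u‖ : ℂ) ^ (-4 * j - 4) * evenSub h u := by
    rw [← integral_const_mul]
    refine setIntegral_congr_fun hbm fun u hu => ?_
    simp only [evenSub, Set.indicator_of_mem hu]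
    ring
  have hio : IntegrableOn (fun u => (‖u‖ : ℂ) ^ (-4 * j - 4) * h u) (Metric.ball (0 : ℂ) 1)ᶜ := by
    refine (hi.norm.integrableOn (s := (Metric.ball (0 : ℂ) 1)ᶜ)).mono'
      (Measurable.aestronglyMeasurable (by fun_prop)) ?_
    refine (ae_restrict_iff' hbm.compl).2 ?_
    filter_upwards [ae_ne_zero] with u hu0 hu
    have hu1 : 1 ≤ ‖u‖ := by simpa using hu
    rw [norm_mul, norm_norm_cpow hu0]
    refine mul_le_of_le_one_left (norm_nonneg _) (Real.rpow_le_one_of_one_le_of_nonpos hu1 ?_)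
    simp
    linarith [hj.1]
  have hsymm : ∫ u in (Metric.ball (0 : ℂ) 1)ᶜ, (‖u‖ : ℂ) ^ (-4 * j - 4) * h (-u) =
      ∫ u in (Metric.ball (0 : ℂ) 1)ᶜ, (‖u‖ : ℂ) ^ (-4 * j - 4) * h u := by
    rw [← integral_indicator hbm.compl, ← integral_indicator hbm.compl, ← integral_neg_eq_self]
    refine integral_congr_ae (ae_of_all _ fun u => ?_)
    simp [Set.indicator]
  have hio' : IntegrableOn (fun u => (‖u‖ : ℂ) ^ (-4 * j - 4) * h (-u)) (Metric.ball (0 : ℂ) 1)ᶜ := by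
    rw [← integrable_indicator_iff hbm.compl] at hio ⊢
    refine hio.comp_neg.congr (ae_of_all _ fun u => ?_)
    simp [Set.indicator]
  have e2 : ∫ u in (Metric.ball (0 : ℂ) 1)ᶜ, (‖u‖ : ℂ) ^ (-4 * j - 4) * h u =
      ∫ u in (Metric.ball (0 : ℂ) 1)ᶜ, (‖u‖ : ℂ) ^ (-4 * j - 4) * evenSub h u := by
    have e3 : ∫ u in (Metric.ball (0 : ℂ) 1)ᶜ, (‖u‖ : ℂ) ^ (-4 * j - 4) * evenSub h u =
        (1 / 2) * ((∫ u in (Metric.ball (0 : ℂ) 1)ᶜ, (‖u‖ : ℂ) ^ (-4 * j - 4) * h u) +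
          ∫ u in (Metric.ball (0 : ℂ) 1)ᶜ, (‖u‖ : ℂ) ^ (-4 * j - 4) * h (-u)) := by
      rw [← integral_add hio hio', ← integral_const_mul]
      refine setIntegral_congr_fun hbm.compl fun u hu => ?_
      simp only [evenSub, Set.indicator_of_notMem hu]
      ring
    rw [e3, hsymm]
    ring
  have hΓ : Complex.Gamma (2 * j + 2) ≠ 0 := Complex.Gamma_ne_zero_of_re_pos h0
  have hπ : (Real.pi : ℂ) ≠ 0 := by exact_mod_cast Real.pi_ne_zero
  rw [kernelDist, e1, e2, integral_add_compl hbm hB]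
  generalize Complex.Gamma (2 * j + 2) = G at key hΓ ⊢
  generalize (∫ u, (‖u‖ : ℂ) ^ (-4 * j - 4) * evenSub h u) = B at key ⊢
  generalize (∫ ξ, (‖ξ‖ : ℂ) ^ (4 * j + 2) * g ξ) = M at key ⊢
  generalize Complex.Gamma (-2 * j) = G' at key ⊢
  rw [div_mul_eq_mul_div, div_mul_eq_mul_div, eq_div_iff hΓ, ← mul_left_inj' hπ, sub_mul, sub_mul,
    div_mul_eq_mul_div, div_mul_cancel₀ _ hπ]
  linear_combination key

universe u

/-! ### Correlation with a Schwartz function has temperate growth -/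

section Correlation

lemma exists_norm_schwartz_le {E F : Type*} [NormedAddCommGroup E] [NormedSpace ℝ E]
    [NormedAddCommGroup F] [NormedSpace ℝ F] (S : 𝓢(E, F)) (M : ℕ) :
    ∃ C, 0 ≤ C ∧ ∀ x, ‖S x‖ ≤ C * ((1 + ‖x‖) ^ M)⁻¹ := by
  have h := fun x => SchwartzMap.one_add_le_sup_seminorm_apply (𝕜 := ℝ) (m := (M, 0)) (k := M)
    (n := 0) le_rfl le_rfl S x
  refine ⟨_, (by positivity : 0 ≤ 2 ^ M * (Finset.Iic (M, 0)).sup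
    (fun m => SchwartzMap.seminorm ℝ m.1 m.2) S), fun x => ?_⟩
  have hx := h x
  rw [norm_iteratedFDeriv_zero] at hx
  rw [← div_eq_mul_inv, le_div_iff₀ (by positivity), mul_comm]
  exact hx

/-- Peetre's inequality: translating the weight costs a polynomial in the translation. -/
lemma inv_one_add_norm_sub_pow_le (w κ : ℂ) (M : ℕ) :
    ((1 + ‖w - κ‖) ^ M)⁻¹ ≤ (1 + ‖κ‖) ^ M * ((1 + ‖w‖) ^ M)⁻¹ := by
  rw [← div_eq_mul_inv, le_div_iff₀ (by positivity), inv_mul_le_iff₀ (by positivity), ← mul_pow]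
  refine pow_le_pow_left₀ (by positivity) ?_ M
  have : ‖w‖ ≤ ‖w - κ‖ + ‖κ‖ := by simpa using norm_add_le (w - κ) κ
  nlinarith [norm_nonneg κ, norm_nonneg (w - κ)]

variable {F : Type*} [NormedAddCommGroup F] [NormedSpace ℝ F] [NormedSpace ℂ F]

/-- The correlation of a function `A` of moderate growth with a Schwartz function. -/
def corr (A : ℂ → ℂ) (S : 𝓢(ℂ, F)) (κ : ℂ) : F := ∫ w, A w • S (w - κ)

variable {A : ℂ → ℂ} {M : ℕ}

lemma norm_smul_schwartz_sub_le {S : 𝓢(ℂ, F)} {C : ℝ} (hC : 0 ≤ C)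
    (hS : ∀ x, ‖S x‖ ≤ C * ((1 + ‖x‖) ^ M)⁻¹) (w κ : ℂ) :
    ‖A w • S (w - κ)‖ ≤ C * (1 + ‖κ‖) ^ M * (‖A w‖ * ((1 + ‖w‖) ^ M)⁻¹) := by
  rw [norm_smul]
  calc ‖A w‖ * ‖S (w - κ)‖ ≤ ‖A w‖ * (C * ((1 + ‖κ‖) ^ M * ((1 + ‖w‖) ^ M)⁻¹)) := by
        gcongr
        refine (hS _).trans ?_
        gcongr
        exact inv_one_add_norm_sub_pow_le w κ M
    _ = _ := by ring

lemma aestronglyMeasurable_smul_schwartz_sub (hm : Measurable A) (S : 𝓢(ℂ, F)) (κ : ℂ) :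
    AEStronglyMeasurable fun w => A w • S (w - κ) :=
  hm.aestronglyMeasurable.smul (S.continuous.comp (by fun_prop)).aestronglyMeasurable

lemma integrable_smul_schwartz_sub (hm : Measurable A)
    (hA : Integrable fun w => ‖A w‖ * ((1 + ‖w‖) ^ M)⁻¹) (S : 𝓢(ℂ, F)) (κ : ℂ) :
    Integrable fun w => A w • S (w - κ) := by
  obtain ⟨C, hC, hS⟩ := exists_norm_schwartz_le S M
  exact (hA.const_mul (C * (1 + ‖κ‖) ^ M)).mono' (aestronglyMeasurable_smul_schwartz_sub hm S κ)
    (ae_of_all _ fun w => norm_smul_schwartz_sub_le hC hS w κ)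

lemma exists_norm_corr_le (hA : Integrable fun w => ‖A w‖ * ((1 + ‖w‖) ^ M)⁻¹) (S : 𝓢(ℂ, F)) :
    ∃ C, ∀ κ, ‖corr A S κ‖ ≤ C * (1 + ‖κ‖) ^ M := by
  obtain ⟨C, hC, hS⟩ := exists_norm_schwartz_le S M
  refine ⟨C * ∫ w, ‖A w‖ * ((1 + ‖w‖) ^ M)⁻¹, fun κ => ?_⟩
  refine (norm_integral_le_of_norm_le (hA.const_mul (C * (1 + ‖κ‖) ^ M))
    (ae_of_all _ fun w => norm_smul_schwartz_sub_le hC hS w κ)).trans (le_of_eq ?_)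
  rw [integral_const_mul]
  ring

lemma hasFDerivAt_corr [SMulCommClass ℝ ℂ F] (hm : Measurable A)
    (hA : Integrable fun w => ‖A w‖ * ((1 + ‖w‖) ^ M)⁻¹) (S : 𝓢(ℂ, F)) (κ : ℂ) :
    HasFDerivAt (corr A S) (corr A (-SchwartzMap.fderivCLM ℝ ℂ F S) κ) κ := by
  obtain ⟨C, hC, hS⟩ := exists_norm_schwartz_le (-SchwartzMap.fderivCLM ℝ ℂ F S) M
  refine hasFDerivAt_integral_of_dominated_of_fderiv_le
    -- The constant `2 + ‖κ‖` bounds `1 + ‖κ'‖` on the unit ball around `κ`.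
    (bound := fun w => C * (2 + ‖κ‖) ^ M * (‖A w‖ * ((1 + ‖w‖) ^ M)⁻¹))
    (F' := fun κ w => A w • (-SchwartzMap.fderivCLM ℝ ℂ F S) (w - κ))
    (Metric.ball_mem_nhds κ one_pos)
    (Eventually.of_forall fun κ => aestronglyMeasurable_smul_schwartz_sub hm S κ)
    (integrable_smul_schwartz_sub hm hA S κ)
    (aestronglyMeasurable_smul_schwartz_sub hm _ κ) (ae_of_all _ fun w κ' hκ' => ?_)
    (hA.const_mul _) (ae_of_all _ fun w κ' _ => ?_)
  · refine (norm_smul_schwartz_sub_le hC hS w κ').trans ?_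
    have h1 : ‖κ'‖ ≤ 1 + ‖κ‖ := by
      have h2 : ‖κ' - κ‖ < 1 := by simpa [dist_eq_norm] using hκ'
      have h3 : ‖κ'‖ ≤ ‖κ' - κ‖ + ‖κ‖ := by simpa using norm_add_le (κ' - κ) κ
      linarith
    exact mul_le_mul_of_nonneg_right (mul_le_mul_of_nonneg_left
      (pow_le_pow_left₀ (by positivity) (by linarith) M) hC) (by positivity)
  · have h1 : HasFDerivAt (fun κ : ℂ => w - κ) (-ContinuousLinearMap.id ℝ ℂ) κ' := by
      simpa using (hasFDerivAt_id κ').const_sub w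
    have h2 := (S.differentiableAt (x := w - κ')).hasFDerivAt.comp κ' h1
    have h3 := h2.const_smul (A w)
    have e : A w • (-SchwartzMap.fderivCLM ℝ ℂ F S) (w - κ') =
        A w • fderiv ℝ S (w - κ') ∘SL (-ContinuousLinearMap.id ℝ ℂ) := by
      rw [_root_.neg_apply, SchwartzMap.fderivCLM_apply]
      exact ContinuousLinearMap.ext fun v => by simp
    rw [e]
    exact h3

/-- A derivative of `corr A S` is a correlation with minus the derivative of `S`. That function has
values in another space, so the induction quantifies over the target space. -/
lemma contDiff_corr_and_norm_iteratedFDeriv_le (hm : Measurable A)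
    (hA : Integrable fun w => ‖A w‖ * ((1 + ‖w‖) ^ M)⁻¹) (n : ℕ) :
    ∀ {F : Type u} [NormedAddCommGroup F] [NormedSpace ℝ F] [NormedSpace ℂ F] [SMulCommClass ℝ ℂ F]
      (S : 𝓢(ℂ, F)), ContDiff ℝ n (corr A S) ∧
        ∃ C, ∀ κ, ‖iteratedFDeriv ℝ n (corr A S) κ‖ ≤ C * (1 + ‖κ‖) ^ M := by
  induction n with
  | zero =>
    intro F _ _ _ _ S
    refine ⟨contDiff_zero.2 (continuous_iff_continuousAt.2 fun κ =>
      (hasFDerivAt_corr hm hA S κ).continuousAt), ?_⟩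
    simpa using exists_norm_corr_le hA S
  | succ n ih =>
    intro F _ _ _ _ S
    have hf : fderiv ℝ (corr A S) = corr A (-SchwartzMap.fderivCLM ℝ ℂ F S) :=
      funext fun κ => (hasFDerivAt_corr hm hA S κ).fderiv
    obtain ⟨h1, C, h2⟩ := ih (-SchwartzMap.fderivCLM ℝ ℂ F S)
    refine ⟨?_, C, fun κ => ?_⟩
    · push_cast
      refine contDiff_succ_iff_fderiv.2 ⟨fun κ => (hasFDerivAt_corr hm hA S κ).differentiableAt,
        by simp, ?_⟩
      rw [hf]
      exact h1
    · rw [← norm_iteratedFDeriv_fderiv, hf]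
      exact h2 κ

lemma hasTemperateGrowth_corr (hm : Measurable A)
    (hA : Integrable fun w => ‖A w‖ * ((1 + ‖w‖) ^ M)⁻¹) (S : 𝓢(ℂ, ℂ)) :
    (corr A S).HasTemperateGrowth := by
  have h := fun n => contDiff_corr_and_norm_iteratedFDeriv_le hm hA n S
  exact ⟨contDiff_infty.2 fun n => (h n).1, fun n => ⟨M, (h n).2⟩⟩

end Correlation

/-! ### Cut-offs and uniform estimates for mollified powers -/

section Cutoff

variable {η : ℝ → ℝ}

/-- The norm is not smooth at the origin, but `η` is constant there. -/
lemma exists_schwartz_cutoff (hη : ContDiff ℝ ∞ η) (h1 : ∀ t ≤ 1, η t = 1)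
    (h2 : ∀ t ≥ 2, η t = 0) : ∃ χ : 𝓢(ℂ, ℂ), ∀ u, χ u = (η ‖u‖ : ℂ) := by
  have hs : HasCompactSupport fun u : ℂ => (η ‖u‖ : ℂ) := by
    refine HasCompactSupport.intro (isCompact_closedBall 0 2) fun u hu => ?_
    have : 2 < ‖u‖ := by simpa using hu
    simp [h2 _ this.le]
  have hc : ContDiff ℝ ∞ fun u : ℂ => (η ‖u‖ : ℂ) := by
    refine Complex.ofRealCLM.contDiff.comp (contDiff_iff_contDiffAt.2 fun u => ?_)
    by_cases hu : u = 0
    · refine (contDiffAt_const (c := (1 : ℝ))).congr_of_eventuallyEq ?_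
      filter_upwards [Metric.ball_mem_nhds u one_pos] with v hv
      exact h1 _ (by simpa [hu] using (Metric.mem_ball.1 hv).le)
    · exact hη.contDiffAt.comp u (contDiffAt_norm ℝ hu)
  exact ⟨hs.toSchwartzMap hc, fun u => rfl⟩

/-- The function `S(w) = L² G(L w)`. -/
lemma exists_schwartz_dilation (G : 𝓢(ℂ, ℂ)) {L : ℝ} (hL : 0 < L) :
    ∃ S : 𝓢(ℂ, ℂ), ∀ w, S w = (L : ℂ) ^ 2 * G (L • w) := by
  refine ⟨(L : ℂ) ^ 2 • SchwartzMap.compCLMOfContinuousLinearEquiv ℂ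
    (ContinuousLinearEquiv.smulLeft (Units.mk0 L hL.ne')) G, fun w => ?_⟩
  rfl

lemma integral_dilation {G S : ℂ → ℂ} {L : ℝ} (hL : 0 < L)
    (hS : ∀ w, S w = (L : ℂ) ^ 2 * G (L • w)) (A : ℂ → ℂ) (κ : ℂ) :
    ∫ w, A w * S (w - κ) = ∫ ξ, A (κ + L⁻¹ • ξ) * G ξ := by
  have h := Measure.integral_comp_inv_smul (volume : Measure ℂ)
    (fun w => A (κ + w) * G (L • w)) L
  rw [Complex.finrank_real_complex, abs_of_pos (by positivity)] at h
  rw [← integral_add_left_eq_self _ κ]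
  simp only [smul_inv_smul₀ hL.ne'] at h
  rw [h, ← integral_smul]
  refine integral_congr_ae (ae_of_all _ fun w => ?_)
  simp only [add_sub_cancel_left, hS, Complex.real_smul]
  push_cast
  ring

end Cutoff

section Mollification

lemma add_rpow_le_four_mul {a b q : ℝ} (ha : 0 ≤ a) (hb : 0 ≤ b) (hq : 0 ≤ q) (hq2 : q ≤ 2) :
    (a + b) ^ q ≤ 4 * (a ^ q + b ^ q) := by
  have h2 : (2 : ℝ) ^ q ≤ 4 := by
    have := Real.rpow_le_rpow_of_exponent_le (show (1 : ℝ) ≤ 2 by norm_num) hq2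
    norm_num at this ⊢
    exact this
  have ha' : 0 ≤ a ^ q := by positivity
  have hb' : 0 ≤ b ^ q := by positivity
  rcases le_total a b with h | h
  · calc (a + b) ^ q ≤ (2 * b) ^ q := by gcongr; linarith
      _ = 2 ^ q * b ^ q := Real.mul_rpow (by norm_num) hb
      _ ≤ 4 * b ^ q := by gcongr
      _ ≤ _ := by linarith
  · calc (a + b) ^ q ≤ (2 * a) ^ q := by gcongr; linarith
      _ = 2 ^ q * a ^ q := Real.mul_rpow (by norm_num) ha
      _ ≤ 4 * a ^ q := by gcongr
      _ ≤ _ := by linarith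

lemma rpow_le_one_add_sq {a q : ℝ} (ha : 0 ≤ a) (hq : 0 ≤ q) (hq2 : q ≤ 2) :
    a ^ q ≤ (1 + a) ^ 2 := by
  calc a ^ q ≤ (1 + a) ^ q := by gcongr; linarith
    _ ≤ (1 + a) ^ (2 : ℝ) := Real.rpow_le_rpow_of_exponent_le (by linarith) hq2
    _ = _ := Real.rpow_two _

variable {p : ℝ}

/-- For `p < 0`, the power `‖κ‖ ^ (-p)` is split between `κ + L⁻¹ • ξ` and `L⁻¹ • ξ`; the ratio of
the latter two moduli equals that of `L • κ + ξ` and `ξ`. So `L` survives only as a translation. -/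
lemma norm_add_smul_rpow_le (hp : -2 < p) (hp2 : p < 2) {L : ℝ} (hL : 1 ≤ L) {κ ξ : ℂ}
    (hκ : κ ≠ 0) (hξ : L • κ + ξ ≠ 0) :
    ‖κ + L⁻¹ • ξ‖ ^ p ≤
      4 * (1 + ‖κ‖ ^ p) * ((1 + ‖ξ‖) ^ 2 * (1 + ‖L • κ + ξ‖ ^ (-|p|))) := by
  have hL0 : 0 < L := by linarith
  have hκ' : 0 < ‖κ‖ := norm_pos_iff.2 hκ
  have hv : 0 < ‖L • κ + ξ‖ := norm_pos_iff.2 hξ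
  have e1 : κ + L⁻¹ • ξ = L⁻¹ • (L • κ + ξ) := by
    rw [smul_add, inv_smul_smul₀ hL0.ne']
  have e2 : ‖κ + L⁻¹ • ξ‖ = L⁻¹ * ‖L • κ + ξ‖ := by
    rw [e1, norm_smul, Real.norm_of_nonneg (by positivity)]
  have e3 : ‖L⁻¹ • ξ‖ = L⁻¹ * ‖ξ‖ := by rw [norm_smul, Real.norm_of_nonneg (by positivity)]
  have hκp : 0 < ‖κ‖ ^ p := by positivity
  have hξ1 : 1 ≤ (1 + ‖ξ‖) ^ 2 := one_le_pow₀ (by linarith [norm_nonneg ξ])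
  have hr : 0 < ‖L • κ + ξ‖ ^ (-|p|) := by positivity
  rcases le_or_gt 0 p with h0 | h0
  · have h1 : ‖κ + L⁻¹ • ξ‖ ^ p ≤ 4 * (‖κ‖ ^ p + (1 + ‖ξ‖) ^ 2) := by
      calc _ ≤ (‖κ‖ + ‖ξ‖) ^ p := by
            gcongr
            refine (norm_add_le _ _).trans ?_
            rw [e3]
            gcongr
            exact mul_le_of_le_one_left (norm_nonneg _) (inv_le_one_of_one_le₀ hL)
        _ ≤ 4 * (‖κ‖ ^ p + ‖ξ‖ ^ p) := add_rpow_le_four_mul hκ'.le (norm_nonneg _) h0 hp2.le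
        _ ≤ _ := by gcongr; exact rpow_le_one_add_sq (norm_nonneg _) h0 hp2.le
    refine h1.trans ?_
    have h3 : ‖κ‖ ^ p + (1 + ‖ξ‖) ^ 2 ≤ (1 + ‖κ‖ ^ p) * (1 + ‖ξ‖) ^ 2 := by nlinarith
    calc 4 * (‖κ‖ ^ p + (1 + ‖ξ‖) ^ 2) ≤ 4 * ((1 + ‖κ‖ ^ p) * ((1 + ‖ξ‖) ^ 2 * 1)) := by
          rw [mul_one]; gcongr
      _ ≤ 4 * ((1 + ‖κ‖ ^ p) * ((1 + ‖ξ‖) ^ 2 * (1 + ‖L • κ + ξ‖ ^ (-|p|)))) := by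
          gcongr; linarith
      _ = _ := by ring
  · have hq0 : 0 ≤ -p := by linarith
    have hq2 : -p ≤ 2 := by linarith
    rw [abs_of_neg h0, neg_neg] at hr ⊢
    have hw : 0 < ‖κ + L⁻¹ • ξ‖ := by rw [e2]; positivity
    have h1 : ‖κ‖ ^ (-p) ≤ 4 * (‖κ + L⁻¹ • ξ‖ ^ (-p) + ‖L⁻¹ • ξ‖ ^ (-p)) := by
      refine le_trans ?_ (add_rpow_le_four_mul (norm_nonneg _) (norm_nonneg _) hq0 hq2)
      gcongr
      simpa using norm_sub_le (κ + L⁻¹ • ξ) (L⁻¹ • ξ)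
    have h2 : ‖L⁻¹ • ξ‖ ^ (-p) * ‖κ + L⁻¹ • ξ‖ ^ p = ‖ξ‖ ^ (-p) * ‖L • κ + ξ‖ ^ p := by
      rw [e2, e3, Real.mul_rpow (by positivity) (norm_nonneg _),
        Real.mul_rpow (by positivity) (norm_nonneg _), Real.rpow_neg (by positivity : 0 ≤ L⁻¹)]
      field_simp
    have h3 : ‖κ + L⁻¹ • ξ‖ ^ (-p) * ‖κ + L⁻¹ • ξ‖ ^ p = 1 := by
      rw [← Real.rpow_add hw]; simp
    have h4 : ‖κ‖ ^ p * ‖κ‖ ^ (-p) = 1 := by rw [← Real.rpow_add hκ']; simp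
    have h5 := rpow_le_one_add_sq (norm_nonneg ξ) hq0 hq2
    calc ‖κ + L⁻¹ • ξ‖ ^ p = ‖κ‖ ^ p * ‖κ + L⁻¹ • ξ‖ ^ p * ‖κ‖ ^ (-p) := by
          linear_combination (-‖κ + L⁻¹ • ξ‖ ^ p) * h4
      _ ≤ ‖κ‖ ^ p * ‖κ + L⁻¹ • ξ‖ ^ p * (4 * (‖κ + L⁻¹ • ξ‖ ^ (-p) + ‖L⁻¹ • ξ‖ ^ (-p))) := by
          gcongr
      _ = 4 * ‖κ‖ ^ p * (1 + ‖ξ‖ ^ (-p) * ‖L • κ + ξ‖ ^ p) := by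
          linear_combination (4 * ‖κ‖ ^ p) * (h3 + h2)
      _ ≤ 4 * ‖κ‖ ^ p * ((1 + ‖ξ‖) ^ 2 * 1 + (1 + ‖ξ‖) ^ 2 * ‖L • κ + ξ‖ ^ p) := by
          rw [mul_one]; gcongr
      _ = 4 * ‖κ‖ ^ p * ((1 + ‖ξ‖) ^ 2 * (1 + ‖L • κ + ξ‖ ^ p)) := by ring
      _ ≤ _ := by gcongr; linarith

/-- Separates a bounded part from an integrable one; `16 = 2 ^ 4` offsets the weight on the unit
disc. -/
lemma rpow_neg_norm_le (hp : 0 ≤ p) {w : ℂ} (hw : w ≠ 0) :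
    ‖w‖ ^ (-p) ≤ 1 + 16 * (‖w‖ ^ (-p) * ((1 + ‖w‖) ^ 4)⁻¹) := by
  have hw' : 0 < ‖w‖ := norm_pos_iff.2 hw
  have h0 : 0 < ‖w‖ ^ (-p) := by positivity
  rcases le_total ‖w‖ 1 with h | h
  · have h2 : 1 ≤ 16 * ((1 + ‖w‖) ^ 4)⁻¹ := by
      rw [← div_eq_mul_inv, one_le_div (by positivity)]
      calc (1 + ‖w‖) ^ 4 ≤ 2 ^ 4 := pow_le_pow_left₀ (by positivity) (by linarith) 4
        _ = 16 := by norm_num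
    nlinarith
  · have h1 : ‖w‖ ^ (-p) ≤ 1 := Real.rpow_le_one_of_one_le_of_nonpos h (by linarith)
    have : 0 ≤ 16 * (‖w‖ ^ (-p) * ((1 + ‖w‖) ^ 4)⁻¹) := by positivity
    linarith

lemma ae_add_ne_zero (v : ℂ) : ∀ᵐ ξ : ℂ, v + ξ ≠ 0 := by
  refine ae_iff.2 (measure_mono_null (t := {-v}) (fun ξ hξ => ?_) (measure_singleton _))
  rw [Set.mem_ofPred_eq, not_not, add_comm] at hξ
  exact eq_neg_of_add_eq_zero_left hξ

/-- The constant does not depend on `L` because the singular part is a translate of a fixed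
integrable function. The extra factor `1 + ‖ξ‖` is a moment kept for the tail estimate in
`tendsto_integral_cpow_add_smul`. -/
lemma exists_integral_norm_add_smul_rpow_le (hp : -2 < p) (hp2 : p < 2) (G : 𝓢(ℂ, ℂ)) :
    ∃ C, ∀ L : ℝ, 1 ≤ L → ∀ κ : ℂ, κ ≠ 0 →
      Integrable (fun ξ => ‖κ + L⁻¹ • ξ‖ ^ p * ((1 + ‖ξ‖) * ‖G ξ‖)) ∧
      ∫ ξ, ‖κ + L⁻¹ • ξ‖ ^ p * ((1 + ‖ξ‖) * ‖G ξ‖) ≤ C * (1 + ‖κ‖ ^ p) := by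
  obtain ⟨C, hC, hG⟩ := exists_norm_schwartz_le G 6
  have hpa : |p| < 2 := abs_lt.2 ⟨hp, hp2⟩
  have i1 : Integrable fun ξ : ℂ => ((1 + ‖ξ‖) ^ 3)⁻¹ := by
    simpa using integrable_norm_rpow_neg_mul (q := 0) (M := 3) (by norm_num) (by norm_num)
  have i2 := integrable_norm_rpow_neg_mul (q := |p|) (M := 4) hpa
    (by push_cast; linarith [abs_nonneg p])
  set I1 := ∫ ξ : ℂ, ((1 + ‖ξ‖) ^ 3)⁻¹
  set I2 := ∫ w : ℂ, ‖w‖ ^ (-|p|) * ((1 + ‖w‖) ^ 4)⁻¹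
  refine ⟨4 * C * (2 * I1 + 16 * I2), fun L hL κ hκ => ?_⟩
  have hb : Integrable fun ξ : ℂ => 4 * (1 + ‖κ‖ ^ p) * C * (2 * ((1 + ‖ξ‖) ^ 3)⁻¹ +
      16 * (‖L • κ + ξ‖ ^ (-|p|) * ((1 + ‖L • κ + ξ‖) ^ 4)⁻¹)) :=
    ((i1.const_mul 2).add ((i2.comp_add_left (L • κ)).const_mul 16)).const_mul _
  have hle : ∀ᵐ ξ : ℂ, ‖κ + L⁻¹ • ξ‖ ^ p * ((1 + ‖ξ‖) * ‖G ξ‖) ≤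
      4 * (1 + ‖κ‖ ^ p) * C * (2 * ((1 + ‖ξ‖) ^ 3)⁻¹ +
        16 * (‖L • κ + ξ‖ ^ (-|p|) * ((1 + ‖L • κ + ξ‖) ^ 4)⁻¹)) := by
    filter_upwards [ae_add_ne_zero (L • κ)] with ξ hξ
    have h1 := norm_add_smul_rpow_le hp hp2 hL hκ hξ
    have h2 := rpow_neg_norm_le (abs_nonneg p) hξ
    have h3 : (1 + ‖ξ‖) ^ 2 * ((1 + ‖ξ‖) * ‖G ξ‖) ≤ C * ((1 + ‖ξ‖) ^ 3)⁻¹ := by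
      calc (1 + ‖ξ‖) ^ 2 * ((1 + ‖ξ‖) * ‖G ξ‖)
          ≤ (1 + ‖ξ‖) ^ 2 * ((1 + ‖ξ‖) * (C * ((1 + ‖ξ‖) ^ 6)⁻¹)) := by gcongr; exact hG ξ
        _ = _ := by field_simp
    have h4 : ((1 + ‖ξ‖) ^ 3)⁻¹ ≤ 1 :=
      inv_le_one_of_one_le₀ (one_le_pow₀ (by linarith [norm_nonneg ξ]))
    have h5 : 0 ≤ 16 * (‖L • κ + ξ‖ ^ (-|p|) * ((1 + ‖L • κ + ξ‖) ^ 4)⁻¹) := by positivity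
    have h6 : 0 ≤ ((1 + ‖ξ‖) ^ 3)⁻¹ := by positivity
    calc _ ≤ 4 * (1 + ‖κ‖ ^ p) * ((1 + ‖ξ‖) ^ 2 * (1 + ‖L • κ + ξ‖ ^ (-|p|))) *
          ((1 + ‖ξ‖) * ‖G ξ‖) := by gcongr
      _ = 4 * (1 + ‖κ‖ ^ p) * ((1 + ‖ξ‖) ^ 2 * ((1 + ‖ξ‖) * ‖G ξ‖)) *
          (1 + ‖L • κ + ξ‖ ^ (-|p|)) := by ring
      _ ≤ 4 * (1 + ‖κ‖ ^ p) * (C * ((1 + ‖ξ‖) ^ 3)⁻¹) *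
          (1 + (1 + 16 * (‖L • κ + ξ‖ ^ (-|p|) * ((1 + ‖L • κ + ξ‖) ^ 4)⁻¹))) := by gcongr
      _ = 4 * (1 + ‖κ‖ ^ p) * C * (2 * ((1 + ‖ξ‖) ^ 3)⁻¹ + ((1 + ‖ξ‖) ^ 3)⁻¹ *
          (16 * (‖L • κ + ξ‖ ^ (-|p|) * ((1 + ‖L • κ + ξ‖) ^ 4)⁻¹))) := by ring
      _ ≤ _ := by
          refine mul_le_mul_of_nonneg_left (add_le_add le_rfl ?_) (by positivity)
          exact mul_le_of_le_one_left h5 h4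
  have hi : Integrable fun ξ => ‖κ + L⁻¹ • ξ‖ ^ p * ((1 + ‖ξ‖) * ‖G ξ‖) := by
    refine hb.mono' ?_ ?_
    · have := G.continuous.measurable
      exact Measurable.aestronglyMeasurable (by fun_prop)
    · filter_upwards [hle] with ξ hξ
      rwa [Real.norm_of_nonneg (by positivity)]
  refine ⟨hi, (integral_mono_ae hi hb hle).trans (le_of_eq ?_)⟩
  rw [integral_const_mul, integral_add (i1.const_mul 2) ((i2.comp_add_left (L • κ)).const_mul 16),
    integral_const_mul, integral_const_mul,
    integral_add_left_eq_self (fun w : ℂ => ‖w‖ ^ (-|p|) * ((1 + ‖w‖) ^ 4)⁻¹)]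
  ring

variable {s : ℂ}

lemma ae_add_smul_ne_zero {L : ℝ} (hL : 0 < L) (κ : ℂ) : ∀ᵐ ξ : ℂ, κ + L⁻¹ • ξ ≠ 0 := by
  filter_upwards [ae_add_ne_zero (L • κ)] with ξ hξ
  rw [show κ + L⁻¹ • ξ = L⁻¹ • (L • κ + ξ) by rw [smul_add, inv_smul_smul₀ hL.ne']]
  exact smul_ne_zero (inv_ne_zero hL.ne') hξ

/-- The singularity at `ξ = -L κ` moves with `L`. On `‖ξ‖ < L ‖κ‖ / 2` it is avoided and dominated
convergence applies; outside, the moment bound of `exists_integral_norm_add_smul_rpow_le` yields a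
factor `1 / L`. -/
lemma tendsto_integral_cpow_add_smul (hs : -2 < s.re) (hs2 : s.re < 2) (G : 𝓢(ℂ, ℂ)) {κ : ℂ}
    (hκ : κ ≠ 0) : Tendsto (fun L : ℝ => ∫ ξ, (‖κ + L⁻¹ • ξ‖ : ℂ) ^ s * G ξ) atTop
      (𝓝 (∫ ξ, (‖κ‖ : ℂ) ^ s * G ξ)) := by
  obtain ⟨C, hC⟩ := exists_integral_norm_add_smul_rpow_le hs hs2 G
  have hGm := G.continuous.measurable
  have hκ' : 0 < ‖κ‖ := norm_pos_iff.2 hκ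
  have hm : ∀ L : ℝ, Measurable fun ξ : ℂ => (‖κ + L⁻¹ • ξ‖ : ℂ) ^ s * G ξ := fun L => by fun_prop
  have hn : ∀ L : ℝ, 1 ≤ L → ∀ᵐ ξ : ℂ, ‖(‖κ + L⁻¹ • ξ‖ : ℂ) ^ s * G ξ‖ =
      ‖κ + L⁻¹ • ξ‖ ^ s.re * ‖G ξ‖ := fun L hL => by
    filter_upwards [ae_add_smul_ne_zero (by linarith : 0 < L) κ] with ξ hξ
    rw [norm_mul, norm_norm_cpow hξ]
  have hi : ∀ L : ℝ, 1 ≤ L → Integrable fun ξ : ℂ => (‖κ + L⁻¹ • ξ‖ : ℂ) ^ s * G ξ :=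
    fun L hL => by
    refine (hC L hL κ hκ).1.mono' (hm L).aestronglyMeasurable ?_
    filter_upwards [hn L hL] with ξ hξ
    rw [hξ]
    gcongr
    exact le_mul_of_one_le_left (norm_nonneg _) (by linarith [norm_nonneg ξ])
  set U : ℝ → Set ℂ := fun L => Metric.ball 0 (L * (‖κ‖ / 2)) with hU
  have hUm : ∀ L, MeasurableSet (U L) := fun L => Metric.isOpen_ball.measurableSet
  have t1 : Tendsto (fun L : ℝ => ∫ ξ, (U L).indicator
      (fun ξ => (‖κ + L⁻¹ • ξ‖ : ℂ) ^ s * G ξ) ξ) atTop (𝓝 (∫ ξ, (‖κ‖ : ℂ) ^ s * G ξ)) := by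
    refine tendsto_integral_filter_of_dominated_convergence
      (fun ξ => ((‖κ‖ / 2) ^ s.re + (2 * ‖κ‖) ^ s.re) * ‖G ξ‖)
      (Eventually.of_forall fun L => ((hm L).indicator (hUm L)).aestronglyMeasurable) ?_
      (G.integrable.norm.const_mul _) (ae_of_all _ fun ξ => ?_)
    · filter_upwards [eventually_ge_atTop 1] with L hL
      filter_upwards [hn L hL] with ξ hξ
      by_cases h : ξ ∈ U L
      · rw [Set.indicator_of_mem h, hξ]
        gcongr
        have hL0 : 0 < L := by linarith
        have h1 : ‖L⁻¹ • ξ‖ < ‖κ‖ / 2 := by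
          rw [norm_smul, Real.norm_of_nonneg (by positivity), inv_mul_lt_iff₀ hL0]
          simpa [hU] using h
        have h2 : ‖κ‖ / 2 ≤ ‖κ + L⁻¹ • ξ‖ := by
          have := norm_sub_le (κ + L⁻¹ • ξ) (L⁻¹ • ξ)
          rw [add_sub_cancel_right] at this
          linarith
        have h3 : ‖κ + L⁻¹ • ξ‖ ≤ 2 * ‖κ‖ := by
          have := norm_add_le κ (L⁻¹ • ξ)
          linarith
        have h4 : 0 < (‖κ‖ / 2) ^ s.re := by positivity
        have h5 : 0 < (2 * ‖κ‖) ^ s.re := by positivity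
        rcases le_total 0 s.re with h0 | h0
        · have := Real.rpow_le_rpow (norm_nonneg _) h3 h0
          linarith
        · have := Real.rpow_le_rpow_of_nonpos (by positivity) h2 h0
          linarith
      · rw [Set.indicator_of_notMem h, norm_zero]
        positivity
    · have h1 : Tendsto (fun L : ℝ => κ + L⁻¹ • ξ) atTop (𝓝 κ) := by
        have := ((tendsto_inv_atTop_zero (𝕜 := ℝ)).smul_const ξ).const_add κ
        simpa using this
      have h2 : Tendsto (fun L : ℝ => (‖κ + L⁻¹ • ξ‖ : ℂ) ^ s * G ξ) atTop
          (𝓝 ((‖κ‖ : ℂ) ^ s * G ξ)) := by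
        refine Tendsto.mul_const _ ?_
        exact (Complex.continuousAt_ofReal_cpow_const _ _ (Or.inr hκ'.ne')).tendsto.comp h1.norm
      refine h2.congr' ?_
      have h3 : Tendsto (fun L : ℝ => L * (‖κ‖ / 2)) atTop atTop :=
        tendsto_id.atTop_mul_const (by positivity)
      filter_upwards [h3.eventually_gt_atTop ‖ξ‖] with L hL
      rw [Set.indicator_of_mem (by simpa [hU] using hL)]
  have t2 : Tendsto (fun L : ℝ => ∫ ξ, (U L)ᶜ.indicator
      (fun ξ => (‖κ + L⁻¹ • ξ‖ : ℂ) ^ s * G ξ) ξ) atTop (𝓝 0) := by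
    have h1 : Tendsto (fun L : ℝ => L⁻¹ * (2 / ‖κ‖ * (C * (1 + ‖κ‖ ^ s.re)))) atTop (𝓝 0) := by
      simpa using (tendsto_inv_atTop_zero (𝕜 := ℝ)).mul_const _
    refine squeeze_zero_norm' ?_ h1
    filter_upwards [eventually_ge_atTop 1] with L hL
    have hL0 : 0 < L := by linarith
    obtain ⟨hi1, hi2⟩ := hC L hL κ hκ
    refine (norm_integral_le_of_norm_le (hi1.const_mul (L⁻¹ * (2 / ‖κ‖))) ?_).trans ?_
    · filter_upwards [hn L hL] with ξ hξ
      by_cases h : ξ ∈ (U L)ᶜ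
      · rw [Set.indicator_of_mem h, hξ]
        have h2 : L * (‖κ‖ / 2) ≤ ‖ξ‖ := by simpa [hU] using h
        have h3 : 1 ≤ L⁻¹ * (2 / ‖κ‖) * (1 + ‖ξ‖) := by
          calc (1 : ℝ) = L⁻¹ * (2 / ‖κ‖) * (L * (‖κ‖ / 2)) := by field_simp
            _ ≤ _ := by gcongr; linarith
        calc ‖κ + L⁻¹ • ξ‖ ^ s.re * ‖G ξ‖
            ≤ L⁻¹ * (2 / ‖κ‖) * (1 + ‖ξ‖) * (‖κ + L⁻¹ • ξ‖ ^ s.re * ‖G ξ‖) :=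
              le_mul_of_one_le_left (by positivity) h3
          _ = _ := by ring
      · rw [Set.indicator_of_notMem h, norm_zero]
        positivity
    · rw [integral_const_mul, mul_assoc]
      gcongr
  have t3 := t1.add t2
  rw [add_zero] at t3
  refine t3.congr' ?_
  filter_upwards [eventually_ge_atTop 1] with L hL
  rw [integral_indicator (hUm L), integral_indicator (hUm L).compl,
    integral_add_compl (hUm L) (hi L hL)]

lemma exists_norm_integral_cpow_add_smul_le (hs : -2 < s.re) (hs2 : s.re < 2) (G : 𝓢(ℂ, ℂ)) :
    ∃ C, ∀ L : ℝ, 1 ≤ L → ∀ κ : ℂ, κ ≠ 0 →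
      ‖∫ ξ, (‖κ + L⁻¹ • ξ‖ : ℂ) ^ s * G ξ‖ ≤ C * (1 + ‖κ‖ ^ s.re) := by
  obtain ⟨C, hC⟩ := exists_integral_norm_add_smul_rpow_le hs hs2 G
  refine ⟨C, fun L hL κ hκ => ?_⟩
  obtain ⟨hi1, hi2⟩ := hC L hL κ hκ
  refine (norm_integral_le_of_norm_le hi1 ?_).trans hi2
  filter_upwards [ae_add_smul_ne_zero (by linarith : 0 < L) κ] with ξ hξ
  rw [norm_mul, norm_norm_cpow hξ]
  gcongr
  exact le_mul_of_one_le_left (norm_nonneg _) (by linarith [norm_nonneg ξ])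

end Mollification

/-! ### The cut-off kernel as a Fourier multiplier -/

section Weights

lemma integrable_norm_mul_inv_of_ae_eq {W : ℂ → ℂ} {p : ℝ} (hp : -2 < p) (hp2 : p ≤ 2)
    (hW : ∀ w, w ≠ 0 → ‖W w‖ = ‖w‖ ^ p) : Integrable fun w => ‖W w‖ * ((1 + ‖w‖) ^ 5)⁻¹ := by
  refine (integrable_norm_rpow_neg_mul (q := -p) (M := 5) (by linarith)
    (by push_cast; linarith)).congr ?_
  filter_upwards [ae_ne_zero] with w hw
  rw [hW w hw, neg_neg]

lemma integrable_cpow_weight {s : ℂ} (hs : -2 < s.re) (hs2 : s.re < 2) :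
    Integrable fun w : ℂ => ‖(‖w‖ : ℂ) ^ s‖ * ((1 + ‖w‖) ^ 5)⁻¹ :=
  integrable_norm_mul_inv_of_ae_eq hs hs2.le fun _ hw => norm_norm_cpow hw s

lemma integrable_sq_weight : Integrable fun w : ℂ => ‖((‖w‖ ^ 2 : ℝ) : ℂ)‖ * ((1 + ‖w‖) ^ 5)⁻¹ :=
  integrable_norm_mul_inv_of_ae_eq (p := 2) (by norm_num) le_rfl fun w _ => by simp

lemma gaussWeight_nonneg (α w : ℂ) : 0 ≤ gaussWeight α w := by
  unfold gaussWeight; positivity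

lemma measurable_gaussWeight (α : ℂ) : Measurable (gaussWeight α) := by
  unfold gaussWeight; fun_prop

lemma integrable_one_weight {W : ℂ → ℂ} (hW : ∀ w, ‖W w‖ = 1) :
    Integrable fun w : ℂ => ‖W w‖ * ((1 + ‖w‖) ^ 5)⁻¹ :=
  integrable_norm_mul_inv_of_ae_eq (p := 0) (by norm_num) (by norm_num) fun w _ => by simp [hW]

lemma integrable_gaussWeight {α : ℂ} (h0 : 0 < α.re) (h2 : α.re < 2) :
    Integrable fun w : ℂ => ‖(gaussWeight α w : ℂ)‖ * ((1 + ‖w‖) ^ 5)⁻¹ := by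
  have h3 := integrable_norm_mul_inv_of_ae_eq (p := α.re - 2)
    (W := fun w => (((‖w‖ ^ 2) ^ (α.re / 2 - 1) : ℝ) : ℂ)) (by linarith) (by linarith)
    fun w hw => by
      have hw' : 0 < ‖w‖ := norm_pos_iff.2 hw
      rw [Complex.norm_real, Real.norm_of_nonneg (by positivity), ← Real.rpow_natCast,
        ← Real.rpow_mul hw'.le]
      congr 1; push_cast; ring
  refine (((integrable_one_weight (W := fun _ => 1) (by simp)).add integrable_sq_weight).add
    h3).congr (ae_of_all _ fun w => ?_)
  have e : ‖(((‖w‖ ^ 2) ^ (α.re / 2 - 1) : ℝ) : ℂ)‖ = (‖w‖ ^ 2) ^ (α.re / 2 - 1) := by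
    rw [Complex.norm_real, Real.norm_of_nonneg (by positivity)]
  simp only [Pi.add_apply, e]
  rw [Complex.norm_real, Complex.norm_real, Real.norm_of_nonneg (gaussWeight_nonneg α w),
    Real.norm_of_nonneg (sq_nonneg ‖w‖), gaussWeight, norm_one]
  ring

end Weights

section CutoffKernel

variable {d : ℕ}

/-- The Fourier kernel for the pairing of `k` and `x`. -/
def expPair (k x : Fin (d + 1) → ℂ) : ℂ := Complex.exp (-2 * Complex.I * ((pair k x).im : ℂ))

lemma norm_expPair (k x : Fin (d + 1) → ℂ) : ‖expPair k x‖ = 1 := by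
  rw [expPair, show -2 * Complex.I * ((pair k x).im : ℂ) = ((-2 * (pair k x).im : ℝ) : ℂ) *
    Complex.I by push_cast; ring, Complex.norm_exp_ofReal_mul_I]

lemma continuous_expPair (x : Fin (d + 1) → ℂ) : Continuous fun k => expPair k x := by
  unfold expPair pair; fun_prop

lemma expPair_add_single (k x : Fin (d + 1) → ℂ) (u : ℂ) :
    expPair k (x + Pi.single 0 u) = expPair k x * expK (k 0) u := by
  have : pair k (x + Pi.single 0 u) = pair k x + k 0 * u := by
    simp only [pair, Pi.add_apply, mul_add, Finset.sum_add_distrib]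
    congr 1
    rw [Finset.sum_eq_single 0 (fun r _ hr => by simp [hr]) (by simp)]
    simp
  rw [expPair, expPair, expK, this, ← Complex.exp_add, Complex.add_im]
  congr 1
  push_cast
  ring

lemma integrable_one_add_norm_pow_mul (γ : 𝓢(Fin (d + 1) → ℂ, ℂ)) :
    Integrable fun k => (1 + ‖k 0‖) ^ 5 * ‖γ k‖ := by
  have h := (γ.integrable.norm (μ := volume)).add (γ.integrable_pow_mul volume 5)
  refine (h.const_mul (2 ^ 4)).mono' (Continuous.aestronglyMeasurable ?_) (ae_of_all _ fun k => ?_)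
  · have := γ.continuous
    fun_prop
  · rw [Real.norm_of_nonneg (by positivity)]
    have h1 : (1 + ‖k 0‖) ^ 5 ≤ 2 ^ 4 * (1 + ‖k‖ ^ 5) := by
      calc (1 + ‖k 0‖) ^ 5 ≤ (1 + ‖k‖) ^ 5 := by gcongr; exact norm_le_pi_norm k 0
        _ ≤ 2 ^ (5 - 1) * (1 ^ 5 + ‖k‖ ^ 5) := add_pow_le zero_le_one (norm_nonneg _) 5
        _ = _ := by norm_num
    calc _ ≤ 2 ^ 4 * (1 + ‖k‖ ^ 5) * ‖γ k‖ := by gcongr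
      _ = 2 ^ 4 * (‖γ k‖ + ‖k‖ ^ 5 * ‖γ k‖) := by ring

variable {W : ℂ → ℂ} (γ : 𝓢(Fin (d + 1) → ℂ, ℂ)) (S χ : 𝓢(ℂ, ℂ)) (x : Fin (d + 1) → ℂ)

lemma integrable_prod_weight (hm : Measurable W)
    (hW : Integrable fun w => ‖W w‖ * ((1 + ‖w‖) ^ 5)⁻¹) :
    Integrable (fun p : ℂ × (Fin (d + 1) → ℂ) => W p.1 * (γ p.2 * expPair p.2 x * S (p.1 - p.2 0)))
      (volume.prod volume) := by
  obtain ⟨C, hC, hS⟩ := exists_norm_schwartz_le S 5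
  refine ((hW.const_mul C).mul_prod (integrable_one_add_norm_pow_mul γ)).mono'
    (Measurable.aestronglyMeasurable ?_) (ae_of_all _ fun p => ?_)
  · have h1 := γ.continuous.measurable
    have h2 := S.continuous.measurable
    have h3 := (continuous_expPair x).measurable
    have h4 : Measurable fun p : ℂ × (Fin (d + 1) → ℂ) => expPair p.2 x := h3.comp measurable_snd
    fun_prop
  · rw [norm_mul, norm_mul, norm_mul, norm_expPair, mul_one]
    calc ‖W p.1‖ * (‖γ p.2‖ * ‖S (p.1 - p.2 0)‖)
        ≤ ‖W p.1‖ * (‖γ p.2‖ * (C * ((1 + ‖p.2 0‖) ^ 5 * ((1 + ‖p.1‖) ^ 5)⁻¹))) := by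
          gcongr
          refine (hS _).trans ?_
          gcongr
          exact inv_one_add_norm_sub_pow_le _ _ 5
      _ = _ := by ring

lemma integrable_weight_mul_integral (hm : Measurable W)
    (hW : Integrable fun w => ‖W w‖ * ((1 + ‖w‖) ^ 5)⁻¹) :
    Integrable fun ξ => W ξ * ∫ k, γ k * expPair k x * S (ξ - k 0) := by
  have h := (integrable_prod_weight γ S x hm hW).integral_prod_left
  simpa only [integral_const_mul] using h

lemma integral_weight_mul_integral (hm : Measurable W)
    (hW : Integrable fun w => ‖W w‖ * ((1 + ‖w‖) ^ 5)⁻¹) :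
    ∫ ξ, W ξ * ∫ k, γ k * expPair k x * S (ξ - k 0) =
      ∫ k, γ k * expPair k x * corr W S (k 0) := by
  simp only [← integral_const_mul]
  rw [integral_integral_swap (f := fun (ξ : ℂ) (k : Fin (d + 1) → ℂ) =>
    W ξ * (γ k * expPair k x * S (ξ - k 0))) (integrable_prod_weight γ S x hm hW)]
  refine integral_congr_ae (ae_of_all _ fun k => ?_)
  simp only [corr, smul_eq_mul, ← integral_const_mul]
  refine integral_congr_ae (ae_of_all _ fun ξ => ?_)
  simp only
  ring

/-- A character factors under translation, so its correlation with `S` is itself times the Fourier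
transform of `S`. -/
lemma corr_expK (hS : ∀ u, χ u = ∫ ξ, S ξ * expK ξ u) (u κ : ℂ) :
    corr (fun ξ => expK ξ u) S κ = expK κ u * χ u := by
  rw [corr, ← integral_add_right_eq_self _ κ, hS, ← integral_const_mul]
  refine integral_congr_ae (ae_of_all _ fun ξ => ?_)
  have : expK (ξ + κ) u = expK ξ u * expK κ u := by
    rw [expK, expK, expK, ← Complex.exp_add, add_mul, Complex.add_im]
    congr 1; push_cast; ring
  simp only [add_sub_cancel_right, smul_eq_mul, this]
  ring

/-- The homogeneous kernel, cut off by `χ`, acts as a Fourier multiplier. -/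
theorem kernelDist_cutoff {j : ℂ} (hj : -1 < j.re ∧ j.re < 0)
    (hS : ∀ u, χ u = ∫ ξ, S ξ * expK ξ u) :
    kernelDist j (fun u => χ u * pairFourier d γ (x + Pi.single 0 u)) =
      Complex.Gamma (-2 * j) / Complex.Gamma (2 * j + 2) *
        ∫ k, γ k * expPair k x * corr (fun w => (‖w‖ : ℂ) ^ (4 * j + 2)) S (k 0) := by
  have hre : (2 * j + 2).re = 2 * j.re + 2 := by simp
  have hre' : (4 * j + 2).re = 4 * j.re + 2 := by simp
  have hF : Continuous fun u : ℂ => pairFourier d γ (x + Pi.single 0 u) :=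
    (pairFourier d γ).continuous.comp (continuous_const.add
      (continuous_single (A := fun _ : Fin (d + 1) => ℂ) 0))
  have hi1 := integrable_weight_mul_integral γ S x measurable_const
    (integrable_one_weight (W := fun _ => 1) (by simp))
  -- This `g` is the density in `ξ` whose Fourier transform is `u ↦ χ u * pairFourier d γ (x + u
  -- e_0)`: a convolution in the variable dual to `x_0`.
  rw [kernelDist_eq hj (g := fun ξ => ∫ k, γ k * expPair k x * S (ξ - k 0)),
    integral_weight_mul_integral γ S x (by fun_prop)
      (integrable_cpow_weight (by rw [hre']; linarith [hj.1]) (by rw [hre']; linarith [hj.2]))]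
  · simpa only [one_mul] using hi1
  · have h := integrable_weight_mul_integral γ S x (by fun_prop) integrable_sq_weight
    refine h.norm.congr (ae_of_all _ fun ξ => ?_)
    simp only [norm_mul, Complex.norm_real, norm_pow, norm_norm]
  · have h := integrable_weight_mul_integral γ S x
      (Complex.measurable_ofReal.comp (measurable_gaussWeight (2 * j + 2)))
      (integrable_gaussWeight (by rw [hre]; linarith [hj.1]) (by rw [hre]; linarith [hj.2]))
    refine h.norm.congr (ae_of_all _ fun ξ => ?_)
    simp only [norm_mul, Function.comp_apply, Complex.norm_real,
      Real.norm_of_nonneg (gaussWeight_nonneg _ ξ)]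
  · intro u
    have h := integral_weight_mul_integral γ S x (W := fun ξ => expK ξ u) (by fun_prop)
      (integrable_one_weight fun ξ => norm_expK ξ u)
    simp only [corr_expK S χ hS] at h
    simp only [mul_comm (∫ k, _ ∂_) (expK _ u)]
    rw [h, pairFourier_apply, ← integral_const_mul]
    refine integral_congr_ae (ae_of_all _ fun k => ?_)
    have e := expPair_add_single k x u
    rw [expPair] at e
    simp only [e]
    ring
  · exact (χ.continuous.mul hF).measurable
  · obtain ⟨C, -, hC⟩ := exists_norm_schwartz_le (pairFourier d γ) 0
    exact χ.integrable.mul_bdd (c := C) hF.aestronglyMeasurable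
      (ae_of_all _ fun u => by simpa using hC (x + Pi.single 0 u))

end CutoffKernel

/-! ### The limit of the cut-off operators and the conclusion -/

section Reflection

variable {d : ℕ}

/-- The cut-off operator multiplies the Fourier side by `c * corr A (S L) (k 0)`, a mollification of
`A` at scale `1 / L`. Temperate growth keeps `g L` Schwartz, and dominated convergence gives the
limit. -/
theorem isReflection_of_fourier {j : ℂ} (hj : -1 < j.re ∧ j.re < 0)
    {T T' : 𝓢'(Fin (d + 1) → ℂ, ℂ)} {Ψ Ψ' : (Fin (d + 1) → ℂ) → ℂ}
    (hT : HasFourierTransform T Ψ) (hT' : HasFourierTransform T' Ψ')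
    (hΨ : ∀ᵐ k, Ψ' k = (‖k 0‖ : ℂ) ^ (4 * j + 2) * Ψ k) :
    IsReflection j T ((Complex.Gamma (-2 * j) / Complex.Gamma (2 * j + 2)) • T') := by
  rw [hasFourierTransform_iff] at hT hT'
  intro η hη h1 h2 f
  set c := Complex.Gamma (-2 * j) / Complex.Gamma (2 * j + 2)
  set A : ℂ → ℂ := fun w => (‖w‖ : ℂ) ^ (4 * j + 2) with hA
  have hre : (4 * j + 2).re = 4 * j.re + 2 := by simp
  have hs1 : -2 < (4 * j + 2).re := by rw [hre]; linarith [hj.1]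
  have hs2 : (4 * j + 2).re < 2 := by rw [hre]; linarith [hj.2]
  have hAm : Measurable A := by fun_prop
  obtain ⟨χ, hχ⟩ := exists_schwartz_cutoff hη h1 h2
  obtain ⟨Φ, hΦ⟩ := exists_complexFourier
  set G := Φ.symm χ with hG
  have hGχ : ∀ u, ∫ ξ, G ξ * expK ξ u = χ u := fun u => by
    have := hΦ G u
    rw [hG, ContinuousLinearEquiv.apply_symm_apply] at this
    exact this.symm
  -- The mollifier has total mass `χ 0 = η 0 = 1`, hence the limit does not depend on the cut-off.
  have hG1 : ∫ ξ, G ξ = 1 := by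
    have := hGχ 0
    simpa [expK_zero, hχ, h1 0 zero_le_one] using this
  choose! S hS using fun (L : ℝ) (hL : 0 < L) => exists_schwartz_dilation G hL
  have hcorr : ∀ L > 0, ∀ κ, corr A (S L) κ = ∫ ξ, A (κ + L⁻¹ • ξ) * G ξ := fun L hL κ =>
    integral_dilation hL (hS L hL) A κ
  set γ := (pairFourier d).symm f with hγ
  have hf : pairFourier d γ = f := ContinuousLinearEquiv.apply_symm_apply _ _
  have hgr : ∀ L, (fun k : Fin (d + 1) → ℂ => c * corr A (S L) (k 0)).HasTemperateGrowth :=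
    fun L => (Function.HasTemperateGrowth.const c).mul
      ((hasTemperateGrowth_corr hAm (integrable_cpow_weight hs1 hs2) (S L)).comp
        (ContinuousLinearMap.proj (R := ℝ) (φ := fun _ : Fin (d + 1) => ℂ) 0).hasTemperateGrowth)
  set g : ℝ → 𝓢(Fin (d + 1) → ℂ, ℂ) := fun L => pairFourier d
    (SchwartzMap.smulLeftCLM ℂ (fun k => c * corr A (S L) (k 0)) γ) with hg
  refine ⟨g, fun L hL x => ?_, ?_⟩
  · have e : ∀ u, ((η (‖u‖ / L) : ℝ) : ℂ) = ∫ ξ, S L ξ * expK ξ u := fun u => by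
      have h3 : ‖L⁻¹ • u‖ = ‖u‖ / L := by
        rw [norm_smul, Real.norm_of_nonneg (by positivity), inv_mul_eq_div]
      have h4 := integral_dilation hL (hS L hL) (fun w => expK w u) 0
      simp only [sub_zero, zero_add] at h4
      rw [← h3, ← hχ, ← hGχ]
      simp only [mul_comm (S L _) (expK _ _)]
      rw [h4]
      refine integral_congr_ae (ae_of_all _ fun ξ => ?_)
      simp only [expK, smul_mul_assoc, mul_smul_comm, mul_comm (G ξ)]
    have h5 := kernelDist_cutoff γ (S L) (Φ (S L)) x hj (hΦ (S L))
    have h6 : ∀ u, Φ (S L) u = ((η (‖u‖ / L) : ℝ) : ℂ) := fun u => (hΦ (S L) u).trans (e u).symm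
    simp only [h6, hf] at h5
    rw [h5, hg, pairFourier_apply, ← integral_const_mul]
    refine integral_congr_ae (ae_of_all _ fun k => ?_)
    simp only [SchwartzMap.smulLeftCLM_apply_apply (hgr L), smul_eq_mul, expPair]
    ring
  · have hT1 : ∀ L, T (g L) = ∫ k, (Ψ k * γ k) * (c * corr A (S L) (k 0)) := fun L => by
      rw [hg, (hT _).2]
      refine integral_congr_ae (ae_of_all _ fun k => ?_)
      simp only [SchwartzMap.smulLeftCLM_apply_apply (hgr L), smul_eq_mul]
      ring
    have hT2 : (c • T') f = ∫ k, (Ψ k * γ k) * (c * (‖k 0‖ : ℂ) ^ (4 * j + 2)) := by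
      have e1 : (c • T') f = c * T' f := by simp
      rw [e1, ← hf, (hT' γ).2, ← integral_const_mul]
      refine integral_congr_ae ?_
      filter_upwards [hΨ] with k hk
      rw [hk]
      ring
    obtain ⟨C, hC⟩ := exists_norm_integral_cpow_add_smul_le hs1 hs2 G
    have hk0 : ∀ᵐ k : Fin (d + 1) → ℂ, k 0 ≠ 0 := ae_apply_ne 0 0
    simp only [hT1, hT2]
    refine tendsto_integral_filter_of_dominated_convergence
      -- The bound `1 + ‖k 0‖ ^ (4 * j + 2).re` on the multiplier, times `‖Ψ γ‖`, is `‖Ψ γ‖ + ‖Ψ'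
      -- γ‖`; both terms are integrable because both functions are Fourier transforms of tempered
      -- distributions.
      (fun k => ‖c‖ * C * (‖Ψ k * γ k‖ + ‖Ψ' k * γ k‖))
      (Eventually.of_forall fun L => (hT γ).1.1.mul (hgr L).1.continuous.aestronglyMeasurable) ?_
      (((hT γ).1.norm.add (hT' γ).1.norm).const_mul _) ?_
    · filter_upwards [eventually_ge_atTop 1] with L hL
      filter_upwards [hk0, hΨ] with k hk hk'
      have h3 := hC L hL (k 0) hk
      rw [hcorr L (by linarith), norm_mul, norm_mul c, hk', norm_mul _ (γ k), norm_mul _ (γ k),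
        norm_mul _ (Ψ k), norm_norm_cpow hk]
      calc _ ≤ ‖Ψ k‖ * ‖γ k‖ * (‖c‖ * (C * (1 + ‖k 0‖ ^ (4 * j + 2).re))) := by gcongr
        _ = _ := by ring
    · filter_upwards [hk0] with k hk
      have h3 := tendsto_integral_cpow_add_smul hs1 hs2 G hk
      rw [integral_const_mul, hG1, mul_one] at h3
      refine ((h3.congr' ?_).const_mul c).const_mul _
      filter_upwards [eventually_gt_atTop 0] with L hL
      rw [hcorr L hL]

end Reflection

/-- Reflecting `j_0` multiplies the twist by `|k_0|^{-4 j_0 - 2}`. -/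
lemma twist_eq_mul_twist_update {d : ℕ} {z j : Fin (d + 2) → ℂ} {jn : ℂ} {i : Fin 2}
    {k : Fin (d + 1) → ℂ} (hk : k 0 ≠ 0) :
    twist z j jn i k = (‖k 0‖ : ℂ) ^ (4 * j 0 + 2) *
      twist z (Function.update j 0 (-j 0 - 1)) jn i k := by
  have hn : (‖k 0‖ : ℂ) ≠ 0 := by simpa using hk
  simp only [twist, Fin.prod_univ_succ, Function.update_self, allK_zero, ne_eq, Fin.succ_ne_zero,
    not_false_eq_true, Function.update_of_ne]
  have e : (‖k 0‖ : ℂ) ^ (2 * j 0 + 2) =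
      (‖k 0‖ : ℂ) ^ (4 * j 0 + 2) * (‖k 0‖ : ℂ) ^ (2 * (-j 0 - 1) + 2) := by
    rw [← Complex.cpow_add _ _ hn]
    congr 1
    ring
  rw [e]
  ring

theorem IsSoVTransform.isReflection {d : ℕ} {z : Fin (d + 2) → ℂ} (hz : Function.Injective z)
    {j : Fin (d + 2) → ℂ} {jn : ℂ} {i : Fin 2} (hj0 : -1 < (j 0).re ∧ (j 0).re < 0)
    {φ : (Fin d → ℂ) → ℂ} {T T' : 𝓢'(Fin (d + 1) → ℂ, ℂ)} (hT : IsSoVTransform z j jn i T φ)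
    (hT' : IsSoVTransform z (Function.update j 0 (-j 0 - 1)) jn i T' φ) :
    IsReflection (j 0) T
      ((Complex.Gamma (-2 * j 0) / Complex.Gamma (2 * j 0 + 2)) • T') := by
  obtain ⟨Ψ, hΨ, hφ⟩ := hT
  obtain ⟨Ψ', hΨ', hφ'⟩ := hT'
  refine isReflection_of_fourier hj0 hΨ hΨ' ?_
  filter_upwards [ae_twist_mul_eq hz hφ hφ', ae_rho_allK_ne_zero hz] with k hk hk'
  have h0 : k 0 ≠ 0 := by simpa only [allK_zero] using hk'.2 0
  rw [twist_eq_mul_twist_update h0] at hk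
  refine mul_left_cancel₀ (twist_ne_zero hk'.1 hk'.2) (hk.symm.trans ?_)
  ring

end SoV

end

theorem mainTheorem8 (d : ℕ) (z : Fin (d + 2) → ℂ) (hz : Function.Injective z)
    (j : Fin (d + 2) → ℂ) (jn : ℂ) (i : Fin 2)
    (hj0 : -1 < (j 0).re ∧ (j 0).re < 0)
    (hj : ∀ r, r ≠ 0 → (j r).re = -1 / 2) (hjn : jn.re = -1 / 2)
    (φ : (Fin d → ℂ) → ℂ) (hφ : SoV.MemSkl z φ) :
    (∃! T' : 𝓢'(Fin (d + 1) → ℂ, ℂ), SoV.IsSoVTransform z j jn i T' φ) ∧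
    (∃! T'' : 𝓢'(Fin (d + 1) → ℂ, ℂ),
      SoV.IsSoVTransform z (Function.update j 0 (-j 0 - 1)) jn i T'' φ) ∧
    ∀ T' T'' : 𝓢'(Fin (d + 1) → ℂ, ℂ),
      SoV.IsSoVTransform z j jn i T' φ →
      SoV.IsSoVTransform z (Function.update j 0 (-j 0 - 1)) jn i T'' φ →
      SoV.IsReflection (j 0) T'
        ((Complex.Gamma (-2 * j 0) / Complex.Gamma (2 * j 0 + 2)) • T'') := by
  refine ⟨?_, ?_, fun T' T'' h' h'' => h'.isReflection hz hj0 h''⟩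
  · obtain ⟨T, hT⟩ := SoV.exists_isSoVTransform hz i hj0 hj hjn hφ
    exact ⟨T, hT, fun T₁ h₁ => h₁.unique hz hT⟩
  · obtain ⟨T, hT⟩ := SoV.exists_isSoVTransform hz i (j := Function.update j 0 (-j 0 - 1))
      (by
        simp only [Function.update_self, Complex.sub_re, Complex.neg_re, Complex.one_re]
        constructor <;> linarith [hj0.1, hj0.2]) (fun r hr => by simpa [hr] using hj r hr) hjn hφ
    exact ⟨T, hT, fun T₁ h₁ => h₁.unique hz hT⟩
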